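/- Let $n\in\mathbb N$, $h>0$, $h^*=\frac{h}{2\pi}$, and let $d\mu_h = h^{-n}\,dp\,dq$ on $\mathbb R^{2n}=\{z=(p,q): p,q\in\mathbb R^n\}$. For $\psi\in L^2(\mathbb R^n,dx)$ (complex valued) let $$\mathcal L\psi(p,q)=\Big(\frac2h\Big)^{n/4} e^{i p\cdot q/2h^*}\int_{\mathbb R^n} e^{i p\cdot x/h^*}\,e^{-|x-q|^2/2h^*}\,\psi(x)\,dx$$ be the coherent state transform (an isometry of $L^2(\mathbb R^n,dx)$ into $L^2(\mathbb R^{2n},\mu_h)$). For a density $\rho$ on $(\mathbb R^{2n},\mu_h)$ let $S(\rho)=-\int\rho\log\rho\,d\mu_h$ and let $\delta_{\rm Wehrl}(\rho)=S(\rho)-n$ be the Wehrl deficit. Let $\gamma$ be the standard Gaussian probability measure on $\mathbb R^{2n}$. A probability measure $\nu$ on $\mathbb R^{2n}$ satisfies a Poincaré inequality with constant $\lambda>0$ if $\lambda\int g^2\,d\nu\le\int|\nabla g|^2\,d\nu$ for every smooth $\nu$-integrable $g:\mathbb R^{2n}\to\mathbb R$ with $\int g\,d\nu=0$ (both sides may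 be $+\infty$). Let $$W_2(\nu,\mu)=\inf_\pi\Big(\iint|x-y|^2\,d\pi(x,y)\Big)^{1/2},$$ the infimum being over all couplings $\pi$ of $\nu$ and $\mu$. **Theorem.** Let $\psi\in L^2(\mathbb R^n,dx)$ be such that $\rho=|\mathcal L\psi|^2$ is a probability density on $(\mathbb R^{2n},\mu_h)$ with finite second moments, $\int|z|^2\rho\,d\mu_h<\infty$, and let $b=\int z\,\rho(z)\,d\mu_h(z)$ be its barycenter. Suppose that, for some $\lambda>0$, the probability measure with density $$z\mapsto e^{|z|^2/2}\,\rho\Big(\sqrt{\tfrac{h}{2\pi}}\,z\Big)$$ with respect to $\gamma$ satisfies a Poincaré inequality with constant $\lambda$. Let $$d\nu_{\rho,b}(z)=e^{|z|^2/2}\,\rho\Big(\sqrt{\tfrac{h}{2\pi}}\,z+b\Big)\,d\gamma(z).$$ Then $\rho\log\rho$ is $\mu_h$-integrable, $W_2(\nu_{\rho,b},\gamma)<\infty$, and $$\delta_{\rm Wehrl}(\rho)\ \ge\ c_2(\lambda)\,W_2(\nu_{\rho,b},\gamma)^2,$$ where $$c_2(\lambda)=\frac12\Big(\frac1{c(\lambda)}-1\Big),\qquad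 c(\lambda)=\frac{1-\lambda+\lambda\log\lambda}{(1-\lambda)^2}\ \ (\lambda\ne1),\qquad c(1)=\frac12 .$$ -/

import Mathlib

open MeasureTheory
open scoped ENNReal ContDiff

noncomputable section

namespace WehrlStability

/-- Phase space `ℝ^{2n} = ℝ^n_p × ℝ^n_q` with its Euclidean structure: the coordinates `Sum.inl i`
are the momenta `p_i`, the coordinates `Sum.inr i` are the positions `q_i`. -/
abbrev PhaseSpace (n : ℕ) : Type := EuclideanSpace ℝ (Fin n ⊕ Fin n)

/-- The momentum part `p` of a phase space point `(p, q)`. -/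
def momentum {n : ℕ} (z : PhaseSpace n) : EuclideanSpace ℝ (Fin n) :=
  WithLp.toLp 2 (fun i => z (Sum.inl i))

/-- The position part `q` of a phase space point `(p, q)`. -/
def position {n : ℕ} (z : PhaseSpace n) : EuclideanSpace ℝ (Fin n) :=
  WithLp.toLp 2 (fun i => z (Sum.inr i))

/-- `h^* = h / 2π`. -/
def hstar (h : ℝ) : ℝ := h / (2 * Real.pi)

/-- The measure `μ_h = h^{-n} dp dq` on phase space. -/
def phaseMeasure (n : ℕ) (h : ℝ) : Measure (PhaseSpace n) :=
  ENNReal.ofReal ((h ^ n)⁻¹) • (volume : Measure (PhaseSpace n))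

/-- The coherent state transform
`𝓛ψ(p,q) = (2/h)^{n/4} e^{i p·q / 2h^*} ∫ e^{i p·x / h^*} e^{-|x-q|² / 2h^*} ψ(x) dx`.
The factor `(2/h)^{n/4}` makes it an isometry from `L²(ℝⁿ, dx)` into `L²(μ_h)`. -/
def coherentTransform {n : ℕ} (h : ℝ) (ψ : EuclideanSpace ℝ (Fin n) → ℂ) (z : PhaseSpace n) : ℂ :=
  (((2 / h) ^ ((n : ℝ) / 4) : ℝ) : ℂ) *
    Complex.exp (Complex.I *
      ((inner ℝ (momentum z) (position z) / (2 * hstar h) : ℝ) : ℂ)) *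
    ∫ x : EuclideanSpace ℝ (Fin n),
      Complex.exp (Complex.I * ((inner ℝ (momentum z) x / hstar h : ℝ) : ℂ)) *
        ((Real.exp (-‖x - position z‖ ^ 2 / (2 * hstar h)) : ℝ) : ℂ) * ψ x

/-- The phase space density `ρ = |𝓛ψ|²`. -/
def phaseDensity {n : ℕ} (h : ℝ) (ψ : EuclideanSpace ℝ (Fin n) → ℂ) (z : PhaseSpace n) : ℝ :=
  ‖coherentTransform h ψ z‖ ^ 2

/-- The barycenter `b_ρ = ∫ z ρ(z) dμ_h(z)`. -/
def barycenter {n : ℕ} (h : ℝ) (ρ : PhaseSpace n → ℝ) : PhaseSpace n :=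
  ∫ z, ρ z • z ∂(phaseMeasure n h)

/-- The (physical) entropy `S(ρ) = - ∫ ρ log ρ dμ_h`. -/
def entropy {n : ℕ} (h : ℝ) (ρ : PhaseSpace n → ℝ) : ℝ :=
  -∫ z, ρ z * Real.log (ρ z) ∂(phaseMeasure n h)

/-- The Wehrl deficit `δ_Wehrl(ρ) = S(ρ) - n`. -/
def wehrlDeficit {n : ℕ} (h : ℝ) (ρ : PhaseSpace n → ℝ) : ℝ :=
  entropy h ρ - n

/-- The standard Gaussian measure on phase space. -/
def gaussian (n : ℕ) : Measure (PhaseSpace n) :=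
  ProbabilityTheory.stdGaussian (PhaseSpace n)

/-- The measure `e^{|z|²/2} ρ(√(h/2π) z + a) dγ(z)`. -/
def rescaledMeasure {n : ℕ} (h : ℝ) (ρ : PhaseSpace n → ℝ) (a : PhaseSpace n) :
    Measure (PhaseSpace n) :=
  (gaussian n).withDensity fun z =>
    ENNReal.ofReal (Real.exp (‖z‖ ^ 2 / 2) * ρ (√(h / (2 * Real.pi)) • z + a))

/-- The Poincaré inequality with constant `lam`: `lam ∫ g² dν ≤ ∫ |∇g|² dν` for every smooth
`ν`-integrable real function `g` of `ν`-mean zero; both sides may be `+∞`. -/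
def SatisfiesPoincare {E : Type*} [NormedAddCommGroup E] [InnerProductSpace ℝ E]
    [CompleteSpace E] [MeasurableSpace E] (ν : Measure E) (lam : ℝ) : Prop :=
  ∀ g : E → ℝ, ContDiff ℝ ∞ g → Integrable g ν → ∫ x, g x ∂ν = 0 →
    ENNReal.ofReal lam * ∫⁻ x, ENNReal.ofReal (g x ^ 2) ∂ν ≤
      ∫⁻ x, ENNReal.ofReal (‖gradient g x‖ ^ 2) ∂ν

/-- `π` is a coupling of `ν` and `μ`. -/
def IsCoupling {E : Type*} [MeasurableSpace E] (π : Measure (E × E)) (ν μ : Measure E) : Prop :=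
  π.map Prod.fst = ν ∧ π.map Prod.snd = μ

/-- The quadratic Kantorovich–Wasserstein distance, as an extended nonnegative real. -/
def W2 {E : Type*} [PseudoEMetricSpace E] [MeasurableSpace E] (ν μ : Measure E) : ℝ≥0∞ :=
  ⨅ (π : Measure (E × E)) (_ : IsCoupling π ν μ),
    (∫⁻ w, edist w.1 w.2 ^ 2 ∂π) ^ (1 / 2 : ℝ)

/-- `c(λ) = (1 - λ + λ log λ) / (1 - λ)²`, with `c(1) = 1/2`. -/
def cConst (lam : ℝ) : ℝ :=
  if lam = 1 then 1 / 2 else (1 - lam + lam * Real.log lam) / (1 - lam) ^ 2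

/-- `c₂(λ) = (1/2) (1/c(λ) - 1)`. -/
def c2Const (lam : ℝ) : ℝ := (1 / 2) * (1 / cConst lam - 1)

end WehrlStability

end

open MeasureTheory ProbabilityTheory Set Filter Topology InformationTheory
open scoped ENNReal NNReal ContDiff

noncomputable section

namespace WehrlStability

/-! Let f(x) = exp(|x|²/2) ρ(√(h/2π) x + b), where b is the barycenter. It is a probability density
relative to the standard Gaussian γ on ℝ^{2n}, and the measure ν = fγ is centred. Put H = ∫ f log f
dγ and M = ∑ᵢ ∫ (xᵢ² − 1) f dγ. A change of variables turns the Wehrl deficit into M/2 − H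
(`wehrlDeficit_eq`). It therefore suffices to prove H ≤ c(λ) M/2. Then M/2 − H ≥ (1/c(λ) − 1) H,
with a positive coefficient because 0 < c(λ) < 1 (`cConst_mem`), and Talagrand's inequality H ≥
W₂²/2 (`W2_le`) concludes.

The coherent state transform enters through one fact: f = |G|² with G holomorphic in q + ip
(`rescaledDensity_eq_norm_sq`). Hence Δf ≥ 0 and |∇f|² = f Δf, so the Fisher information I = ∫
|∇f|²/f dγ is at most ∫ Δf dγ, which integration by parts bounds by M
(`IsLaplacianDensity.fisher_le`). What remains is an improved logarithmic Sobolev inequality H ≤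
c(λ) I/2 for a centred measure with Poincaré constant λ.

For that inequality, run the Mehler flow: f_r is the density of rX + √(1 − r²) Z, with X of law ν
and Z an independent Gaussian, and P_r is the dual operator on functions. Write v = r². Testing ∇f_r
against g amounts to pairing r P_r g with the score of ν. The score has mean zero, so only the
ν-variance of P_r g counts. The Poincaré inequality, together with the reverse inequality (1 −
v)|∇P_r g|² ≤ v (P_r(g²) − (P_r g)²), bounds this variance by v/(v + λ(1 − v)) ∫ g² f_r dγ.
Consequently the Fisher information of f_r is at most v · v/(v + λ(1 − v)) · I
(`lintegral_fisher_flowDensity_le`). In terms of v, the entropy then grows at rate at most half of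
v/(v + λ(1 − v)) · I, and the integral of v/(v + λ(1 − v)) over [0, 1] is exactly c(λ).

The entropy is never differentiated. Finite steps in one coordinate are compared by the
one-dimensional logarithmic Sobolev inequality on slices (`lintegral_klFun_flowDensity_le`), a
Riemann sum replaces the integral, and v → 1 is handled by lower semicontinuity
(`lintegral_klFun_le_of_flowDensity`).

The two one-dimensional inputs, Talagrand and logarithmic Sobolev, both come from the monotone map T
onto the Gaussian and from log t ≤ t − 1, applied to 1/T' and T' respectively. Talagrand's
inequality reaches higher dimension through the Knothe map. -/

/-! ### The standard Gaussian distribution on the line and its quantile function -/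

/-- The standard Gaussian measure on the line. -/
abbrev gaussLine : Measure ℝ := gaussianReal 0 1

/-- The standard Gaussian density. -/
abbrev gaussPDF (x : ℝ) : ℝ := gaussianPDFReal 0 1 x

lemma gaussPDF_eq (x : ℝ) : gaussPDF x = (√(2 * Real.pi))⁻¹ * Real.exp (-x ^ 2 / 2) := by
  simp [gaussPDF, gaussianPDFReal]

lemma gaussPDF_pos (x : ℝ) : 0 < gaussPDF x := gaussianPDFReal_pos _ _ _ one_ne_zero

lemma hasDerivAt_gaussPDF (x : ℝ) : HasDerivAt gaussPDF (-x * gaussPDF x) x := by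
  have h1 : HasDerivAt (fun x : ℝ => -x ^ 2 / 2) (-x) x :=
    ((hasDerivAt_pow 2 x).fun_neg.div_const 2).congr_deriv (by norm_num; ring)
  have h2 := (h1.exp.const_mul (√(2 * Real.pi))⁻¹)
  have h3 : gaussPDF = fun x => (√(2 * Real.pi))⁻¹ * Real.exp (-x ^ 2 / 2) := by
    ext x; exact gaussPDF_eq x
  rw [h3]
  exact h2.congr_deriv (by ring)

lemma continuous_gaussPDF : Continuous gaussPDF :=
  continuous_iff_continuousAt.2 fun x => (hasDerivAt_gaussPDF x).continuousAt

lemma gaussLine_eq : gaussLine = volume.withDensity fun x => ENNReal.ofReal (gaussPDF x) :=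
  gaussianReal_of_var_ne_zero 0 one_ne_zero

lemma integral_gaussLine (g : ℝ → ℝ) : ∫ x, g x ∂gaussLine = ∫ x, gaussPDF x * g x := by
  rw [integral_gaussianReal_eq_integral_smul one_ne_zero]; rfl

lemma lintegral_gaussLine (g : ℝ → ℝ≥0∞) :
    ∫⁻ x, g x ∂gaussLine = ∫⁻ x, ENNReal.ofReal (gaussPDF x) * g x := by
  rw [gaussLine_eq, lintegral_withDensity_eq_lintegral_mul_non_measurable₀]
  · rfl
  · exact (continuous_gaussPDF.measurable.ennreal_ofReal).aemeasurable
  · exact ae_of_all _ fun x => ENNReal.ofReal_lt_top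

lemma integrable_gaussLine_iff (g : ℝ → ℝ) :
    Integrable g gaussLine ↔ Integrable fun x => gaussPDF x * g x := by
  rw [gaussLine_eq, integrable_withDensity_iff_integrable_smul₀']
  · simp [ENNReal.toReal_ofReal (gaussPDF_pos _).le]
  · exact (continuous_gaussPDF.measurable.ennreal_ofReal).aemeasurable
  · exact ae_of_all _ fun x => ENNReal.ofReal_lt_top

instance : NullSingletonClass gaussLine := nullSingletonClass_gaussianReal one_ne_zero

/-- The standard Gaussian distribution function. -/
abbrev gaussCDF (x : ℝ) : ℝ := cdf gaussLine x

lemma gaussCDF_eq (x : ℝ) : gaussCDF x = ∫ t in Iic x, gaussPDF t := by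
  rw [gaussCDF, cdf_eq_real, Measure.real, gaussLine,
    gaussianReal_apply_eq_integral 0 one_ne_zero, ENNReal.toReal_ofReal]
  exact integral_nonneg fun t => (gaussPDF_pos t).le

lemma hasDerivAt_setIntegral_Iic {g : ℝ → ℝ} (hg : Integrable g) (hc : Continuous g) (x : ℝ) :
    HasDerivAt (fun x => ∫ t in Iic x, g t) (g x) x := by
  have h1 : (fun x => ∫ t in Iic x, g t) = fun x => (∫ t in Iic 0, g t) + ∫ t in (0:ℝ)..x, g t := by
    ext x
    rw [← intervalIntegral.integral_Iic_sub_Iic hg.integrableOn hg.integrableOn]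
    ring
  rw [h1]
  exact (intervalIntegral.integral_hasDerivAt_right hg.intervalIntegrable
    (hc.stronglyMeasurableAtFilter _ _) hc.continuousAt).const_add _

lemma hasDerivAt_gaussCDF (x : ℝ) : HasDerivAt gaussCDF (gaussPDF x) x := by
  have h : gaussCDF = fun x => ∫ t in Iic x, gaussPDF t := by ext x; exact gaussCDF_eq x
  rw [h]
  exact hasDerivAt_setIntegral_Iic (integrable_gaussianPDFReal 0 1) continuous_gaussPDF x

lemma continuous_gaussCDF : Continuous gaussCDF :=
  continuous_iff_continuousAt.2 fun x => (hasDerivAt_gaussCDF x).continuousAt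

lemma strictMono_gaussCDF : StrictMono gaussCDF :=
  strictMono_of_hasDerivAt_pos (fun x => hasDerivAt_gaussCDF x) fun x => gaussPDF_pos x

lemma gaussCDF_mem (x : ℝ) : gaussCDF x ∈ Ioo (0 : ℝ) 1 :=
  ⟨(cdf_nonneg _ (x - 1)).trans_lt (strictMono_gaussCDF (by linarith)),
    (strictMono_gaussCDF (show x < x + 1 by linarith)).trans_le (cdf_le_one _ _)⟩

lemma exists_gaussCDF_eq {u : ℝ} (hu : u ∈ Ioo (0 : ℝ) 1) : ∃ x, gaussCDF x = u := by
  obtain ⟨a, ha⟩ := ((tendsto_cdf_atBot gaussLine).eventually_lt_const hu.1).exists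
  obtain ⟨b, hb⟩ := ((tendsto_cdf_atTop gaussLine).eventually_const_lt hu.2).exists
  exact mem_range_of_exists_le_of_exists_ge continuous_gaussCDF ⟨a, ha.le⟩ ⟨b, hb.le⟩

/-- The Gaussian quantile function, the inverse of `gaussCDF` (and `0` outside `(0, 1)`). -/
def gaussQuantile (u : ℝ) : ℝ := if h : u ∈ Ioo (0 : ℝ) 1 then (exists_gaussCDF_eq h).choose else 0

lemma gaussCDF_gaussQuantile {u : ℝ} (hu : u ∈ Ioo (0 : ℝ) 1) : gaussCDF (gaussQuantile u) = u := by
  rw [gaussQuantile, dif_pos hu]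
  exact (exists_gaussCDF_eq hu).choose_spec

lemma gaussQuantile_gaussCDF (x : ℝ) : gaussQuantile (gaussCDF x) = x :=
  strictMono_gaussCDF.injective (gaussCDF_gaussQuantile (gaussCDF_mem x))

lemma gaussQuantile_le_iff {u : ℝ} (hu : u ∈ Ioo (0 : ℝ) 1) (x : ℝ) :
    gaussQuantile u ≤ x ↔ u ≤ gaussCDF x := by
  rw [← strictMono_gaussCDF.le_iff_le, gaussCDF_gaussQuantile hu]

lemma continuousAt_gaussQuantile {u : ℝ} (hu : u ∈ Ioo (0 : ℝ) 1) :
    ContinuousAt gaussQuantile u := by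
  have hmono : StrictMonoOn gaussQuantile (Ioo 0 1) := by
    intro a ha b hb hab
    rw [← strictMono_gaussCDF.lt_iff_lt, gaussCDF_gaussQuantile ha, gaussCDF_gaussQuantile hb]
    exact hab
  refine hmono.continuousAt_of_image_mem_nhds (isOpen_Ioo.mem_nhds hu) ?_
  have : gaussQuantile '' Ioo 0 1 = univ := by
    refine eq_univ_of_forall fun x => ⟨gaussCDF x, gaussCDF_mem x, gaussQuantile_gaussCDF x⟩
  rw [this]
  exact univ_mem

lemma hasDerivAt_gaussQuantile {u : ℝ} (hu : u ∈ Ioo (0 : ℝ) 1) :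
    HasDerivAt gaussQuantile (gaussPDF (gaussQuantile u))⁻¹ u := by
  refine HasDerivAt.of_local_left_inverse (continuousAt_gaussQuantile hu)
    (hasDerivAt_gaussCDF _) (gaussPDF_pos _).ne' ?_
  filter_upwards [isOpen_Ioo.mem_nhds hu] with v hv
  exact gaussCDF_gaussQuantile hv

lemma measurable_gaussQuantile : Measurable gaussQuantile := by
  have h : gaussQuantile = (Ioo (0 : ℝ) 1).piecewise gaussQuantile 0 := by
    ext u
    by_cases hu : u ∈ Ioo (0 : ℝ) 1
    · simp [hu]
    · rw [piecewise_eq_of_notMem _ _ _ hu, gaussQuantile, dif_neg hu]; rfl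
  rw [h]
  exact ContinuousOn.measurable_piecewise
    (fun u hu => (continuousAt_gaussQuantile hu).continuousWithinAt) continuousOn_const
    measurableSet_Ioo

/-! ### Monotone rearrangement onto the Gaussian -/

/-- The monotone map pushing an atomless probability measure on the line to the Gaussian. -/
def gaussRearr (μ : Measure ℝ) (s : ℝ) : ℝ := gaussQuantile (cdf μ s)

section rearr

variable {μ : Measure ℝ} [IsProbabilityMeasure μ] [NullSingletonClass μ]

lemma measurable_gaussRearr (μ : Measure ℝ) : Measurable (gaussRearr μ) :=
  measurable_gaussQuantile.comp (monotone_cdf μ).measurable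

lemma continuous_cdf_of_nullSingleton : Continuous (cdf μ) := by
  rw [continuous_iff_continuousAt]
  intro x
  rw [(monotone_cdf μ).continuousAt_iff_leftLim_eq_rightLim, (cdf μ).rightLim_eq]
  have h := (cdf μ).measure_singleton x
  rw [measure_cdf, measure_singleton, eq_comm, ENNReal.ofReal_eq_zero] at h
  exact le_antisymm ((monotone_cdf μ).leftLim_le le_rfl) (by linarith)

/-- Without atoms the distribution function F is continuous, so the level set {F ≤ u} is a closed
half-line whose endpoint has F-value exactly u. In other words, F pushes μ to the uniform law on (0,
1). -/
lemma measure_cdf_le {u : ℝ} (hu : u ∈ Ioo (0 : ℝ) 1) :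
    μ {s | cdf μ s ≤ u} = ENNReal.ofReal u := by
  obtain ⟨a, ha⟩ := ((tendsto_cdf_atBot μ).eventually_lt_const hu.1).exists
  obtain ⟨b, hb⟩ := ((tendsto_cdf_atTop μ).eventually_const_lt hu.2).exists
  have hc : Continuous (cdf μ) := continuous_cdf_of_nullSingleton
  have hcl : IsClosed {s | cdf μ s ≤ u} := isClosed_le hc continuous_const
  have hbd : BddAbove {s | cdf μ s ≤ u} := by
    refine ⟨b, fun s hs => ?_⟩
    by_contra hlt
    have := monotone_cdf μ (not_le.1 hlt).le
    have h2 : cdf μ s ≤ u := hs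
    linarith
  have hne : {s | cdf μ s ≤ u}.Nonempty := ⟨a, ha.le⟩
  set c := sSup {s | cdf μ s ≤ u} with hcdef
  have hcm : c ∈ {s | cdf μ s ≤ u} := hcl.csSup_mem hne hbd
  have hset : {s | cdf μ s ≤ u} = Iic c := by
    ext s
    exact ⟨fun hs => le_csSup hbd hs, fun hs => (monotone_cdf μ hs).trans hcm⟩
  obtain ⟨x, hx⟩ : ∃ x, cdf μ x = u :=
    mem_range_of_exists_le_of_exists_ge hc ⟨a, ha.le⟩ ⟨b, hb.le⟩
  have hxc : x ≤ c := le_csSup hbd hx.le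
  rw [hset, ← ofReal_cdf]
  congr 1
  exact le_antisymm hcm (hx ▸ monotone_cdf μ hxc)

lemma ae_cdf_mem : ∀ᵐ s ∂μ, cdf μ s ∈ Ioo (0 : ℝ) 1 := by
  have h0 : μ {s | cdf μ s ≤ 0} = 0 := by
    refine le_antisymm (ENNReal.le_of_forall_pos_le_add fun ε hε _ => ?_) zero_le
    have hm : min (ε : ℝ) (1 / 2) ∈ Ioo (0 : ℝ) 1 :=
      ⟨lt_min (by exact_mod_cast hε) (by norm_num), (min_le_right _ _).trans_lt (by norm_num)⟩
    calc μ {s | cdf μ s ≤ 0} ≤ μ {s | cdf μ s ≤ min (ε : ℝ) (1 / 2)} :=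
          measure_mono fun s (hs : _ ≤ _) => hs.trans hm.1.le
      _ = ENNReal.ofReal (min (ε : ℝ) (1 / 2)) := measure_cdf_le hm
      _ ≤ ENNReal.ofReal ε := ENNReal.ofReal_le_ofReal (min_le_left _ _)
      _ = 0 + ε := by simp
  have h1 : μ {s | 1 ≤ cdf μ s} = 0 := by
    refine le_antisymm (ENNReal.le_of_forall_pos_le_add fun ε hε _ => ?_) zero_le
    have hm : 1 - min (ε : ℝ) (1 / 2) ∈ Ioo (0 : ℝ) 1 := by
      have h1 : (0:ℝ) < min (ε : ℝ) (1 / 2) := lt_min (by exact_mod_cast hε) (by norm_num)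
      have h2 : min (ε : ℝ) (1 / 2) ≤ 1 / 2 := min_le_right _ _
      constructor <;> linarith
    have hms : MeasurableSet {s | cdf μ s ≤ 1 - min (ε : ℝ) (1 / 2)} :=
      measurableSet_le (monotone_cdf μ).measurable measurable_const
    calc μ {s | 1 ≤ cdf μ s} ≤ μ {s | cdf μ s ≤ 1 - min (ε : ℝ) (1 / 2)}ᶜ :=
          measure_mono fun s (hs : 1 ≤ cdf μ s) (hs' : cdf μ s ≤ _) => by linarith [hm.2]
      _ = 1 - ENNReal.ofReal (1 - min (ε : ℝ) (1 / 2)) := by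
          rw [prob_compl_eq_one_sub hms, measure_cdf_le hm]
      _ = ENNReal.ofReal (min (ε : ℝ) (1 / 2)) := by
          rw [← ENNReal.ofReal_one, ← ENNReal.ofReal_sub _ hm.1.le]; congr 1; ring
      _ ≤ ENNReal.ofReal ε := ENNReal.ofReal_le_ofReal (min_le_left _ _)
      _ = 0 + ε := by simp
  have h0' : ∀ᵐ s ∂μ, ¬ cdf μ s ≤ 0 := by rw [ae_iff]; simpa using h0
  have h1' : ∀ᵐ s ∂μ, ¬ 1 ≤ cdf μ s := by rw [ae_iff]; simpa using h1
  filter_upwards [h0', h1'] with s hs hs'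
  exact ⟨not_le.1 hs, not_le.1 hs'⟩

/-- F is uniformly distributed under μ, and the quantile function turns a uniform variable into a
Gaussian one. The a.e. restriction to 0 < F < 1 avoids the default value of `gaussQuantile`. -/
lemma map_gaussRearr : μ.map (gaussRearr μ) = gaussLine := by
  have : IsProbabilityMeasure (μ.map (gaussRearr μ)) :=
    Measure.isProbabilityMeasure_map (measurable_gaussRearr μ).aemeasurable
  refine Measure.ext_of_Iic _ _ fun x => ?_
  rw [Measure.map_apply (measurable_gaussRearr μ) measurableSet_Iic, ← ofReal_cdf,
    ← measure_cdf_le (μ := μ) (gaussCDF_mem x)]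
  refine measure_congr ?_
  filter_upwards [ae_cdf_mem (μ := μ)] with s hs
  exact propext (gaussQuantile_le_iff hs x)

end rearr

/-! ### Gaussian moments and tail integrals of the rearrangement -/

lemma tendsto_gaussPDF_atTop : Tendsto gaussPDF atTop (𝓝 0) := by
  have h3 : gaussPDF = fun x => (√(2 * Real.pi))⁻¹ * Real.exp (-x ^ 2 / 2) := by
    ext x; exact gaussPDF_eq x
  rw [h3, ← mul_zero ((√(2 * Real.pi))⁻¹)]
  refine Tendsto.const_mul _ (Real.tendsto_exp_atBot.comp ?_)
  have : (fun x : ℝ => -x ^ 2 / 2) = fun x => -(x ^ 2 / 2) := by ext; ring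
  rw [this]
  exact tendsto_neg_atTop_atBot.comp ((tendsto_pow_atTop two_ne_zero).atTop_div_const two_pos)

lemma integrable_id_gaussLine : Integrable (fun x : ℝ => x) gaussLine :=
  IsGaussian.integrable_fun_id

lemma integrable_sq_gaussLine : Integrable (fun x : ℝ => x ^ 2) gaussLine :=
  (memLp_id_gaussianReal 2).integrable_sq

lemma integral_sq_gaussLine : ∫ x, x ^ 2 ∂gaussLine = 1 := by
  have h := variance_fun_id_gaussianReal (μ := 0) (v := 1)
  rw [variance_eq_integral (by fun_prop)] at h
  simpa using h

lemma setIntegral_Ioi_gaussLine (a : ℝ) : ∫ t in Ioi a, t ∂gaussLine = gaussPDF a := by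
  have h1 : ∫ t in Ioi a, t ∂gaussLine = ∫ t in Ioi a, t * gaussPDF t := by
    rw [← integral_indicator measurableSet_Ioi, ← integral_indicator measurableSet_Ioi,
      integral_gaussLine]
    congr 1
    ext t
    by_cases ht : t ∈ Ioi a <;> simp [ht, mul_comm]
  have hi : Integrable fun t : ℝ => t * gaussPDF t := by
    simpa [mul_comm] using (integrable_gaussLine_iff _).1 integrable_id_gaussLine
  rw [h1, integral_Ioi_of_hasDerivAt_of_tendsto' (f := fun t => -gaussPDF t) (m := -0)
    (fun t _ => ((hasDerivAt_gaussPDF t).fun_neg).congr_deriv (by ring)) hi.integrableOn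
    tendsto_gaussPDF_atTop.neg]
  simp

section rearr

variable {μ : Measure ℝ} [IsProbabilityMeasure μ] [NullSingletonClass μ]

lemma integral_comp_gaussRearr (g : ℝ → ℝ) (hg : Measurable g) :
    ∫ s, g (gaussRearr μ s) ∂μ = ∫ t, g t ∂gaussLine := by
  rw [← map_gaussRearr (μ := μ), integral_map (measurable_gaussRearr μ).aemeasurable
    hg.aestronglyMeasurable]

lemma integrable_comp_gaussRearr {g : ℝ → ℝ} (hg : Integrable g gaussLine) :
    Integrable (fun s => g (gaussRearr μ s)) μ := by
  rw [← map_gaussRearr (μ := μ)] at hg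
  exact hg.comp_measurable (measurable_gaussRearr μ)

lemma integrable_gaussRearr : Integrable (gaussRearr μ) μ :=
  integrable_comp_gaussRearr integrable_id_gaussLine

lemma integrable_gaussRearr_sq : Integrable (fun s => gaussRearr μ s ^ 2) μ :=
  integrable_comp_gaussRearr integrable_sq_gaussLine

lemma integral_gaussRearr : ∫ s, gaussRearr μ s ∂μ = 0 := by
  rw [integral_comp_gaussRearr (fun t => t) measurable_id]
  exact integral_id_gaussianReal

lemma integral_gaussRearr_sq : ∫ s, gaussRearr μ s ^ 2 ∂μ = 1 := by
  rw [integral_comp_gaussRearr (fun t => t ^ 2) (by fun_prop), integral_sq_gaussLine]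

lemma integrable_mul_gaussRearr (h2 : Integrable (fun s => s ^ 2) μ) :
    Integrable (fun s => s * gaussRearr μ s) μ := by
  refine (h2.add (integrable_gaussRearr_sq (μ := μ))).mono'
    (measurable_id.mul (measurable_gaussRearr μ)).aestronglyMeasurable (ae_of_all _ fun s => ?_)
  simp only [Real.norm_eq_abs, Pi.add_apply, abs_le]
  constructor <;> nlinarith [sq_nonneg (s - gaussRearr μ s), sq_nonneg (s + gaussRearr μ s)]

/-- The tail integral of the rearrangement. -/
def rearrTail (μ : Measure ℝ) (x : ℝ) : ℝ := ∫ y in Ioi x, gaussRearr μ y ∂μ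

/-- This is the integrated form of (φ∘T)' = −T · (density of μ), valid without any differentiability
of T. The event y > x coincides with T(y) > T(x) up to a flat stretch of the distribution function,
which is μ-null; the tail integral then transfers to the Gaussian, where tφ(t) = −φ'(t). -/
lemma rearrTail_eq {x : ℝ} (hx : cdf μ x ∈ Ioo (0 : ℝ) 1) :
    rearrTail μ x = gaussPDF (gaussRearr μ x) := by
  have hset : (Iic x : Set ℝ) =ᵐ[μ] {y | gaussRearr μ y ≤ gaussRearr μ x} := by
    have h1 : (Iic x : Set ℝ) =ᵐ[μ] {y | cdf μ y ≤ cdf μ x} := by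
      refine ae_eq_of_subset_of_measure_ge (fun y hy => monotone_cdf μ hy) ?_
        measurableSet_Iic.nullMeasurableSet (measure_ne_top _ _)
      rw [measure_cdf_le hx, ofReal_cdf]
    refine h1.trans ?_
    filter_upwards [ae_cdf_mem (μ := μ)] with y hy
    refine propext ?_
    change cdf μ y ≤ cdf μ x ↔ gaussRearr μ y ≤ gaussRearr μ x
    rw [gaussRearr, gaussRearr, gaussQuantile_le_iff hy, gaussCDF_gaussQuantile hx]
  have hset' : (Ioi x : Set ℝ) =ᵐ[μ] gaussRearr μ ⁻¹' Ioi (gaussRearr μ x) := by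
    have := hset.compl
    simpa [preimage, compl_ofPred, compl_Iic] using this
  rw [rearrTail, setIntegral_congr_set hset', ← setIntegral_Ioi_gaussLine,
    ← map_gaussRearr (μ := μ)]
  exact (setIntegral_map (f := fun t : ℝ => t) measurableSet_Ioi
      aestronglyMeasurable_id (measurable_gaussRearr μ).aemeasurable).symm

/-- Where the distribution function equals 0 the tail integral is the full mean of T, which
vanishes; where it equals 1 the tail is null. In between it is a value of the Gaussian density. -/
lemma rearrTail_nonneg (x : ℝ) : 0 ≤ rearrTail μ x := by
  rcases (cdf_nonneg μ x).eq_or_lt with h0 | h0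
  · have h : μ (Iic x) = 0 := by rw [← ofReal_cdf, ← h0, ENNReal.ofReal_zero]
    have : (Ioi x : Set ℝ) =ᵐ[μ] univ := by
      rw [← compl_Iic]; exact (ae_eq_univ.2 (by simpa using h))
    rw [rearrTail, setIntegral_congr_set this, setIntegral_univ, integral_gaussRearr]
  rcases (cdf_le_one μ x).eq_or_lt with h1 | h1
  · have h : μ (Ioi x) = 0 := by
      rw [← compl_Iic, prob_compl_eq_one_sub measurableSet_Iic, ← ofReal_cdf, h1]; simp
    rw [rearrTail, setIntegral_measure_zero _ h]
  · rw [rearrTail_eq ⟨h0, h1⟩]; exact (gaussPDF_pos _).le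

/-- The signed indicator of the interval between `0` and `y`. -/
def betweenSign (x y : ℝ) : ℝ := (Ico 0 y).indicator 1 x - (Ico y 0).indicator 1 x

lemma measurable_betweenSign : Measurable fun p : ℝ × ℝ => betweenSign p.1 p.2 := by
  have h1 : MeasurableSet {p : ℝ × ℝ | 0 ≤ p.1 ∧ p.1 < p.2} :=
    (measurableSet_le measurable_const measurable_fst).inter
      (measurableSet_lt measurable_fst measurable_snd)
  have h2 : MeasurableSet {p : ℝ × ℝ | p.2 ≤ p.1 ∧ p.1 < 0} :=
    (measurableSet_le measurable_snd measurable_fst).inter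
      (measurableSet_lt measurable_fst measurable_const)
  exact ((measurable_const (a := (1 : ℝ))).indicator h1).sub
    ((measurable_const (a := (1 : ℝ))).indicator h2)

/-- Represents y as a signed layer-cake integral over x, so that ∫ y T(y) dμ can be computed by
Fubini instead of integration by parts. -/
lemma integral_betweenSign (y : ℝ) : Integrable (fun x => betweenSign x y) ∧
    ∫ x, betweenSign x y = y ∧ ∫ x, ‖betweenSign x y‖ = |y| := by
  have i1 : Integrable ((Ico 0 y).indicator (1 : ℝ → ℝ)) :=
    (integrable_indicator_iff measurableSet_Ico).2 (integrableOn_const (by simp))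
  have i2 : Integrable ((Ico y 0).indicator (1 : ℝ → ℝ)) :=
    (integrable_indicator_iff measurableSet_Ico).2 (integrableOn_const (by simp))
  refine ⟨i1.sub i2, ?_, ?_⟩
  · rw [show (fun x => betweenSign x y) = fun x => (Ico 0 y).indicator 1 x - (Ico y 0).indicator 1 x
      from rfl, integral_sub i1 i2, integral_indicator_one measurableSet_Ico,
      integral_indicator_one measurableSet_Ico]
    rcases le_total 0 y with hy | hy <;> simp [hy]
  · rcases le_total 0 y with hy | hy
    · have : (fun x => ‖betweenSign x y‖) = (Ico 0 y).indicator 1 := by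
        ext x
        by_cases hx : x ∈ Ico 0 y <;> simp [betweenSign, hx, Ico_eq_empty (not_lt.2 hy)]
      rw [this, integral_indicator_one measurableSet_Ico]
      simp [hy, abs_of_nonneg hy]
    · have : (fun x => ‖betweenSign x y‖) = (Ico y 0).indicator 1 := by
        ext x
        by_cases hx : x ∈ Ico y 0 <;> simp [betweenSign, hx, Ico_eq_empty (not_lt.2 hy)]
      rw [this, integral_indicator_one measurableSet_Ico]
      simp [hy, abs_of_nonpos hy]

/-- For x < 0 the kernel yields minus the lower tail, which equals the upper tail because T has
μ-mean zero. -/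
lemma integral_betweenSign_mul (x : ℝ) :
    ∫ y, betweenSign x y * gaussRearr μ y ∂μ = rearrTail μ x := by
  rcases le_or_gt 0 x with hx | hx
  · rw [rearrTail, ← integral_indicator measurableSet_Ioi]
    congr 1
    ext y
    by_cases hy : x < y <;> simp [betweenSign, hx, hy, not_lt.2 hx]
  · have h1 : ∫ y, betweenSign x y * gaussRearr μ y ∂μ = -∫ y in Iic x, gaussRearr μ y ∂μ := by
      rw [← integral_indicator measurableSet_Iic, ← integral_neg]
      congr 1
      ext y
      by_cases hy : y ≤ x <;> simp [betweenSign, hx, hy, not_le.2 hx]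
    have h2 := integral_add_compl (μ := μ) (measurableSet_Iic (a := x))
      (integrable_gaussRearr (μ := μ))
    rw [integral_gaussRearr, compl_Iic] at h2
    rw [h1, rearrTail]
    linarith

lemma integrable_betweenSign_mul (h2 : Integrable (fun s => s ^ 2) μ) :
    Integrable (fun p : ℝ × ℝ => betweenSign p.1 p.2 * gaussRearr μ p.2) (volume.prod μ) := by
  have hmeas : Measurable fun p : ℝ × ℝ => betweenSign p.1 p.2 * gaussRearr μ p.2 :=
    measurable_betweenSign.mul ((measurable_gaussRearr μ).comp measurable_snd)
  rw [integrable_prod_iff' hmeas.aestronglyMeasurable]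
  refine ⟨ae_of_all _ fun y => (integral_betweenSign y).1.mul_const (gaussRearr μ y), ?_⟩
  refine (integrable_mul_gaussRearr h2).norm.congr (ae_of_all _ fun y => ?_)
  simp only [norm_mul]
  rw [integral_mul_const, (integral_betweenSign y).2.2, Real.norm_eq_abs]

lemma integrable_rearrTail (h2 : Integrable (fun s => s ^ 2) μ) : Integrable (rearrTail μ) :=
  (integrable_betweenSign_mul h2).integral_prod_left.congr
    (ae_of_all _ fun x => integral_betweenSign_mul x)

lemma integral_rearrTail (h2 : Integrable (fun s => s ^ 2) μ) :
    ∫ x, rearrTail μ x = ∫ y, y * gaussRearr μ y ∂μ := by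
  have := integral_integral_swap (f := fun x y => betweenSign x y * gaussRearr μ y)
    (integrable_betweenSign_mul h2)
  rw [show rearrTail μ = fun x => ∫ y, betweenSign x y * gaussRearr μ y ∂μ from
    funext fun x => (integral_betweenSign_mul x).symm, this]
  congr 1
  ext y
  rw [integral_mul_const, (integral_betweenSign y).2.1]

end rearr

/-! ### Densities relative to the Gaussian on the line; Talagrand's inequality -/

section lineDensity

variable {h : ℝ → ℝ}

/-- The measure with density `h` with respect to the standard Gaussian. -/
def lineMeasure (h : ℝ → ℝ) : Measure ℝ := gaussLine.withDensity fun s => ENNReal.ofReal (h s)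

lemma lintegral_lineMeasure (hm : Measurable h) (g : ℝ → ℝ≥0∞) :
    ∫⁻ s, g s ∂lineMeasure h = ∫⁻ s, ENNReal.ofReal (h s) * g s ∂gaussLine := by
  rw [lineMeasure, lintegral_withDensity_eq_lintegral_mul_non_measurable₀]
  · rfl
  · exact hm.ennreal_ofReal.aemeasurable
  · exact ae_of_all _ fun x => ENNReal.ofReal_lt_top

lemma isProbabilityMeasure_lineMeasure (h1 : ∫⁻ s, ENNReal.ofReal (h s) ∂gaussLine = 1) :
    IsProbabilityMeasure (lineMeasure h) :=
  ⟨by rw [lineMeasure, withDensity_apply _ MeasurableSet.univ, setLIntegral_univ, h1]⟩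

lemma nullSingletonClass_lineMeasure : NullSingletonClass (lineMeasure h) :=
  ⟨fun x => withDensity_absolutelyContinuous _ _ (measure_singleton x)⟩

lemma integrable_lineMeasure_iff (hm : Measurable h) (h0 : ∀ s, 0 ≤ h s) (g : ℝ → ℝ) :
    Integrable g (lineMeasure h) ↔ Integrable (fun s => h s * g s) gaussLine := by
  rw [lineMeasure, integrable_withDensity_iff_integrable_smul₀']
  · simp [ENNReal.toReal_ofReal (h0 _)]
  · exact hm.ennreal_ofReal.aemeasurable
  · exact ae_of_all _ fun x => ENNReal.ofReal_lt_top

lemma integral_lineMeasure (hm : Measurable h) (h0 : ∀ s, 0 ≤ h s) (g : ℝ → ℝ) :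
    ∫ s, g s ∂(lineMeasure h) = ∫ s, h s * g s ∂gaussLine := by
  rw [lineMeasure, integral_withDensity_eq_integral_toReal_smul₀]
  · simp [ENNReal.toReal_ofReal (h0 _)]
  · exact hm.ennreal_ofReal.aemeasurable
  · exact ae_of_all _ fun x => ENNReal.ofReal_lt_top

lemma integrable_of_lintegral_ofReal {α : Type*} [MeasurableSpace α] {m : Measure α} {g : α → ℝ}
    (hg : AEStronglyMeasurable g m) (g0 : ∀ a, 0 ≤ g a) (hfin : ∫⁻ a, ENNReal.ofReal (g a) ∂m ≠ ⊤) :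
    Integrable g m :=
  ⟨hg, (hasFiniteIntegral_iff_ofReal (ae_of_all _ g0)).2 hfin.lt_top⟩

lemma integral_eq_one_of_lintegral {α : Type*} [MeasurableSpace α] {m : Measure α} {g : α → ℝ}
    (hg : Measurable g) (g0 : ∀ a, 0 ≤ g a) (h1 : ∫⁻ a, ENNReal.ofReal (g a) ∂m = 1) :
    Integrable g m ∧ ∫ a, g a ∂m = 1 := by
  refine ⟨integrable_of_lintegral_ofReal hg.aestronglyMeasurable g0 (by simp [h1]), ?_⟩
  rw [integral_eq_lintegral_of_nonneg_ae (ae_of_all _ g0) hg.aestronglyMeasurable, h1]; rfl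

lemma ae_lineMeasure_pos (hm : Measurable h) : ∀ᵐ s ∂lineMeasure h, 0 < h s := by
  rw [lineMeasure, ae_withDensity_iff hm.ennreal_ofReal]
  exact ae_of_all _ fun s hs => by simpa using hs

lemma integrable_sq_lineMeasure (hm : Measurable h)
    (hM : ∫⁻ s, ENNReal.ofReal (s ^ 2 * h s) ∂gaussLine ≠ ⊤) :
    Integrable (fun s : ℝ => s ^ 2) (lineMeasure h) := by
  refine integrable_of_lintegral_ofReal (by fun_prop) (fun s => sq_nonneg s) ?_
  rw [lintegral_lineMeasure hm]
  convert hM using 3 with s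
  rw [mul_comm, ← ENNReal.ofReal_mul (sq_nonneg s)]

/-- Talagrand's transport inequality on the line, with the monotone map as coupling. -/
theorem lintegral_sub_gaussRearr_sq_le (hm : Measurable h) (h0 : ∀ s, 0 ≤ h s)
    (h1 : ∫⁻ s, ENNReal.ofReal (h s) ∂gaussLine = 1)
    (hM : ∫⁻ s, ENNReal.ofReal (s ^ 2 * h s) ∂gaussLine ≠ ⊤) :
    ∫⁻ s, ENNReal.ofReal ((s - gaussRearr (lineMeasure h) s) ^ 2) ∂lineMeasure h ≤
      2 * ∫⁻ s, ENNReal.ofReal (klFun (h s)) ∂gaussLine := by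
  by_cases hH : ∫⁻ s, ENNReal.ofReal (klFun (h s)) ∂gaussLine = ⊤
  · simp [hH]
  set μ := lineMeasure h with hμ
  have : IsProbabilityMeasure μ := isProbabilityMeasure_lineMeasure h1
  have : NullSingletonClass μ := nullSingletonClass_lineMeasure
  have h2 : Integrable (fun s : ℝ => s ^ 2) μ := integrable_sq_lineMeasure hm hM
  obtain ⟨hhi, hh1⟩ := integral_eq_one_of_lintegral hm h0 h1
  set T := gaussRearr μ with hT
  have hTm : Measurable T := measurable_gaussRearr μ
  have hkl : Integrable (fun s => klFun (h s)) gaussLine :=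
    integrable_of_lintegral_ofReal (measurable_klFun.comp hm).aestronglyMeasurable
      (fun s => klFun_nonneg (h0 s)) hH
  have hlog : Integrable (fun s => Real.log (h s)) μ := by
    rw [hμ, integrable_lineMeasure_iff hm h0]
    refine ((hkl.add hhi).sub (integrable_const 1)).congr (ae_of_all _ fun s => ?_)
    simp only [klFun, Pi.add_apply, Pi.sub_apply]; ring
  have hlogint : ∫ s, Real.log (h s) ∂μ = ∫ s, klFun (h s) ∂gaussLine := by
    rw [hμ, integral_lineMeasure hm h0]
    have : ∀ s, h s * Real.log (h s) = klFun (h s) + h s - 1 := fun s => by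
      simp only [klFun]; ring
    simp_rw [this]
    have hi : Integrable (fun s => klFun (h s) + h s) gaussLine := hkl.add hhi
    rw [integral_sub hi (integrable_const 1), integral_add hkl hhi, hh1]
    simp
  -- q plays the role of 1/T': formally T' = hφ/φ(T), and `rearrTail` agrees with φ(T) almost
  -- everywhere. The density is only measurable here, so T' itself is not used.
  set q : ℝ → ℝ := fun s => rearrTail μ s / (h s * gaussPDF s) with hq
  have htail : Integrable (rearrTail μ) := integrable_rearrTail h2
  have hqm : AEStronglyMeasurable q μ := by
    have h3 : AEMeasurable (rearrTail μ) gaussLine :=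
      htail.aestronglyMeasurable.aemeasurable.mono_ac
        (gaussianReal_absolutelyContinuous 0 one_ne_zero)
    have h4 : AEMeasurable (rearrTail μ) μ := h3.mono_ac (withDensity_absolutelyContinuous _ _)
    exact (h4.div (hm.mul continuous_gaussPDF.measurable).aemeasurable).aestronglyMeasurable
  have hq0 : ∀ s, 0 ≤ q s := fun s =>
    div_nonneg (rearrTail_nonneg s) (mul_nonneg (h0 s) (gaussPDF_pos s).le)
  -- Only an inequality: on {h = 0} the quotient q is 0 by convention while the tail integral may be
  -- positive.
  have hqle : ∫⁻ s, ENNReal.ofReal (q s) ∂μ ≤ ENNReal.ofReal (∫ s, s * T s ∂μ) := by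
    rw [← integral_rearrTail h2, ofReal_integral_eq_lintegral_ofReal htail
      (ae_of_all _ rearrTail_nonneg), hμ, lintegral_lineMeasure hm, lintegral_gaussLine]
    refine lintegral_mono fun s => ?_
    rw [← ENNReal.ofReal_mul (h0 s), ← ENNReal.ofReal_mul (gaussPDF_pos s).le]
    refine ENNReal.ofReal_le_ofReal ?_
    rcases (h0 s).eq_or_lt with hs | hs
    · simp [← hs]; exact rearrTail_nonneg s
    · have := gaussPDF_pos s
      rw [hq]
      apply le_of_eq
      field_simp
      rfl
  have hqi : Integrable q μ := integrable_of_lintegral_ofReal hqm hq0 (by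
    exact (hqle.trans_lt ENNReal.ofReal_lt_top).ne)
  have hsT : Integrable (fun s => s * T s) μ := integrable_mul_gaussRearr h2
  have hTT : Integrable (fun s => T s ^ 2) μ := integrable_gaussRearr_sq
  have hsT0 : 0 ≤ ∫ s, s * T s ∂μ := by
    rw [← integral_rearrTail h2]; exact integral_nonneg rearrTail_nonneg
  have hqint : ∫ s, q s ∂μ ≤ ∫ s, s * T s ∂μ := by
    rw [integral_eq_lintegral_of_nonneg_ae (ae_of_all _ hq0) hqm]
    exact ENNReal.toReal_le_of_le_ofReal hsT0 hqle
  -- Since log q = (s² − T²)/2 − log h, the bound log q ≤ q − 1 gives s²/2 ≤ log h + q − 1 + T²/2;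
  -- add T²/2 − sT to both sides.
  have hpt : ∀ᵐ s ∂μ, (s - T s) ^ 2 ≤
      2 * (Real.log (h s) - 1 + q s - s * T s + T s ^ 2) := by
    filter_upwards [ae_lineMeasure_pos hm, ae_cdf_mem (μ := μ)] with s hs hc
    have hφ := gaussPDF_pos s
    have hφT := gaussPDF_pos (T s)
    have hqs : q s = gaussPDF (T s) / (h s * gaussPDF s) := by rw [hq, hT, ← rearrTail_eq hc]
    have hqpos : 0 < q s := by rw [hqs]; positivity
    have hl : Real.log (q s) = (s ^ 2 - T s ^ 2) / 2 - Real.log (h s) := by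
      have hc0 : (√(2 * Real.pi))⁻¹ ≠ 0 := by positivity
      rw [hqs, Real.log_div hφT.ne' (by positivity), Real.log_mul hs.ne' hφ.ne', gaussPDF_eq,
        gaussPDF_eq, Real.log_mul hc0 (Real.exp_pos _).ne', Real.log_mul hc0 (Real.exp_pos _).ne',
        Real.log_exp, Real.log_exp]
      ring
    have := Real.log_le_sub_one_of_pos hqpos
    nlinarith
  have hd : Integrable (fun s => (s - T s) ^ 2) μ := by
    refine ((h2.add hTT).sub (hsT.const_mul 2)).congr (ae_of_all _ fun s => ?_)
    simp only [Pi.add_apply, Pi.sub_apply]; ring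
  have hA : Integrable (fun s => Real.log (h s) - 1) μ := hlog.sub (integrable_const (1 : ℝ))
  have hB : Integrable (fun s => Real.log (h s) - 1 + q s) μ := hA.add hqi
  have hC : Integrable (fun s => Real.log (h s) - 1 + q s - s * T s) μ := hB.sub hsT
  have hD : Integrable (fun s => Real.log (h s) - 1 + q s - s * T s + T s ^ 2) μ := hC.add hTT
  -- After integration the bound ∫ q ≤ ∫ sT cancels the cross term and ∫ T² = 1 cancels the −1,
  -- leaving only the entropy.
  have key : ∫ s, (s - T s) ^ 2 ∂μ ≤ 2 * ∫ s, klFun (h s) ∂gaussLine := by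
    calc ∫ s, (s - T s) ^ 2 ∂μ
        ≤ ∫ s, 2 * (Real.log (h s) - 1 + q s - s * T s + T s ^ 2) ∂μ :=
          integral_mono_ae hd (hD.const_mul 2) hpt
      _ = 2 * (∫ s, klFun (h s) ∂gaussLine - 1 + ∫ s, q s ∂μ - ∫ s, s * T s ∂μ + 1) := by
          rw [integral_const_mul, ← hlogint, integral_add hC hTT, integral_sub hB hsT,
            integral_add hA hqi, integral_sub hlog (integrable_const 1), integral_gaussRearr_sq]
          simp
      _ ≤ _ := by linarith
  rw [← ofReal_integral_eq_lintegral_ofReal hd (ae_of_all _ fun s => sq_nonneg _),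
    ← ofReal_integral_eq_lintegral_ofReal hkl (ae_of_all _ fun s => klFun_nonneg (h0 s)),
    ← ENNReal.ofReal_ofNat 2, ← ENNReal.ofReal_mul (by norm_num)]
  exact ENNReal.ofReal_le_ofReal key

end lineDensity

/-! ### The logarithmic Sobolev inequality on the line -/

section lineLogSobolev

lemma exists_abs_lt_of_integrable_atTop {W : ℝ → ℝ} (hW : Integrable W) {ε : ℝ} (hε : 0 < ε)
    (R : ℝ) : ∃ b, R ≤ b ∧ |W b| < ε := by
  by_contra! hcon
  have hi : IntegrableOn (fun _ : ℝ => ε) (Ici R) := by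
    refine Integrable.mono' (g := fun x => |W x|) hW.abs.integrableOn (by fun_prop) ?_
    filter_upwards [ae_restrict_mem measurableSet_Ici] with b hb
    rw [Real.norm_eq_abs, abs_of_pos hε]
    exact hcon b hb
  rw [integrableOn_const_iff] at hi
  simp [hε.ne'] at hi

lemma exists_abs_lt_of_integrable_atBot {W : ℝ → ℝ} (hW : Integrable W) {ε : ℝ} (hε : 0 < ε)
    (R : ℝ) : ∃ a, a ≤ R ∧ |W a| < ε := by
  obtain ⟨b, hb, hWb⟩ := exists_abs_lt_of_integrable_atTop hW.comp_neg hε (-R)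
  exact ⟨-b, by linarith, hWb⟩

/-- If `u - w ≤ (A + B)'` with `A` integrable on the line and `B` vanishing at infinity,
then `∫ u ≤ ∫ w`. -/
lemma lintegral_le_of_le_deriv {A B W' u w : ℝ → ℝ} (hA : Integrable A)
    (hBt : Tendsto B atTop (𝓝 0)) (hBb : Tendsto B atBot (𝓝 0))
    (hd : ∀ x, HasDerivAt (fun x => A x + B x) (W' x) x) (hc : Continuous W') (hu : Continuous u) (hw : Continuous w)
    (u0 : ∀ x, 0 ≤ u x) (w0 : ∀ x, 0 ≤ w x) (hle : ∀ x, u x - w x ≤ W' x) :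
    ∫⁻ x, ENNReal.ofReal (u x) ≤ ∫⁻ x, ENNReal.ofReal (w x) := by
  have hR : ∀ n : ℕ, ∫⁻ x in Ioc (-(n : ℝ)) n, ENNReal.ofReal (u x) ≤
      ∫⁻ x, ENNReal.ofReal (w x) := by
    intro n
    refine ENNReal.le_of_forall_pos_le_add fun ε hε _ => ?_
    have hε2 : (0 : ℝ) < ε / 2 := by have : (0 : ℝ) < ε := by exact_mod_cast hε
                                     linarith
    have hε4 : (0 : ℝ) < ε / 4 := by linarith
    obtain ⟨R, hR⟩ := eventually_atTop.1 (hBt.eventually (Metric.ball_mem_nhds 0 hε4))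
    obtain ⟨S, hS⟩ := eventually_atBot.1 (hBb.eventually (Metric.ball_mem_nhds 0 hε4))
    -- A need not vanish at infinity, but integrability supplies arbitrarily distant points where it
    -- is small, which is enough to control the boundary terms.
    obtain ⟨b, hb, hAb⟩ := exists_abs_lt_of_integrable_atTop hA hε4 (max n R)
    obtain ⟨a, ha, hAa⟩ := exists_abs_lt_of_integrable_atBot hA hε4 (min (-n) S)
    have hRb := hR b ((le_max_right _ _).trans hb)
    have hSa := hS a (ha.trans (min_le_right _ _))
    rw [dist_zero_right, Real.norm_eq_abs] at hRb hSa
    replace hb := (le_max_left _ _).trans hb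
    replace ha := ha.trans (min_le_left _ _)
    have hab : a ≤ b := by have : (0 : ℝ) ≤ n := Nat.cast_nonneg n
                           linarith
    have hint : ∫ x in a..b, u x ≤ ((A b + B b) - (A a + B a)) + ∫ x in a..b, w x := by
      rw [← intervalIntegral.integral_eq_sub_of_hasDerivAt (fun x _ => hd x)
        (hc.intervalIntegrable _ _), ← intervalIntegral.integral_add (hc.intervalIntegrable _ _)
        (hw.intervalIntegrable _ _)]
      refine intervalIntegral.integral_mono_on hab (hu.intervalIntegrable _ _)
        ((hc.add hw).intervalIntegrable _ _) fun x _ => ?_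
      linarith [hle x]
    have hconv : ∀ {v : ℝ → ℝ}, Continuous v → (∀ x, 0 ≤ v x) →
        ENNReal.ofReal (∫ x in a..b, v x) = ∫⁻ x in Ioc a b, ENNReal.ofReal (v x) := by
      intro v hv v0
      rw [intervalIntegral.integral_of_le hab, ofReal_integral_eq_lintegral_ofReal
        ((intervalIntegrable_iff_integrableOn_Ioc_of_le hab).1 (hv.intervalIntegrable _ _))
        (ae_of_all _ v0)]
    calc ∫⁻ x in Ioc (-(n : ℝ)) n, ENNReal.ofReal (u x)
        ≤ ∫⁻ x in Ioc a b, ENNReal.ofReal (u x) := lintegral_mono_set (Ioc_subset_Ioc ha hb)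
      _ = ENNReal.ofReal (∫ x in a..b, u x) := (hconv hu u0).symm
      _ ≤ ENNReal.ofReal ((∫ x in a..b, w x) + ε) := by
          refine ENNReal.ofReal_le_ofReal ?_
          have := abs_lt.1 hAb
          have := abs_lt.1 hAa
          have := abs_lt.1 hRb
          have := abs_lt.1 hSa
          linarith
      _ = ENNReal.ofReal (∫ x in a..b, w x) + (ε : ℝ≥0∞) := by
          have hw0 : 0 ≤ ∫ x in a..b, w x := intervalIntegral.integral_nonneg hab fun x _ => w0 x
          rw [ENNReal.ofReal_add hw0 ε.coe_nonneg, ENNReal.ofReal_coe_nnreal]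
      _ ≤ (∫⁻ x, ENNReal.ofReal (w x)) + ε := by
          rw [hconv hw w0]
          exact add_le_add_left (setLIntegral_le_lintegral _ _) _
  have hun : (⋃ n : ℕ, Ioc (-(n : ℝ)) n) = univ := by
    refine eq_univ_of_forall fun x => ?_
    obtain ⟨n, hn⟩ := exists_nat_gt |x|
    exact mem_iUnion.2 ⟨n, (abs_lt.1 hn).1, (abs_lt.1 hn).2.le⟩
  have hdir : Directed (· ⊆ ·) fun n : ℕ => Ioc (-(n : ℝ)) n :=
    Monotone.directed_le fun m n hmn => by
      have : (m : ℝ) ≤ n := by exact_mod_cast hmn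
      exact Ioc_subset_Ioc (by linarith) this
  rw [← setLIntegral_univ, ← hun, setLIntegral_iUnion_of_directed _ hdir]
  exact iSup_le hR

/-- The Gaussian logarithmic Sobolev inequality on the line for a positive `C¹` density. -/
theorem lintegral_klFun_le_fisher_of_prob {h h' : ℝ → ℝ} (hpos : ∀ s, 0 < h s)
    (hd : ∀ s, HasDerivAt h (h' s) s) (hc : Continuous h')
    (h1 : ∫⁻ s, ENNReal.ofReal (h s) ∂gaussLine = 1)
    (hM : ∫⁻ s, ENNReal.ofReal (s ^ 2 * h s) ∂gaussLine ≠ ⊤) :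
    ∫⁻ s, ENNReal.ofReal (klFun (h s)) ∂gaussLine ≤
      ∫⁻ s, ENNReal.ofReal (1 / 2 * (h' s ^ 2 / h s)) ∂gaussLine := by
  have h0 : ∀ s, 0 ≤ h s := fun s => (hpos s).le
  have hcont : Continuous h := continuous_iff_continuousAt.2 fun s => (hd s).continuousAt
  have hm : Measurable h := hcont.measurable
  set μ := lineMeasure h with hμ
  have : IsProbabilityMeasure μ := isProbabilityMeasure_lineMeasure h1
  have : NullSingletonClass μ := nullSingletonClass_lineMeasure
  have h2 : Integrable (fun s : ℝ => s ^ 2) μ := integrable_sq_lineMeasure hm hM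
  obtain ⟨hhi, hh1⟩ := integral_eq_one_of_lintegral hm h0 h1
  have hpi : Integrable fun s => gaussPDF s * h s := (integrable_gaussLine_iff _).1 hhi
  have hpc : Continuous fun s => gaussPDF s * h s := continuous_gaussPDF.mul hcont
  have hF : ∀ x, cdf μ x = ∫ s in Iic x, gaussPDF s * h s := fun x => by
    rw [cdf_eq_real, ← integral_indicator_one measurableSet_Iic, hμ, integral_lineMeasure hm h0,
      integral_gaussLine, ← integral_indicator measurableSet_Iic]
    congr 1
    ext s
    by_cases hs : s ∈ Iic x <;> simp [hs]
  have hFd : ∀ x, HasDerivAt (cdf μ) (gaussPDF x * h x) x := fun x => by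
    rw [show (cdf μ : ℝ → ℝ) = fun x => ∫ s in Iic x, gaussPDF s * h s from funext hF]
    exact hasDerivAt_setIntegral_Iic hpi hpc x
  have hFm : StrictMono (cdf μ) :=
    strictMono_of_hasDerivAt_pos hFd fun x => mul_pos (gaussPDF_pos x) (hpos x)
  have hF01 : ∀ x, cdf μ x ∈ Ioo (0 : ℝ) 1 := fun x =>
    ⟨(cdf_nonneg _ (x - 1)).trans_lt (hFm (by linarith)),
      (hFm (show x < x + 1 by linarith)).trans_le (cdf_le_one _ _)⟩
  set T := gaussRearr μ with hT
  have hTd : ∀ x, HasDerivAt T (gaussPDF x * h x / gaussPDF (T x)) x := fun x => by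
    have := (hasDerivAt_gaussQuantile (hF01 x)).comp x (hFd x)
    exact this.congr_deriv (by rw [div_eq_inv_mul]; rfl)
  have hTc : Continuous T := continuous_iff_continuousAt.2 fun x => (hTd x).continuousAt
  have hAi : Integrable fun x => (T x - x) * (gaussPDF x * h x) := by
    have hx : Integrable (fun s : ℝ => s) μ :=
      ((memLp_two_iff_integrable_sq (by fun_prop)).2 h2).integrable one_le_two
    have := (integrable_gaussLine_iff _).1 ((integrable_lineMeasure_iff hm h0 _).1
      (integrable_gaussRearr.sub hx))
    refine this.congr (ae_of_all _ fun x => ?_)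
    simp only [Pi.sub_apply]
    ring
  have hBt : Tendsto (fun x => gaussCDF x - cdf μ x) atTop (𝓝 0) := by
    simpa using (tendsto_cdf_atTop gaussLine).sub (tendsto_cdf_atTop μ)
  have hBb : Tendsto (fun x => gaussCDF x - cdf μ x) atBot (𝓝 0) := by
    simpa using (tendsto_cdf_atBot gaussLine).sub (tendsto_cdf_atBot μ)
  have hφc := continuous_gaussPDF
  have hφT : ∀ x, gaussPDF (T x) ≠ 0 := fun x => (gaussPDF_pos _).ne'
  have hpd : ∀ x, HasDerivAt (fun x => gaussPDF x * h x)
      (-x * gaussPDF x * h x + gaussPDF x * h' x) x := fun x => (hasDerivAt_gaussPDF x).mul (hd x)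
  -- The boundary function is (T − x)φh + (Φ − F): the first summand is the integration by parts of
  -- the displacement T − x against the density, the second accounts for the mass difference φ − φh.
  have hWd : ∀ x, HasDerivAt (fun x => (T x - x) * (gaussPDF x * h x) + (gaussCDF x - cdf μ x))
      ((gaussPDF x * h x / gaussPDF (T x) - 1) * (gaussPDF x * h x) +
        (T x - x) * (-x * gaussPDF x * h x + gaussPDF x * h' x) +
        (gaussPDF x - gaussPDF x * h x)) x := fun x =>
    (((hTd x).sub (hasDerivAt_id x)).mul (hpd x)).add ((hasDerivAt_gaussCDF x).sub (hFd x))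
  have hmain := lintegral_le_of_le_deriv (u := fun x => gaussPDF x * klFun (h x))
    (w := fun x => gaussPDF x * (1 / 2 * (h' x ^ 2 / h x))) hAi hBt hBb hWd
    ?_ (hφc.mul (continuous_klFun.comp hcont))
    (hφc.mul (continuous_const.mul ((hc.pow 2).div hcont fun x => (hpos x).ne')))
    (fun x => mul_nonneg (gaussPDF_pos x).le (klFun_nonneg (h0 x)))
    (fun x => mul_nonneg (gaussPDF_pos x).le
      (mul_nonneg (by norm_num) (div_nonneg (sq_nonneg _) (h0 x)))) ?_
  · simp only [ENNReal.ofReal_mul (gaussPDF_pos _).le] at hmain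
    rwa [← lintegral_gaussLine, ← lintegral_gaussLine] at hmain
  · have h3 : Continuous fun x => gaussPDF x * h x / gaussPDF (T x) :=
      hpc.div (hφc.comp hTc) hφT
    fun_prop
  · intro x
    have hp := hpos x
    have hφ := gaussPDF_pos x
    have hφ' := gaussPDF_pos (T x)
    have hk : 0 < gaussPDF x * h x / gaussPDF (T x) := by positivity
    -- The change of variables equation T' φ(T) = φh in logarithmic form. With log T' ≤ T' − 1 it
    -- bounds log h from above.
    have hl : Real.log (h x) =
        Real.log (gaussPDF x * h x / gaussPDF (T x)) + (x ^ 2 - T x ^ 2) / 2 := by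
      have hc0 : (√(2 * Real.pi))⁻¹ ≠ 0 := by positivity
      rw [Real.log_div (by positivity) hφ'.ne', Real.log_mul hφ.ne' hp.ne', gaussPDF_eq x,
        gaussPDF_eq (T x), Real.log_mul hc0 (Real.exp_pos _).ne',
        Real.log_mul hc0 (Real.exp_pos _).ne', Real.log_exp, Real.log_exp]
      ring
    have h3 := Real.log_le_sub_one_of_pos hk
    have h4 : Real.log (h x) ≤
        (gaussPDF x * h x / gaussPDF (T x) - 1) + (x ^ 2 - T x ^ 2) / 2 := by linarith
    -- Using (x² − T²)/2 = −x(T − x) − (T − x)²/2, the claimed bound by the derivative leaves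
    -- precisely this completed square.
    have h5 : 0 ≤ (h x * (T x - x) + h' x) ^ 2 / (2 * h x) := by positivity
    have h6 : (h x * (T x - x) + h' x) ^ 2 / (2 * h x) =
        1 / 2 * (h' x ^ 2 / h x) + (T x - x) * h' x + 1 / 2 * h x * (T x - x) ^ 2 := by
      field_simp
      ring
    have h7 := mul_le_mul_of_nonneg_left h4 (mul_pos hφ hp).le
    have h8 := mul_le_mul_of_nonneg_left (h6 ▸ h5) hφ.le
    simp only [klFun]
    nlinarith

end lineLogSobolev

/-! ### Arbitrary total mass -/

section massScaling

/-- Splits off the entropy of the mass m itself; the last term is linear and integrates to zero when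
the total mass is m. This is the chain rule that lets the line inequalities act on slices of a
multivariate density. -/
lemma klFun_eq_scaled {m : ℝ} (hm : 0 < m) {x : ℝ} (hx : 0 ≤ x) :
    klFun x = m * klFun (x / m) + klFun m + Real.log m * (x - m) := by
  rcases hx.eq_or_lt with rfl | hx
  · simp [klFun]; ring
  · simp only [klFun, Real.log_div hx.ne' hm.ne']
    field_simp
    ring

lemma lintegral_klFun_eq_scaled {α : Type*} [MeasurableSpace α] {P : Measure α}
    [IsProbabilityMeasure P] {h : α → ℝ} (hmeas : Measurable h) (h0 : ∀ s, 0 ≤ h s) {m : ℝ}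
    (hm : 0 < m) (h1 : ∫⁻ s, ENNReal.ofReal (h s) ∂P = ENNReal.ofReal m) :
    ∫⁻ s, ENNReal.ofReal (klFun (h s)) ∂P =
      ENNReal.ofReal m * ∫⁻ s, ENNReal.ofReal (klFun (h s / m)) ∂P + ENNReal.ofReal (klFun m) := by
  have hi : Integrable h P := integrable_of_lintegral_ofReal hmeas.aestronglyMeasurable h0
    (by rw [h1]; exact ENNReal.ofReal_ne_top)
  have hint : ∫ s, h s ∂P = m := by
    rw [integral_eq_lintegral_of_nonneg_ae (ae_of_all _ h0) hmeas.aestronglyMeasurable, h1,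
      ENNReal.toReal_ofReal hm.le]
  have hq0 : ∀ s, 0 ≤ h s / m := fun s => div_nonneg (h0 s) hm.le
  have hlin : Integrable (fun s => Real.log m * (h s - m)) P :=
    (hi.sub (integrable_const m)).const_mul _
  have hmk : AEStronglyMeasurable (fun s => klFun (h s)) P :=
    (measurable_klFun.comp hmeas).aestronglyMeasurable
  have hmq : AEStronglyMeasurable (fun s => klFun (h s / m)) P :=
    (measurable_klFun.comp (hmeas.div_const m)).aestronglyMeasurable
  by_cases hq : Integrable (fun s => klFun (h s / m)) P
  · have hA : Integrable (fun s => m * klFun (h s / m) + klFun m) P :=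
      (hq.const_mul m).add (integrable_const _)
    have hk : Integrable (fun s => klFun (h s)) P :=
      (hA.add hlin).congr (ae_of_all _ fun s => (klFun_eq_scaled hm (h0 s)).symm)
    have key : ∫ s, klFun (h s) ∂P = m * ∫ s, klFun (h s / m) ∂P + klFun m := by
      simp_rw [fun s => klFun_eq_scaled hm (h0 s)]
      rw [integral_add hA hlin, integral_add (hq.const_mul m) (integrable_const _),
        integral_const_mul, integral_const_mul, integral_sub hi (integrable_const _), hint]
      simp
    rw [← ofReal_integral_eq_lintegral_ofReal hk (ae_of_all _ fun s => klFun_nonneg (h0 s)),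
      ← ofReal_integral_eq_lintegral_ofReal hq (ae_of_all _ fun s => klFun_nonneg (hq0 s)), key,
      ENNReal.ofReal_add (mul_nonneg hm.le (integral_nonneg fun s => klFun_nonneg (hq0 s)))
        (klFun_nonneg hm.le), ENNReal.ofReal_mul hm.le]
  · have hk : ¬ Integrable (fun s => klFun (h s)) P := by
      intro hk
      refine hq ((((hk.sub (integrable_const (klFun m))).sub hlin).div_const m).congr
        (ae_of_all _ fun s => ?_))
      simp only [Pi.sub_apply]
      rw [klFun_eq_scaled hm (h0 s)]
      field_simp
      ring
    have e1 : ∫⁻ s, ENNReal.ofReal (klFun (h s)) ∂P = ⊤ := by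
      by_contra hcon
      exact hk (integrable_of_lintegral_ofReal hmk (fun s => klFun_nonneg (h0 s)) hcon)
    have e2 : ∫⁻ s, ENNReal.ofReal (klFun (h s / m)) ∂P = ⊤ := by
      by_contra hcon
      exact hq (integrable_of_lintegral_ofReal hmq (fun s => klFun_nonneg (hq0 s)) hcon)
    rw [e1, e2, ENNReal.mul_top (by simpa using hm)]
    simp

variable {h : ℝ → ℝ}

lemma lintegral_div_mass {m : ℝ} (hm : 0 < m)
    (h1 : ∫⁻ s, ENNReal.ofReal (h s) ∂gaussLine = ENNReal.ofReal m) :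
    (∀ s, ENNReal.ofReal (h s / m) = (ENNReal.ofReal m)⁻¹ * ENNReal.ofReal (h s)) ∧
    ∫⁻ s, ENNReal.ofReal (h s / m) ∂gaussLine = 1 := by
  have e : ∀ s, ENNReal.ofReal (h s / m) = (ENNReal.ofReal m)⁻¹ * ENNReal.ofReal (h s) := fun s => by
    rw [ENNReal.ofReal_div_of_pos hm, ENNReal.div_eq_inv_mul]
  refine ⟨e, ?_⟩
  simp_rw [e]
  rw [lintegral_const_mul' _ _ (by simpa using hm), h1,
    ENNReal.inv_mul_cancel (by simpa using hm) ENNReal.ofReal_ne_top]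

/-- The logarithmic Sobolev inequality on the line for positive `C¹` functions of any mass. -/
theorem lintegral_klFun_le_fisher {h' : ℝ → ℝ} (hpos : ∀ s, 0 < h s)
    (hd : ∀ s, HasDerivAt h (h' s) s) (hc : Continuous h') {m : ℝ} (hm : 0 < m)
    (h1 : ∫⁻ s, ENNReal.ofReal (h s) ∂gaussLine = ENNReal.ofReal m)
    (hM : ∫⁻ s, ENNReal.ofReal (s ^ 2 * h s) ∂gaussLine ≠ ⊤) :
    ∫⁻ s, ENNReal.ofReal (klFun (h s)) ∂gaussLine ≤
      ENNReal.ofReal (klFun m) + ∫⁻ s, ENNReal.ofReal (1 / 2 * (h' s ^ 2 / h s)) ∂gaussLine := by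
  have h0 : ∀ s, 0 ≤ h s := fun s => (hpos s).le
  have hcont : Continuous h := continuous_iff_continuousAt.2 fun s => (hd s).continuousAt
  rw [lintegral_klFun_eq_scaled hcont.measurable h0 hm h1, add_comm]
  refine add_le_add_right ?_ _
  have hlsi := lintegral_klFun_le_fisher_of_prob (h := fun s => h s / m) (h' := fun s => h' s / m)
    (fun s => div_pos (hpos s) hm) (fun s => (hd s).div_const m) (hc.div_const m)
    (lintegral_div_mass hm h1).2 (by
      have : ∀ s, ENNReal.ofReal (s ^ 2 * (h s / m)) =
          (ENNReal.ofReal m)⁻¹ * ENNReal.ofReal (s ^ 2 * h s) := fun s => by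
        rw [← mul_div_assoc, ENNReal.ofReal_div_of_pos hm, ENNReal.div_eq_inv_mul]
      simp_rw [this]
      rw [lintegral_const_mul' _ _ (by simpa using hm)]
      exact ENNReal.mul_ne_top (by simpa using hm) hM)
  refine (mul_le_mul_right hlsi _).trans (le_of_eq ?_)
  rw [← lintegral_const_mul' _ _ ENNReal.ofReal_ne_top]
  congr 1
  ext s
  rw [← ENNReal.ofReal_mul hm.le]
  congr 1
  have := (hpos s).ne'
  field_simp

/-- The monotone map from the measure with density `h` (of any finite mass) to the Gaussian. -/
def lineRearr (h : ℝ → ℝ) (s : ℝ) : ℝ :=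
  gaussQuantile ((∫⁻ t, (Iic s).indicator (fun t => ENNReal.ofReal (h t)) t ∂gaussLine).toReal /
    (∫⁻ t, ENNReal.ofReal (h t) ∂gaussLine).toReal)

lemma lineRearr_eq {m : ℝ} (hm : 0 < m)
    (h1 : ∫⁻ s, ENNReal.ofReal (h s) ∂gaussLine = ENNReal.ofReal m) :
    lineRearr h = gaussRearr (lineMeasure fun s => h s / m) := by
  have : IsProbabilityMeasure (lineMeasure fun s => h s / m) :=
    isProbabilityMeasure_lineMeasure (lintegral_div_mass hm h1).2
  ext s
  rw [lineRearr, gaussRearr, cdf_eq_real, Measure.real, lineMeasure,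
    withDensity_apply _ measurableSet_Iic]
  simp_rw [(lintegral_div_mass hm h1).1]
  rw [lintegral_const_mul' _ _ (by simpa using hm), h1, ENNReal.toReal_mul,
    lintegral_indicator measurableSet_Iic, ENNReal.toReal_inv, div_eq_inv_mul]

lemma lintegral_comp_lineRearr (hmeas : Measurable h)
    (hfin : ∫⁻ s, ENNReal.ofReal (h s) ∂gaussLine ≠ ⊤) {g : ℝ → ℝ≥0∞} (hg : Measurable g) :
    ∫⁻ s, ENNReal.ofReal (h s) * g (lineRearr h s) ∂gaussLine =
      (∫⁻ s, ENNReal.ofReal (h s) ∂gaussLine) * ∫⁻ t, g t ∂gaussLine := by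
  rcases eq_or_ne (∫⁻ s, ENNReal.ofReal (h s) ∂gaussLine) 0 with hz | hz
  · rw [hz, zero_mul]
    rw [lintegral_eq_zero_iff hmeas.ennreal_ofReal] at hz
    rw [← lintegral_zero (μ := gaussLine)]
    refine lintegral_congr_ae ?_
    filter_upwards [hz] with s hs
    simp [hs]
  · set m := (∫⁻ s, ENNReal.ofReal (h s) ∂gaussLine).toReal with hmdef
    have hm : 0 < m := ENNReal.toReal_pos hz hfin
    have h1 : ∫⁻ s, ENNReal.ofReal (h s) ∂gaussLine = ENNReal.ofReal m :=
      (ENNReal.ofReal_toReal hfin).symm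
    obtain ⟨e, hprob⟩ := lintegral_div_mass hm h1
    have : IsProbabilityMeasure (lineMeasure fun s => h s / m) :=
      isProbabilityMeasure_lineMeasure hprob
    have : NullSingletonClass (lineMeasure fun s => h s / m) := nullSingletonClass_lineMeasure
    have hmap : ∫⁻ t, g t ∂gaussLine =
        ∫⁻ s, g (lineRearr h s) ∂(lineMeasure fun s => h s / m) := by
      rw [lineRearr_eq hm h1, ← map_gaussRearr (μ := lineMeasure fun s => h s / m),
        lintegral_map hg (measurable_gaussRearr _)]
    rw [hmap, lintegral_lineMeasure (hmeas.div_const m), h1]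
    simp_rw [e, mul_assoc]
    rw [lintegral_const_mul' _ _ (by simpa using hm), ← mul_assoc,
      ENNReal.mul_inv_cancel (by simpa using hm) ENNReal.ofReal_ne_top, one_mul]

/-- Talagrand's inequality after normalising by m. The term `klFun m` is what the marginal
contributes in the chain rule for relative entropy, so these estimates add up in the Knothe
construction. -/
theorem lintegral_sub_lineRearr_sq_le (hmeas : Measurable h) (h0 : ∀ s, 0 ≤ h s) {m : ℝ}
    (hm0 : 0 ≤ m) (h1 : ∫⁻ s, ENNReal.ofReal (h s) ∂gaussLine = ENNReal.ofReal m)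
    (hM : ∫⁻ s, ENNReal.ofReal (s ^ 2 * h s) ∂gaussLine ≠ ⊤) :
    2 * ENNReal.ofReal (klFun m) +
      ∫⁻ s, ENNReal.ofReal (h s) * ENNReal.ofReal ((s - lineRearr h s) ^ 2) ∂gaussLine ≤
      2 * ∫⁻ s, ENNReal.ofReal (klFun (h s)) ∂gaussLine := by
  -- For zero mass there is no transport cost, and both sides equal 2 because `klFun 0 = 1`.
  rcases hm0.eq_or_lt with rfl | hm
  · rw [ENNReal.ofReal_zero, lintegral_eq_zero_iff hmeas.ennreal_ofReal] at h1
    have e1 : ∫⁻ s, ENNReal.ofReal (h s) * ENNReal.ofReal ((s - lineRearr h s) ^ 2) ∂gaussLine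
        = 0 := by
      rw [← lintegral_zero (μ := gaussLine)]
      refine lintegral_congr_ae ?_
      filter_upwards [h1] with s hs
      simp [hs]
    have e2 : ∫⁻ s, ENNReal.ofReal (klFun (h s)) ∂gaussLine = 1 := by
      rw [lintegral_congr_ae (g := fun _ => 1)]
      · simp
      · filter_upwards [h1] with s hs
        have : h s = 0 := le_antisymm (by simpa using hs) (h0 s)
        simp [this, klFun_zero]
    rw [e1, e2, klFun_zero]
    simp
  · obtain ⟨e, hprob⟩ := lintegral_div_mass hm h1
    have htal := lintegral_sub_gaussRearr_sq_le (hmeas.div_const m)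
      (fun s => div_nonneg (h0 s) hm.le) hprob (by
        have : ∀ s, ENNReal.ofReal (s ^ 2 * (h s / m)) =
            (ENNReal.ofReal m)⁻¹ * ENNReal.ofReal (s ^ 2 * h s) := fun s => by
          rw [← mul_div_assoc, ENNReal.ofReal_div_of_pos hm, ENNReal.div_eq_inv_mul]
        simp_rw [this]
        rw [lintegral_const_mul' _ _ (by simpa using hm)]
        exact ENNReal.mul_ne_top (by simpa using hm) hM)
    rw [← lineRearr_eq hm h1, lintegral_lineMeasure (hmeas.div_const m)] at htal
    simp_rw [e, mul_assoc] at htal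
    rw [lintegral_const_mul' _ _ (by simpa using hm)] at htal
    rw [lintegral_klFun_eq_scaled hmeas h0 hm h1, mul_add, add_comm]
    refine add_le_add_left ?_ _
    have := mul_le_mul_right htal (ENNReal.ofReal m)
    rw [← mul_assoc, ENNReal.mul_inv_cancel (by simpa using hm) ENNReal.ofReal_ne_top,
      one_mul] at this
    refine this.trans (le_of_eq ?_)
    ring

end massScaling

/-! ### The Knothe map and Talagrand's inequality in several dimensions -/

section knothe

/-- The standard Gaussian measure on `ι → ℝ`. -/
abbrev gaussPi (ι : Type*) [Fintype ι] : Measure (ι → ℝ) := Measure.pi fun _ => gaussLine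

section step

variable {A : Type*} [MeasurableSpace A] {α : Measure A} [IsProbabilityMeasure α]
  {f : ℝ × A → ℝ}

/-- Joint measurability in the point and the parameter is the reason why `lineRearr` is written with
parametric lower integrals and makes sense for slices of every mass. -/
lemma measurable_uncurry_lineRearr (hf : Measurable f) :
    Measurable fun p : ℝ × A => lineRearr (fun t => f (t, p.2)) p.1 := by
  refine measurable_gaussQuantile.comp (Measurable.div ?_ ?_)
  · refine Measurable.ennreal_toReal ?_
    refine Measurable.lintegral_prod_right' (ν := gaussLine)
      (f := fun q : (ℝ × A) × ℝ => (Iic q.1.1).indicator (fun t => ENNReal.ofReal (f (t, q.1.2))) q.2)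
      ?_
    have hs : MeasurableSet {q : (ℝ × A) × ℝ | q.2 ≤ q.1.1} :=
      measurableSet_le measurable_snd (measurable_fst.comp measurable_fst)
    exact (Measurable.ennreal_ofReal (f := fun q : (ℝ × A) × ℝ => f (q.2, q.1.2))
      (hf.comp (by fun_prop))).indicator hs
  · refine Measurable.ennreal_toReal ?_
    exact Measurable.lintegral_prod_right' (ν := gaussLine)
      (f := fun q : (ℝ × A) × ℝ => ENNReal.ofReal (f (q.2, q.1.2)))
      (Measurable.ennreal_ofReal (hf.comp (by fun_prop)))

variable (hf : Measurable f) (f0 : ∀ p, 0 ≤ f p) {F : A → ℝ}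
  (hF : ∀ᵐ a ∂α, ∫⁻ s, ENNReal.ofReal (f (s, a)) ∂gaussLine = ENNReal.ofReal (F a))
  {S : A → A} (hS : Measurable S)

-- The triangular map moves the first coordinate by the rearrangement of the slice over a and then
-- moves a by S. Each slice goes to mass F(a) times the Gaussian, and S carries the marginal F to
-- the Gaussian.
include hf hF hS in
lemma lintegral_comp_knotheStep
    (hpush : ∀ g : A → ℝ≥0∞, Measurable g →
      ∫⁻ a, ENNReal.ofReal (F a) * g (S a) ∂α = ∫⁻ a, g a ∂α)
    {g : ℝ × A → ℝ≥0∞} (hg : Measurable g) :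
    ∫⁻ p, ENNReal.ofReal (f p) * g (lineRearr (fun t => f (t, p.2)) p.1, S p.2)
      ∂(gaussLine.prod α) = ∫⁻ p, g p ∂(gaussLine.prod α) := by
  have hm := measurable_uncurry_lineRearr hf
  rw [lintegral_prod_symm', lintegral_prod_symm' _ hg]
  · rw [← hpush (fun a => ∫⁻ s, g (s, a) ∂gaussLine) hg.lintegral_prod_left']
    refine lintegral_congr_ae ?_
    filter_upwards [hF] with a ha
    have := lintegral_comp_lineRearr (h := fun t => f (t, a)) (hf.comp (by fun_prop))
      (by rw [ha]; exact ENNReal.ofReal_ne_top) (g := fun s => g (s, S a))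
      (hg.comp (by fun_prop))
    rw [this, ha]
  · exact hf.ennreal_ofReal.mul (hg.comp (hm.prodMk (hS.comp measurable_snd)))

-- The line inequality with mass F(a), integrated over the slices. The marginal entropy remains on
-- the left, ready to absorb the cost of S.
include hf f0 hF in
lemma lintegral_knotheStep_cost_le (F0 : ∀ a, 0 ≤ F a) (hFm : Measurable F)
    (hM : ∫⁻ p, ENNReal.ofReal (p.1 ^ 2 * f p) ∂(gaussLine.prod α) ≠ ⊤) :
    2 * ∫⁻ a, ENNReal.ofReal (klFun (F a)) ∂α +
      ∫⁻ p, ENNReal.ofReal (f p) * ENNReal.ofReal ((p.1 - lineRearr (fun t => f (t, p.2)) p.1) ^ 2)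
        ∂(gaussLine.prod α) ≤
      2 * ∫⁻ p, ENNReal.ofReal (klFun (f p)) ∂(gaussLine.prod α) := by
  have hm := measurable_uncurry_lineRearr hf
  have hmM : Measurable fun p : ℝ × A => ENNReal.ofReal (p.1 ^ 2 * f p) :=
    ((measurable_fst.pow_const 2).mul hf).ennreal_ofReal
  have hMa : ∀ᵐ a ∂α, ∫⁻ s, ENNReal.ofReal (s ^ 2 * f (s, a)) ∂gaussLine ≠ ⊤ := by
    rw [lintegral_prod_symm' _ hmM] at hM
    filter_upwards [ae_lt_top hmM.lintegral_prod_left' hM] with a ha using ha.ne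
  have hk : Measurable fun p => ENNReal.ofReal (klFun (f p)) :=
    (measurable_klFun.comp hf).ennreal_ofReal
  rw [lintegral_prod_symm' _ hk, lintegral_prod_symm',
    ← lintegral_const_mul' _ _ (by simp), ← lintegral_const_mul' _ _ (by simp),
    ← lintegral_add_left]
  · refine lintegral_mono_ae ?_
    filter_upwards [hF, hMa] with a ha hMa
    exact lintegral_sub_lineRearr_sq_le (h := fun t => f (t, a)) (hf.comp (by fun_prop))
      (fun s => f0 _) (F0 a) ha hMa
  · exact (measurable_klFun.comp hFm).ennreal_ofReal.const_mul _
  · exact hf.ennreal_ofReal.mul ((measurable_fst.sub hm).pow_const 2).ennreal_ofReal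

end step

/-- Talagrand's transport inequality on `Fin N → ℝ`, with the Knothe map as coupling. -/
theorem exists_transport_fin (N : ℕ) : ∀ f : (Fin N → ℝ) → ℝ, Measurable f → (∀ x, 0 ≤ f x) →
    ∫⁻ x, ENNReal.ofReal (f x) ∂(gaussPi (Fin N)) = 1 →
    (∀ i, ∫⁻ x, ENNReal.ofReal (x i ^ 2 * f x) ∂(gaussPi (Fin N)) ≠ ⊤) →
    ∃ T : (Fin N → ℝ) → (Fin N → ℝ), Measurable T ∧
      (∀ g : (Fin N → ℝ) → ℝ≥0∞, Measurable g →
        ∫⁻ x, ENNReal.ofReal (f x) * g (T x) ∂(gaussPi (Fin N)) =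
          ∫⁻ x, g x ∂(gaussPi (Fin N))) ∧
      ∫⁻ x, ENNReal.ofReal (f x) * ∑ i, ENNReal.ofReal ((x i - T x i) ^ 2) ∂(gaussPi (Fin N)) ≤
        2 * ∫⁻ x, ENNReal.ofReal (klFun (f x)) ∂(gaussPi (Fin N)) := by
  induction N with
  | zero =>
    intro f hf f0 h1 hM
    have hc : ∀ x, f x = f default := fun x => by rw [Subsingleton.elim x default]
    have h2 : ENNReal.ofReal (f default) = 1 := by
      simpa [hc] using h1
    refine ⟨id, measurable_id, fun g hg => ?_, by simp⟩
    simp [hc, h2]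
  | succ N ih =>
    intro f hf f0 h1 hM
    set e := MeasurableEquiv.piFinSuccAbove (fun _ : Fin (N + 1) => ℝ) 0 with he
    have hmp : MeasurePreserving e (gaussPi (Fin (N + 1)))
        (gaussLine.prod (gaussPi (Fin N))) :=
      measurePreserving_piFinSuccAbove (fun _ => gaussLine) 0
    have hmp' := hmp.symm e
    have hint : ∀ g : (Fin (N + 1) → ℝ) → ℝ≥0∞,
        ∫⁻ x, g x ∂(gaussPi (Fin (N + 1))) =
          ∫⁻ p, g (e.symm p) ∂(gaussLine.prod (gaussPi (Fin N))) := fun g =>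
      (hmp'.lintegral_comp_emb e.symm.measurableEmbedding g).symm
    have e0 : ∀ p, e.symm p 0 = p.1 := fun p => by simp [he]
    have e1 : ∀ p (j : Fin N), e.symm p j.succ = p.2 j := fun p j => by simp [he]
    set f' : ℝ × (Fin N → ℝ) → ℝ := fun p => f (e.symm p) with hf'
    have hf'm : Measurable f' := hf.comp e.symm.measurable
    have hf'e : Measurable fun p => ENNReal.ofReal (f' p) := hf'm.ennreal_ofReal
    rw [hint, lintegral_prod_symm' _ hf'e] at h1
    -- The marginal in the remaining coordinates. Slices of infinite mass, for which `toReal`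
    -- returns 0, form a null set.
    set F : (Fin N → ℝ) → ℝ := fun a => (∫⁻ s, ENNReal.ofReal (f' (s, a)) ∂gaussLine).toReal with hF
    have hFm : Measurable F := hf'e.lintegral_prod_left'.ennreal_toReal
    have hFae : ∀ᵐ a ∂(gaussPi (Fin N)),
        ∫⁻ s, ENNReal.ofReal (f' (s, a)) ∂gaussLine = ENNReal.ofReal (F a) := by
      filter_upwards [ae_lt_top hf'e.lintegral_prod_left' (by rw [h1]; simp)] with a ha
      exact (ENNReal.ofReal_toReal ha.ne).symm
    obtain ⟨S, hSm, hSpush, hScost⟩ := ih F hFm (fun a => ENNReal.toReal_nonneg)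
      (by rw [← lintegral_congr_ae hFae]; exact h1) (by
        intro i
        have := hM i.succ
        rw [hint, lintegral_prod_symm'] at this
        · convert this using 1
          refine lintegral_congr_ae ?_
          filter_upwards [hFae] with a ha
          simp_rw [e1, ENNReal.ofReal_mul (sq_nonneg _)]
          rw [← ha, lintegral_const_mul' _ _ ENNReal.ofReal_ne_top]
        · simp_rw [e1]
          exact Measurable.ennreal_ofReal (by fun_prop))
    have hpush := fun g hg => lintegral_comp_knotheStep hf'm hFae hSm hSpush
      (g := g) hg
    have hcost := lintegral_knotheStep_cost_le hf'm (fun p => f0 _) hFae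
      (fun a => ENNReal.toReal_nonneg) hFm (by
        have := hM 0
        rw [hint] at this
        simpa only [e0] using this)
    set R : ℝ × (Fin N → ℝ) → ℝ × (Fin N → ℝ) :=
      fun p => (lineRearr (fun t => f' (t, p.2)) p.1, S p.2) with hR
    have hRm : Measurable R :=
      (measurable_uncurry_lineRearr hf'm).prodMk (hSm.comp measurable_snd)
    refine ⟨fun x => e.symm (R (e x)), by fun_prop, fun g hg => ?_, ?_⟩
    · rw [hint, hint]
      simp only [MeasurableEquiv.apply_symm_apply]
      exact hpush (fun p => g (e.symm p)) (hg.comp e.symm.measurable)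
    · rw [hint, hint (fun x => ENNReal.ofReal (klFun (f x)))]
      simp only [MeasurableEquiv.apply_symm_apply, Fin.sum_univ_succ, e0, e1, mul_add]
      -- The cost in the later coordinates depends on a alone, so integrating the first variable
      -- replaces the density by its marginal F; the induction hypothesis then bounds that cost by
      -- twice the entropy of F.
      refine le_trans (le_of_eq ?_) ((add_le_add_left hScost _).trans hcost)
      rw [lintegral_add_left, add_comm]
      · congr 1
        rw [lintegral_prod_symm']
        · refine lintegral_congr_ae ?_
          filter_upwards [hFae] with a ha
          rw [← ha]
          exact lintegral_mul_const' (∑ i, ENNReal.ofReal ((a i - S a i) ^ 2))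
            (fun s => ENNReal.ofReal (f' (s, a)))
            (ENNReal.sum_ne_top.2 fun _ _ => ENNReal.ofReal_ne_top)
        · have : Measurable fun p => (R p).2 := hRm.snd
          exact hf'e.mul (Finset.measurable_sum _ fun i _ =>
            Measurable.ennreal_ofReal (by fun_prop))
      · have : Measurable fun p => (R p).1 := hRm.fst
        exact hf'e.mul (Measurable.ennreal_ofReal (by fun_prop))

/-- Talagrand's transport inequality for the standard Gaussian measure on `ι → ℝ`. -/
theorem exists_transport {ι : Type*} [Fintype ι] {f : (ι → ℝ) → ℝ} (hf : Measurable f)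
    (f0 : ∀ x, 0 ≤ f x) (h1 : ∫⁻ x, ENNReal.ofReal (f x) ∂(gaussPi ι) = 1)
    (hM : ∀ i, ∫⁻ x, ENNReal.ofReal (x i ^ 2 * f x) ∂(gaussPi ι) ≠ ⊤) :
    ∃ T : (ι → ℝ) → (ι → ℝ), Measurable T ∧
      (∀ g : (ι → ℝ) → ℝ≥0∞, Measurable g →
        ∫⁻ x, ENNReal.ofReal (f x) * g (T x) ∂(gaussPi ι) = ∫⁻ x, g x ∂(gaussPi ι)) ∧
      ∫⁻ x, ENNReal.ofReal (f x) * ∑ i, ENNReal.ofReal ((x i - T x i) ^ 2) ∂(gaussPi ι) ≤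
        2 * ∫⁻ x, ENNReal.ofReal (klFun (f x)) ∂(gaussPi ι) := by
  set σ := Fintype.equivFin ι
  set e := MeasurableEquiv.piCongrLeft (fun _ : Fin (Fintype.card ι) => ℝ) σ with he
  have hmp : MeasurePreserving e (gaussPi ι) (gaussPi (Fin (Fintype.card ι))) :=
    measurePreserving_piCongrLeft (fun _ => gaussLine) σ
  have hmp' := hmp.symm e
  have hint : ∀ g : (ι → ℝ) → ℝ≥0∞, ∫⁻ x, g x ∂(gaussPi ι) =
      ∫⁻ p, g (e.symm p) ∂(gaussPi (Fin (Fintype.card ι))) := fun g =>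
    (hmp'.lintegral_comp_emb e.symm.measurableEmbedding g).symm
  have e0 : ∀ p i, e.symm p i = p (σ i) := fun p i => rfl
  rw [hint] at h1
  obtain ⟨T, hTm, hpush, hcost⟩ := exists_transport_fin _ (fun p => f (e.symm p))
    (hf.comp e.symm.measurable) (fun p => f0 _) h1 (fun j => by
      have := hM (σ.symm j)
      rw [hint] at this
      simpa only [e0, Equiv.apply_symm_apply] using this)
  refine ⟨fun x => e.symm (T (e x)), by fun_prop, fun g hg => ?_, ?_⟩
  · rw [hint, hint]
    simp only [MeasurableEquiv.apply_symm_apply]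
    exact hpush (fun p => g (e.symm p)) (hg.comp e.symm.measurable)
  · rw [hint, hint (fun x => ENNReal.ofReal (klFun (f x)))]
    simp only [MeasurableEquiv.apply_symm_apply, e0]
    refine le_trans (le_of_eq ?_) hcost
    congr 1
    ext x
    congr 1
    exact Equiv.sum_comp σ fun j => ENNReal.ofReal ((x j - T x j) ^ 2)

end knothe

/-! ### Smoothness of exponential integrals -/

section expIntegral

variable {X : Type*} [MeasurableSpace X] {μ : Measure X} {E : Type} [NormedAddCommGroup E]
  [NormedSpace ℝ E] {Λ : X → E →L[ℝ] ℂ}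

/-- The integral `∫ exp(Λ x z) θ x dμ(x)` as a function of `z`. -/
def expIntegral {F : Type*} [NormedAddCommGroup F] [NormedSpace ℝ F] [NormedSpace ℂ F]
    (μ : Measure X) (Λ : X → E →L[ℝ] ℂ) (θ : X → F) (z : E) : F :=
  ∫ x, Complex.exp (Λ x z) • θ x ∂μ

/-- `θ` stays integrable after multiplication by every exponential of `‖Λ‖`. -/
structure ExpIntegrable {F : Type*} [NormedAddCommGroup F] (μ : Measure X) (Λ : X → E →L[ℝ] ℂ)
    (θ : X → F) : Prop where
  meas_exponent : AEStronglyMeasurable Λ μ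
  meas : AEStronglyMeasurable θ μ
  integrable : ∀ c : ℝ, Integrable (fun x => Real.exp (c * ‖Λ x‖) * ‖θ x‖) μ

/-- The real-linear map `z ↦ L z • v` for a complex-valued real-linear form `L`. -/
def mulVec {F : Type*} [NormedAddCommGroup F] [NormedSpace ℝ F] [NormedSpace ℂ F]
    [IsScalarTower ℝ ℂ F] (L : E →L[ℝ] ℂ) (v : F) : E →L[ℝ] F :=
  ((ContinuousLinearMap.lsmul ℝ ℂ).flip v).comp L

section

variable {F : Type} [NormedAddCommGroup F] [NormedSpace ℝ F] [NormedSpace ℂ F]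
  [IsScalarTower ℝ ℂ F] [SMulCommClass ℝ ℂ F] {θ : X → F}

omit [SMulCommClass ℝ ℂ F] in
@[simp] lemma mulVec_apply (L : E →L[ℝ] ℂ) (v : F) (z : E) : mulVec L v z = L z • v := rfl

omit [SMulCommClass ℝ ℂ F] in
lemma norm_mulVec_le (L : E →L[ℝ] ℂ) (v : F) : ‖mulVec L v‖ ≤ ‖L‖ * ‖v‖ :=
  ContinuousLinearMap.opNorm_le_bound _ (by positivity) fun z => by
    rw [mulVec_apply, norm_smul, mul_right_comm]
    gcongr
    exact L.le_opNorm z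

omit [MeasurableSpace X] [NormedSpace ℝ F] [IsScalarTower ℝ ℂ F] [SMulCommClass ℝ ℂ F] in
lemma norm_exp_smul_le (z : E) (x : X) :
    ‖Complex.exp (Λ x z) • θ x‖ ≤ Real.exp (‖z‖ * ‖Λ x‖) * ‖θ x‖ := by
  rw [norm_smul, Complex.norm_exp]
  gcongr
  calc (Λ x z).re ≤ ‖Λ x z‖ := Complex.re_le_norm _
    _ ≤ ‖Λ x‖ * ‖z‖ := (Λ x).le_opNorm z
    _ = _ := mul_comm _ _

omit [NormedSpace ℝ F] [IsScalarTower ℝ ℂ F] [SMulCommClass ℝ ℂ F] in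
lemma ExpIntegrable.aestronglyMeasurable_smul (h : ExpIntegrable μ Λ θ) (z : E) :
    AEStronglyMeasurable (fun x => Complex.exp (Λ x z) • θ x) μ := by
  refine AEStronglyMeasurable.smul ?_ h.meas
  exact Complex.continuous_exp.comp_aestronglyMeasurable
    (h.meas_exponent.apply_continuousLinearMap z)

omit [NormedSpace ℝ F] [IsScalarTower ℝ ℂ F] [SMulCommClass ℝ ℂ F] in
lemma ExpIntegrable.integrable_smul (h : ExpIntegrable μ Λ θ) (z : E) :
    Integrable (fun x => Complex.exp (Λ x z) • θ x) μ :=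
  (h.integrable ‖z‖).mono' (h.aestronglyMeasurable_smul z) (ae_of_all _ fun x => norm_exp_smul_le z x)

-- Differentiation brings down a factor of size ‖Λ‖ ≤ exp ‖Λ‖, absorbed by raising c to c + 1. The
-- class of integrands is thus closed under differentiation.
omit [SMulCommClass ℝ ℂ F] in
lemma ExpIntegrable.mul_vec (h : ExpIntegrable μ Λ θ) :
    ExpIntegrable μ Λ (fun x => mulVec (Λ x) (θ x)) := by
  have hm : AEStronglyMeasurable (fun x => mulVec (Λ x) (θ x)) μ := by
    have hc : Continuous fun p : (E →L[ℝ] ℂ) × F => mulVec p.1 p.2 :=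
      (((ContinuousLinearMap.lsmul ℝ ℂ).flip).continuous.comp continuous_snd).clm_comp
        continuous_fst
    exact hc.comp_aestronglyMeasurable (h.meas_exponent.prodMk h.meas)
  refine ⟨h.meas_exponent, hm, fun c => ?_⟩
  refine (h.integrable (c + 1)).mono' ?_ (ae_of_all _ fun x => ?_)
  · exact (Real.continuous_exp.comp_aestronglyMeasurable
      (h.meas_exponent.norm.const_mul c)).mul hm.norm
  · rw [Real.norm_of_nonneg (by positivity), add_mul, one_mul, Real.exp_add, mul_assoc]
    refine mul_le_mul_of_nonneg_left ((norm_mulVec_le _ _).trans ?_) (Real.exp_pos _).le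
    gcongr
    linarith [Real.add_one_le_exp ‖Λ x‖]

/-- Differentiation of exponential integrals. -/
theorem ExpIntegrable.hasFDerivAt (h : ExpIntegrable μ Λ θ) (z : E) :
    HasFDerivAt (expIntegral μ Λ θ) (expIntegral μ Λ (fun x => mulVec (Λ x) (θ x)) z) z := by
  have h' := h.mul_vec
  refine hasFDerivAt_integral_of_dominated_of_fderiv_le (𝕜 := ℝ)
    (F := fun z x => Complex.exp (Λ x z) • θ x)
    (F' := fun z x => Complex.exp (Λ x z) • mulVec (Λ x) (θ x))
    (bound := fun x => Real.exp ((‖z‖ + 1) * ‖Λ x‖) * ‖mulVec (Λ x) (θ x)‖)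
    (Metric.ball_mem_nhds z one_pos)
    (Eventually.of_forall fun w => h.aestronglyMeasurable_smul w) (h.integrable_smul z)
    (h'.aestronglyMeasurable_smul z) (ae_of_all _ fun x w hw => ?_) (h'.integrable _)
    (ae_of_all _ fun x w hw => ?_)
  · refine (norm_exp_smul_le (Λ := Λ) (θ := fun x => mulVec (Λ x) (θ x)) w x).trans ?_
    gcongr
    have := norm_sub_norm_le w z
    rw [mem_ball_iff_norm] at hw
    linarith
  · have h1 : HasFDerivAt (fun w => Complex.exp (Λ x w)) (Complex.exp (Λ x w) • Λ x) w :=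
      ((Λ x).hasFDerivAt).cexp
    have h2 := h1.smul_const (θ x)
    refine h2.congr_fderiv ?_
    ext v
    simp [mul_smul]

end

/-- The target space is quantified inside the induction because the derivative is an exponential
integral of the same kind with values in `E →L[ℝ] F`. -/
theorem ExpIntegrable.contDiff_nat (n : ℕ) : ∀ {F : Type} [NormedAddCommGroup F] [NormedSpace ℝ F]
    [NormedSpace ℂ F] [IsScalarTower ℝ ℂ F] [SMulCommClass ℝ ℂ F] {θ : X → F},
    ExpIntegrable μ Λ θ → ContDiff ℝ n (expIntegral μ Λ θ) := by
  induction n with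
  | zero =>
    intro F _ _ _ _ _ θ h
    exact contDiff_zero.2 (continuous_iff_continuousAt.2 fun z => (h.hasFDerivAt z).continuousAt)
  | succ n ih =>
    intro F _ _ _ _ _ θ h
    exact contDiff_succ_iff_hasFDerivAt.2 ⟨_, ih h.mul_vec, fun z => h.hasFDerivAt z⟩

end expIntegral

/-! ### The Mehler kernel on the line -/

section mehler

/-- The Mehler kernel on the line. -/
def mehlerLine (r x y : ℝ) : ℝ :=
  (√(1 - r ^ 2))⁻¹ * Real.exp (-(r ^ 2 * x ^ 2 + r ^ 2 * y ^ 2 - 2 * r * x * y) / (2 * (1 - r ^ 2)))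

lemma mehlerLine_comm (r x y : ℝ) : mehlerLine r x y = mehlerLine r y x := by
  rw [mehlerLine, mehlerLine]; congr 3; ring

lemma one_sub_sq_pos {r : ℝ} (hr : r ∈ Ico (0 : ℝ) 1) : 0 < 1 - r ^ 2 := by
  nlinarith [hr.1, hr.2]

lemma mehlerLine_pos {r : ℝ} (hr : r ∈ Ico (0 : ℝ) 1) (x y : ℝ) : 0 < mehlerLine r x y :=
  mul_pos (inv_pos.2 (Real.sqrt_pos.2 (one_sub_sq_pos hr))) (Real.exp_pos _)

lemma mehlerLine_zero (x y : ℝ) : mehlerLine 0 x y = 1 := by simp [mehlerLine]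

lemma continuous_mehlerLine (r : ℝ) : Continuous fun p : ℝ × ℝ => mehlerLine r p.1 p.2 := by
  unfold mehlerLine; fun_prop

/-- Identifies the kernel: relative to the Gaussian, `mehlerLine r · y` is the density of r y + √(1
− r²) Z. -/
lemma gaussPDF_mul_mehlerLine {r : ℝ} (hr : r ∈ Ico (0 : ℝ) 1) (x y : ℝ) :
    gaussPDF x * mehlerLine r x y = gaussianPDFReal (r * y) (1 - r ^ 2).toNNReal x := by
  have h := one_sub_sq_pos hr
  rw [gaussPDF_eq, mehlerLine, gaussianPDFReal, Real.coe_toNNReal _ h.le,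
    Real.sqrt_mul (by positivity) (1 - r ^ 2), mul_inv, mul_mul_mul_comm, ← Real.exp_add]
  congr 2
  field_simp
  ring

lemma withDensity_mehlerLine {r : ℝ} (hr : r ∈ Ico (0 : ℝ) 1) (y : ℝ) :
    gaussLine.withDensity (fun x => ENNReal.ofReal (mehlerLine r x y)) =
      gaussianReal (r * y) (1 - r ^ 2).toNNReal := by
  have h := one_sub_sq_pos hr
  have hm : Measurable fun x => ENNReal.ofReal (mehlerLine r x y) :=
    ((continuous_mehlerLine r).comp (by fun_prop : Continuous fun x : ℝ => (x, y))
      ).measurable.ennreal_ofReal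
  rw [gaussianReal_of_var_ne_zero _ (by simpa using h), gaussLine_eq,
    ← withDensity_mul _ continuous_gaussPDF.measurable.ennreal_ofReal hm]
  congr 1
  ext x
  rw [Pi.mul_apply, ← ENNReal.ofReal_mul (gaussPDF_pos x).le, gaussPDF_mul_mehlerLine hr]
  rfl

lemma map_affine_gaussLine {r : ℝ} (hr : r ∈ Ico (0 : ℝ) 1) (y : ℝ) :
    gaussLine.map (fun z => r * y + √(1 - r ^ 2) * z) =
      gaussianReal (r * y) (1 - r ^ 2).toNNReal := by
  have h := one_sub_sq_pos hr
  have h1 : (fun z : ℝ => r * y + √(1 - r ^ 2) * z) =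
      (fun z => r * y + z) ∘ fun z => √(1 - r ^ 2) * z := rfl
  rw [h1, ← Measure.map_map (by fun_prop) (by fun_prop), gaussianReal_map_const_mul,
    gaussianReal_map_const_add]
  congr 1
  · ring
  · ext
    simp [Real.sq_sqrt h.le, Real.coe_toNNReal _ h.le]

/-- Semigroup property of the Mehler kernels on the line. -/
lemma lintegral_mehlerLine_affine {r ρ : ℝ} (hr : r ∈ Ico (0 : ℝ) 1) (hρ : ρ ∈ Ico (0 : ℝ) 1)
    (x y : ℝ) :
    ∫⁻ z, ENNReal.ofReal (mehlerLine r (ρ * x + √(1 - ρ ^ 2) * z) y) ∂gaussLine =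
      ENNReal.ofReal (mehlerLine (ρ * r) x y) := by
  have h := one_sub_sq_pos hr
  have h' := one_sub_sq_pos hρ
  have hρr : ρ * r ∈ Ico (0 : ℝ) 1 := ⟨mul_nonneg hρ.1 hr.1, by nlinarith [hρ.1, hρ.2, hr.1, hr.2]⟩
  have h'' := one_sub_sq_pos hρr
  set σ := √(1 - ρ ^ 2) with hσ
  have hσ2 : σ ^ 2 = 1 - ρ ^ 2 := Real.sq_sqrt h'.le
  -- m and v are the conditional mean and variance of z given y when y = r(ρx + σz) + √(1 − r²) ξ
  -- with z, ξ independent Gaussians; completing the square in z produces them.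
  set v : ℝ := (1 - r ^ 2) / (1 - (ρ * r) ^ 2) with hv
  have hv0 : 0 < v := div_pos h h''
  set m : ℝ := r * σ * (y - r * ρ * x) / (1 - (ρ * r) ^ 2) with hm
  have key : ∀ z, gaussPDF z * mehlerLine r (ρ * x + σ * z) y =
      mehlerLine (ρ * r) x y * gaussianPDFReal m v.toNNReal z := by
    intro z
    rw [gaussPDF_eq, mehlerLine, mehlerLine, gaussianPDFReal, Real.coe_toNNReal _ hv0.le,
      mul_mul_mul_comm (√(2 * Real.pi))⁻¹, mul_mul_mul_comm (√(1 - (ρ * r) ^ 2))⁻¹, ← Real.exp_add, ← Real.exp_add]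
    congr 1
    · rw [Real.sqrt_mul (by positivity) v, hv, Real.sqrt_div h.le]
      have a1 := Real.sqrt_pos.2 h
      have a2 := Real.sqrt_pos.2 h''
      rw [mul_pow, mul_comm (ρ ^ 2)] at a2 ⊢
      have a3 : 0 < √(2 * Real.pi) := by positivity
      field_simp
    · congr 1
      have a1 := h.ne'
      have a2 : 1 - r ^ 2 * ρ ^ 2 ≠ 0 := by rw [mul_comm, ← mul_pow]; exact h''.ne'
      rw [hv, hm, mul_pow ρ r, mul_comm (ρ ^ 2)]
      field_simp
      linear_combination (-r ^ 2 * z ^ 2 * (1 - r ^ 2 * ρ ^ 2) + r ^ 2 * (y - r * ρ * x) ^ 2) * hσ2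
  rw [lintegral_gaussLine]
  simp_rw [← ENNReal.ofReal_mul (gaussPDF_pos _).le, key,
    ENNReal.ofReal_mul (mehlerLine_pos hρr x y).le]
  rw [lintegral_const_mul' _ _ ENNReal.ofReal_ne_top,
    lintegral_gaussianPDFReal_eq_one _ (by simpa using hv0), mul_one]

end mehler

/-! ### Product Mehler kernels with one correlation per coordinate -/

section mehlerPi

variable {ι : Type} [Fintype ι]

lemma lintegral_gaussPi_prod {g : ι → ℝ → ℝ≥0∞} (hg : ∀ i, Measurable (g i)) :
    ∫⁻ x, ∏ i, g i (x i) ∂(gaussPi ι) = ∏ i, ∫⁻ t, g i t ∂gaussLine := by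
  rw [lintegral_prod_eq_prod_lintegral_of_indepFun Finset.univ (fun i (x : ι → ℝ) => g i (x i))
    (iIndepFun_pi fun i => (hg i).aemeasurable) (fun i => (hg i).comp (measurable_pi_apply i))]
  refine Finset.prod_congr rfl fun i _ => ?_
  exact (measurePreserving_eval (fun _ : ι => gaussLine) i).lintegral_comp (hg i)

/-- The Mehler kernel on `ι → ℝ`, with a correlation for each coordinate. -/
def mehler (r x y : ι → ℝ) : ℝ := ∏ i, mehlerLine (r i) (x i) (y i)

lemma mehler_comm (r x y : ι → ℝ) : mehler r x y = mehler r y x :=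
  Finset.prod_congr rfl fun _ _ => mehlerLine_comm _ _ _

variable {r : ι → ℝ} (hr : ∀ i, r i ∈ Ico (0 : ℝ) 1)

include hr in
lemma mehler_pos (x y : ι → ℝ) : 0 < mehler r x y :=
  Finset.prod_pos fun i _ => mehlerLine_pos (hr i) _ _

lemma continuous_mehler (r : ι → ℝ) : Continuous fun p : (ι → ℝ) × (ι → ℝ) => mehler r p.1 p.2 := by
  refine continuous_finsetProd _ fun i _ => ?_
  exact (continuous_mehlerLine (r i)).comp
    (by fun_prop : Continuous fun p : (ι → ℝ) × (ι → ℝ) => (p.1 i, p.2 i))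

lemma continuous_mehler_left (r y : ι → ℝ) : Continuous fun x => mehler r x y :=
  Continuous.comp (g := fun p : (ι → ℝ) × (ι → ℝ) => mehler r p.1 p.2)
    (f := fun x : ι → ℝ => (x, y)) (continuous_mehler r) (by fun_prop)

/-- The point `r y + √(1 - r²) z`, coordinatewise. -/
def ouPoint (r y z : ι → ℝ) : ι → ℝ := fun i => r i * y i + √(1 - r i ^ 2) * z i

omit [Fintype ι] in
lemma measurable_ouPoint (r y : ι → ℝ) : Measurable fun z => ouPoint r y z :=
  measurable_pi_iff.2 fun i => by unfold ouPoint; fun_prop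

include hr in
lemma withDensity_mehler (y : ι → ℝ) :
    (gaussPi ι).withDensity (fun x => ENNReal.ofReal (mehler r x y)) =
      (gaussPi ι).map (fun z => ouPoint r y z) := by
  have hml : ∀ i, Measurable fun t => ENNReal.ofReal (mehlerLine (r i) t (y i)) := fun i =>
    ((continuous_mehlerLine (r i)).comp (by fun_prop : Continuous fun t : ℝ => (t, y i))
      ).measurable.ennreal_ofReal
  have h1 : (gaussPi ι).map (fun z => ouPoint r y z) =
      Measure.pi fun i => gaussLine.withDensity fun t => ENNReal.ofReal (mehlerLine (r i) t (y i)) := by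
    have : ∀ i, IsProbabilityMeasure
        (gaussLine.map fun z => r i * y i + √(1 - r i ^ 2) * z) := fun i =>
      Measure.isProbabilityMeasure_map (by fun_prop)
    refine (Measure.pi_map_pi (μ := fun _ : ι => gaussLine)
      (f := fun i t => r i * y i + √(1 - r i ^ 2) * t) (fun i => by fun_prop)).trans ?_
    congr 1
    ext1 i
    rw [withDensity_mehlerLine (hr i), map_affine_gaussLine (hr i)]
  have : ∀ i, IsProbabilityMeasure
      (gaussLine.withDensity fun t => ENNReal.ofReal (mehlerLine (r i) t (y i))) := fun i => by
    rw [withDensity_mehlerLine (hr i)]; infer_instance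
  rw [h1]
  refine (Measure.pi_eq fun s hs => ?_).symm
  rw [withDensity_apply _ (MeasurableSet.univ_pi hs), ← lintegral_indicator (MeasurableSet.univ_pi hs)]
  simp_rw [withDensity_apply _ (hs _), ← lintegral_indicator (hs _)]
  rw [← lintegral_gaussPi_prod fun i => (hml i).indicator (hs i)]
  refine lintegral_congr fun x => ?_
  by_cases hx : x ∈ univ.pi s
  · rw [indicator_of_mem hx, mehler, ENNReal.ofReal_prod_of_nonneg
      fun i _ => (mehlerLine_pos (hr i) _ _).le]
    refine Finset.prod_congr rfl fun i _ => ?_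
    rw [indicator_of_mem (hx i (mem_univ i))]
  · rw [indicator_of_notMem hx]
    simp only [mem_univ_pi, not_forall] at hx
    obtain ⟨i, hi⟩ := hx
    exact (Finset.prod_eq_zero (Finset.mem_univ i) (indicator_of_notMem hi _)).symm

include hr in
lemma lintegral_mul_mehler (y : ι → ℝ) {g : (ι → ℝ) → ℝ≥0∞} (hg : Measurable g) :
    ∫⁻ x, ENNReal.ofReal (mehler r x y) * g x ∂(gaussPi ι) =
      ∫⁻ z, g (ouPoint r y z) ∂(gaussPi ι) := by
  rw [← lintegral_map hg (measurable_ouPoint r y), ← withDensity_mehler hr,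
    lintegral_withDensity_eq_lintegral_mul _ (continuous_mehler_left r y).measurable.ennreal_ofReal hg]
  rfl

include hr in
lemma integral_mul_mehler (y : ι → ℝ) {g : (ι → ℝ) → ℝ} (hg : Measurable g) :
    ∫ x, mehler r x y * g x ∂(gaussPi ι) = ∫ z, g (ouPoint r y z) ∂(gaussPi ι) := by
  rw [← integral_map (measurable_ouPoint r y).aemeasurable hg.aestronglyMeasurable,
    ← withDensity_mehler hr, integral_withDensity_eq_integral_toReal_smul₀
    (continuous_mehler_left r y).measurable.ennreal_ofReal.aemeasurable
    (ae_of_all _ fun x => ENNReal.ofReal_lt_top)]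
  simp [ENNReal.toReal_ofReal (mehler_pos hr _ _).le]

/-- The exponent equals x²/2 − (ry − x)²/(2(1 − r²)). For fixed x the kernel is therefore bounded in
y, so it is integrable against every finite measure. -/
lemma mehlerLine_le {r : ℝ} (hr : r ∈ Ico (0 : ℝ) 1) (x y : ℝ) :
    mehlerLine r x y ≤ (√(1 - r ^ 2))⁻¹ * Real.exp (x ^ 2 / 2) := by
  have h := one_sub_sq_pos hr
  refine mul_le_mul_of_nonneg_left (Real.exp_le_exp.2 ?_) (by positivity)
  rw [div_le_div_iff₀ (by positivity) (by positivity)]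
  nlinarith [sq_nonneg (r * y - x)]

include hr in
lemma exists_mehler_le (x : ι → ℝ) : ∃ C, ∀ y, mehler r x y ≤ C :=
  ⟨∏ i, (√(1 - r i ^ 2))⁻¹ * Real.exp (x i ^ 2 / 2), fun _ =>
    Finset.prod_le_prod (fun i _ => (mehlerLine_pos (hr i) _ _).le) fun i _ => mehlerLine_le (hr i) _ _⟩

/-! ### One coordinate at a time -/

section coordinate

variable [DecidableEq ι]

/-- An Ornstein–Uhlenbeck step in one coordinate leaves the Gaussian invariant: the line kernel is
symmetric and has total mass one in each variable. -/
lemma lintegral_gaussPi_update {g : (ι → ℝ) → ℝ≥0∞} (hg : Measurable g) (i : ι) {ρ : ℝ}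
    (hρ : ρ ∈ Ico (0 : ℝ) 1) :
    ∫⁻ x, ∫⁻ z, g (Function.update x i (ρ * x i + √(1 - ρ ^ 2) * z)) ∂gaussLine ∂(gaussPi ι) =
      ∫⁻ x, g x ∂(gaussPi ι) := by
  have hline : ∀ k : ℝ → ℝ≥0∞, Measurable k →
      ∫⁻ t, ∫⁻ z, k (ρ * t + √(1 - ρ ^ 2) * z) ∂gaussLine ∂gaussLine = ∫⁻ t, k t ∂gaussLine := by
    intro k hk
    have hm : Measurable fun p : ℝ × ℝ => ENNReal.ofReal (mehlerLine ρ p.2 p.1) * k p.2 :=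
      ((continuous_mehlerLine ρ).measurable.ennreal_ofReal.comp measurable_swap).mul
        (hk.comp measurable_snd)
    have h1 : ∀ t, ∫⁻ z, k (ρ * t + √(1 - ρ ^ 2) * z) ∂gaussLine =
        ∫⁻ w, ENNReal.ofReal (mehlerLine ρ w t) * k w ∂gaussLine := fun t => by
      have hmt : Measurable fun w => ENNReal.ofReal (mehlerLine ρ w t) :=
        ((continuous_mehlerLine ρ).comp (by fun_prop : Continuous fun w : ℝ => (w, t))
          ).measurable.ennreal_ofReal
      rw [← lintegral_map hk (by fun_prop : Measurable fun z => ρ * t + √(1 - ρ ^ 2) * z),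
        map_affine_gaussLine hρ, ← withDensity_mehlerLine hρ,
        lintegral_withDensity_eq_lintegral_mul _ hmt hk]
      rfl
    simp_rw [h1]
    rw [lintegral_lintegral_swap hm.aemeasurable]
    refine lintegral_congr fun w => ?_
    have hmw : Measurable fun t => ENNReal.ofReal (mehlerLine ρ w t) :=
      ((continuous_mehlerLine ρ).comp (by fun_prop : Continuous fun t : ℝ => (w, t))
        ).measurable.ennreal_ofReal
    have h2 : ∫⁻ t, ENNReal.ofReal (mehlerLine ρ w t) ∂gaussLine = 1 := by
      simp_rw [mehlerLine_comm ρ w]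
      rw [← setLIntegral_univ, ← withDensity_apply _ MeasurableSet.univ, withDensity_mehlerLine hρ,
        measure_univ]
    rw [lintegral_mul_const _ hmw, h2, one_mul]
  have hG : Measurable fun x : ι → ℝ =>
      ∫⁻ z, g (Function.update x i (ρ * x i + √(1 - ρ ^ 2) * z)) ∂gaussLine := by
    refine Measurable.lintegral_prod_right' (ν := gaussLine)
      (f := fun p : (ι → ℝ) × ℝ => g (Function.update p.1 i (ρ * p.1 i + √(1 - ρ ^ 2) * p.2))) ?_
    refine hg.comp (measurable_pi_iff.2 fun j => ?_)
    by_cases hj : j = i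
    · subst hj; simp only [Function.update_self]; fun_prop
    · simp only [Function.update_of_ne hj]; fun_prop
  rw [lintegral_eq_lmarginal_univ (0 : ι → ℝ), lintegral_eq_lmarginal_univ (0 : ι → ℝ),
    lmarginal_erase' _ hG (Finset.mem_univ i), lmarginal_erase' _ hg (Finset.mem_univ i)]
  congr 1
  ext x
  simp only [Function.update_self, Function.update_idem]
  exact hline (fun t => g (Function.update x i t)) (hg.comp (measurable_update x))

lemma lintegral_mehler_update {r : ι → ℝ} (hr : ∀ i, r i ∈ Ico (0 : ℝ) 1) (i : ι) {ρ : ℝ}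
    (hρ : ρ ∈ Ico (0 : ℝ) 1) (x y : ι → ℝ) :
    ∫⁻ z, ENNReal.ofReal (mehler r (Function.update x i (ρ * x i + √(1 - ρ ^ 2) * z)) y) ∂gaussLine =
      ENNReal.ofReal (mehler (Function.update r i (ρ * r i)) x y) := by
  have e1 : ∀ t, mehler r (Function.update x i t) y =
      mehlerLine (r i) t (y i) * ∏ j ∈ Finset.univ.erase i, mehlerLine (r j) (x j) (y j) := fun t => by
    rw [mehler, ← Finset.mul_prod_erase _ _ (Finset.mem_univ i), Function.update_self]
    congr 1
    refine Finset.prod_congr rfl fun j hj => ?_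
    rw [Function.update_of_ne (Finset.ne_of_mem_erase hj)]
  have e2 : mehler (Function.update r i (ρ * r i)) x y =
      mehlerLine (ρ * r i) (x i) (y i) *
        ∏ j ∈ Finset.univ.erase i, mehlerLine (r j) (x j) (y j) := by
    rw [mehler, ← Finset.mul_prod_erase _ _ (Finset.mem_univ i), Function.update_self]
    congr 1
    refine Finset.prod_congr rfl fun j hj => ?_
    rw [Function.update_of_ne (Finset.ne_of_mem_erase hj)]
  have hP : 0 ≤ ∏ j ∈ Finset.univ.erase i, mehlerLine (r j) (x j) (y j) :=
    Finset.prod_nonneg fun j _ => (mehlerLine_pos (hr j) _ _).le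
  simp_rw [e1, e2, ENNReal.ofReal_mul' hP]
  rw [lintegral_mul_const' _ _ ENNReal.ofReal_ne_top, lintegral_mehlerLine_affine (hr i) hρ]

end coordinate

end mehlerPi

/-! ### Smoothness and derivatives of Mehler integrals -/

section mehlerIntegral

variable {ι : Type} [Fintype ι] {r : ι → ℝ}

/-- The exponent `∑ r_i x_i y_i / (1 - r_i²)` of the Mehler kernel as a form in `y`. -/
def mehlerForm (r x : ι → ℝ) : (ι → ℝ) →L[ℝ] ℂ :=
  Complex.ofRealCLM.comp
    (∑ i, (r i * x i / (1 - r i ^ 2)) • ContinuousLinearMap.proj (R := ℝ) (φ := fun _ : ι => ℝ) i)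

lemma mehlerForm_apply (r x y : ι → ℝ) :
    mehlerForm r x y = ((∑ i, r i * x i / (1 - r i ^ 2) * y i : ℝ) : ℂ) := by
  simp [mehlerForm]

/-- The Gaussian weight of the Mehler kernel in one of its variables. -/
def mehlerWeight (r x : ι → ℝ) : ℝ := Real.exp (-∑ i, r i ^ 2 * x i ^ 2 / (2 * (1 - r i ^ 2)))

/-- With the Gaussian weights in x and y factored out, the kernel is the exponential of a form
linear in y, so Mehler integrals are exponential integrals times a smooth weight. -/
lemma mehler_eq (hr : ∀ i, r i ∈ Ico (0 : ℝ) 1) (x y : ι → ℝ) :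
    mehler r x y = (∏ i, (√(1 - r i ^ 2))⁻¹) * mehlerWeight r y *
      (Real.exp (∑ i, r i * x i / (1 - r i ^ 2) * y i) * mehlerWeight r x) := by
  unfold mehler mehlerLine mehlerWeight
  rw [Finset.prod_mul_distrib, ← Real.exp_sum, mul_assoc, ← Real.exp_add, ← Real.exp_add]
  congr 2
  rw [← Finset.sum_neg_distrib, ← Finset.sum_neg_distrib, ← Finset.sum_add_distrib,
    ← Finset.sum_add_distrib]
  refine Finset.sum_congr rfl fun i _ => ?_
  have := (one_sub_sq_pos (hr i)).ne'
  field_simp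
  ring

lemma norm_mehlerForm_le (hr : ∀ i, r i ∈ Ico (0 : ℝ) 1) (x : ι → ℝ) :
    ‖mehlerForm r x‖ ≤ ∑ i, |r i * x i| / (1 - r i ^ 2) := by
  have h0 : ∀ i, 0 ≤ |r i * x i| / (1 - r i ^ 2) := fun i =>
    div_nonneg (abs_nonneg _) (one_sub_sq_pos (hr i)).le
  refine ContinuousLinearMap.opNorm_le_bound _ (Finset.sum_nonneg fun i _ => h0 i) fun y => ?_
  rw [mehlerForm_apply, Complex.norm_real, Finset.sum_mul]
  refine (norm_sum_le _ _).trans (Finset.sum_le_sum fun i _ => ?_)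
  rw [norm_mul, norm_div, Real.norm_eq_abs, Real.norm_of_nonneg (one_sub_sq_pos (hr i)).le]
  exact mul_le_mul_of_nonneg_left (norm_le_pi_norm y i) (h0 i)

lemma continuous_mehlerForm (r : ι → ℝ) : Continuous fun x => mehlerForm r x := by
  unfold mehlerForm
  refine continuous_const.clm_comp (continuous_finsetSum _ fun i _ => ?_)
  exact ((continuous_const.mul (continuous_apply i)).div_const _).smul continuous_const

/-- The Gaussian weight beats every exponential of the linear form: coordinatewise, |c||rx|/(1 − r²)
− r²x²/(2(1 − r²)) is at most c²/(2(1 − r²)), the defect being a square. -/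
lemma expIntegrable_mehler (hr : ∀ i, r i ∈ Ico (0 : ℝ) 1) {m : Measure (ι → ℝ)}
    [IsFiniteMeasure m] {g : (ι → ℝ) → ℝ} (hg : Measurable g) {B : ℝ} (hB : ∀ x, |g x| ≤ B) :
    ExpIntegrable m (mehlerForm r) fun x => ((g x * mehlerWeight r x : ℝ) : ℂ) := by
  have hw : Continuous (mehlerWeight r) := by unfold mehlerWeight; fun_prop
  have hθ : Measurable fun x => ((g x * mehlerWeight r x : ℝ) : ℂ) :=
    Complex.measurable_ofReal.comp (hg.mul hw.measurable)
  have hΛ : AEStronglyMeasurable (mehlerForm r) m := (continuous_mehlerForm r).aestronglyMeasurable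
  refine ⟨hΛ, hθ.aestronglyMeasurable, fun c => ?_⟩
  refine Integrable.mono' (integrable_const (Real.exp (∑ i, c ^ 2 / (2 * (1 - r i ^ 2))) * B))
    ((Real.continuous_exp.comp_aestronglyMeasurable (hΛ.norm.const_mul c)).mul
      hθ.norm.aestronglyMeasurable) (ae_of_all _ fun x => ?_)
  rw [Real.norm_of_nonneg (by positivity), Complex.norm_real, norm_mul, mul_comm ‖g x‖, ← mul_assoc,
    mehlerWeight, Real.norm_of_nonneg (Real.exp_pos _).le, ← Real.exp_add]
  refine mul_le_mul (Real.exp_le_exp.2 ?_) (hB x) (norm_nonneg _) (Real.exp_pos _).le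
  have h1 : c * ‖mehlerForm r x‖ ≤ |c| * ∑ i, |r i * x i| / (1 - r i ^ 2) :=
    mul_le_mul (le_abs_self c) (norm_mehlerForm_le hr x) (norm_nonneg _) (abs_nonneg c)
  rw [Finset.mul_sum] at h1
  refine (add_le_add_left h1 _).trans ?_
  rw [← Finset.sum_neg_distrib, ← Finset.sum_add_distrib]
  refine Finset.sum_le_sum fun i _ => ?_
  have h := one_sub_sq_pos (hr i)
  have h2 : c ^ 2 / (2 * (1 - r i ^ 2)) - (|c| * (|r i * x i| / (1 - r i ^ 2)) +
      -(r i ^ 2 * x i ^ 2 / (2 * (1 - r i ^ 2)))) =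
      (|c| - |r i * x i|) ^ 2 / (2 * (1 - r i ^ 2)) := by
    rw [sub_sq, sq_abs, sq_abs]
    field_simp
    ring
  have h3 : 0 ≤ (|c| - |r i * x i|) ^ 2 / (2 * (1 - r i ^ 2)) := by positivity
  linarith

/-- The function `y ↦ ∫ k_r(x, y) g(x) dm(x)`, `k_r` the Mehler kernel. -/
def mehlerInt (r : ι → ℝ) (m : Measure (ι → ℝ)) (g : (ι → ℝ) → ℝ) (y : ι → ℝ) : ℝ :=
  ∫ x, mehler r x y * g x ∂m

/-- The partial derivative in the `i`-th coordinate. -/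
def pderivAt [DecidableEq ι] (i : ι) (f : (ι → ℝ) → ℝ) (x : ι → ℝ) : ℝ :=
  fderiv ℝ f x (Pi.single i 1)

variable (hr : ∀ i, r i ∈ Ico (0 : ℝ) 1) {m : Measure (ι → ℝ)} [IsFiniteMeasure m]
  {g : (ι → ℝ) → ℝ} (hg : Measurable g) {B : ℝ} (hB : ∀ x, |g x| ≤ B)

include hr in
omit [IsFiniteMeasure m] in
lemma mehlerInt_eq (g : (ι → ℝ) → ℝ) (y : ι → ℝ) :
    mehlerInt r m g y = (∏ i, (√(1 - r i ^ 2))⁻¹) * mehlerWeight r y *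
      (expIntegral m (mehlerForm r) (fun x => ((g x * mehlerWeight r x : ℝ) : ℂ)) y).re := by
  have h1 : expIntegral m (mehlerForm r) (fun x => ((g x * mehlerWeight r x : ℝ) : ℂ)) y =
      ((∫ x, Real.exp (∑ i, r i * x i / (1 - r i ^ 2) * y i) * (g x * mehlerWeight r x) ∂m : ℝ) : ℂ) := by
    rw [expIntegral, ← integral_complex_ofReal]
    refine integral_congr_ae (ae_of_all _ fun x => ?_)
    simp only [mehlerForm_apply, smul_eq_mul]
    push_cast
    ring
  rw [h1, Complex.ofReal_re, mehlerInt, ← integral_const_mul]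
  refine integral_congr_ae (ae_of_all _ fun x => ?_)
  simp only [mehler_eq hr]
  ring

lemma contDiff_mehlerWeight (r : ι → ℝ) : ContDiff ℝ ∞ (mehlerWeight r) := by
  unfold mehlerWeight
  refine ContDiff.exp (ContDiff.neg (ContDiff.sum fun i _ => ?_))
  exact (contDiff_const.mul ((contDiff_apply ℝ ℝ i).pow 2)).div_const _

include hr hg hB in
theorem contDiff_mehlerInt : ContDiff ℝ ∞ (mehlerInt r m g) := by
  rw [show mehlerInt r m g = _ from funext fun y => mehlerInt_eq hr g y]
  refine (contDiff_const.mul (contDiff_mehlerWeight r)).mul ?_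
  refine Complex.reCLM.contDiff.comp (contDiff_infty.2 fun n => ?_)
  exact (expIntegrable_mehler hr hg hB).contDiff_nat n

include hr hg hB in
lemma integrable_mehler_mul (y : ι → ℝ) : Integrable (fun x => mehler r x y * g x) m := by
  obtain ⟨C, hC⟩ := exists_mehler_le hr y
  refine Integrable.mono' (integrable_const (C * B))
    ((continuous_mehler_left r y).measurable.mul hg).aestronglyMeasurable (ae_of_all _ fun x => ?_)
  rw [norm_mul, Real.norm_of_nonneg (mehler_pos hr x y).le, mehler_comm]
  exact mul_le_mul (hC x) (hB x) (norm_nonneg _) ((mehler_pos hr y x).le.trans (hC x))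

include hr hg hB in
/-- Differentiation of Mehler integrals. -/
theorem pderivAt_mehlerInt [DecidableEq ι] (i : ι) (y : ι → ℝ) :
    Integrable (fun x => mehler r x y *
      (g x * ((r i * x i - r i ^ 2 * y i) / (1 - r i ^ 2)))) m ∧
    pderivAt i (mehlerInt r m g) y =
      ∫ x, mehler r x y * (g x * ((r i * x i - r i ^ 2 * y i) / (1 - r i ^ 2))) ∂m := by
  set θ : (ι → ℝ) → ℂ := fun x => ((g x * mehlerWeight r x : ℝ) : ℂ) with hθ
  have hE : ExpIntegrable m (mehlerForm r) θ := expIntegrable_mehler (m := m) hr hg hB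
  set P : ℝ := ∏ i, (√(1 - r i ^ 2))⁻¹ with hP
  have hPpos : 0 < P := Finset.prod_pos fun i _ =>
    inv_pos.2 (Real.sqrt_pos.2 (one_sub_sq_pos (hr i)))
  have hwpos : ∀ y, 0 < mehlerWeight r y := fun y => Real.exp_pos _
  have h1 : ∀ x, mehlerForm r x (Pi.single i 1) = ((r i * x i / (1 - r i ^ 2) : ℝ) : ℂ) := fun x => by
    rw [mehlerForm_apply]
    simp [Pi.single_apply]
  have hre : ∀ x, (Complex.exp (mehlerForm r x y) • (mulVec (mehlerForm r x) (θ x)))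
      (Pi.single i 1) = ((Real.exp (∑ i, r i * x i / (1 - r i ^ 2) * y i) *
        (r i * x i / (1 - r i ^ 2) * (g x * mehlerWeight r x)) : ℝ) : ℂ) := fun x => by
    rw [smul_apply, mulVec_apply, h1, mehlerForm_apply, hθ]
    simp only [smul_eq_mul]
    push_cast
    ring
  have hi1 : Integrable (fun x => Real.exp (∑ i, r i * x i / (1 - r i ^ 2) * y i) *
      (r i * x i / (1 - r i ^ 2) * (g x * mehlerWeight r x))) m := by
    have := ((hE.mul_vec.integrable_smul y).apply_continuousLinearMap (Pi.single i 1)).re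
    refine this.congr (ae_of_all _ fun x => ?_)
    simp only [hre, RCLike.re_eq_complex_re, Complex.ofReal_re]
  have hi2 : Integrable (fun x => mehler r x y * (r i * x i / (1 - r i ^ 2) * g x)) m := by
    refine (hi1.const_mul (P * mehlerWeight r y)).congr (ae_of_all _ fun x => ?_)
    simp only [mehler_eq hr]
    ring
  have hi3 := (integrable_mehler_mul (m := m) hr hg hB y).const_mul (r i ^ 2 * y i / (1 - r i ^ 2))
  have hsplit : ∀ x, mehler r x y * (g x * ((r i * x i - r i ^ 2 * y i) / (1 - r i ^ 2))) =
      mehler r x y * (r i * x i / (1 - r i ^ 2) * g x) -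
        r i ^ 2 * y i / (1 - r i ^ 2) * (mehler r x y * g x) := fun x => by ring
  refine ⟨(hi2.sub hi3).congr (ae_of_all _ fun x => (hsplit x).symm), ?_⟩
  simp_rw [hsplit]
  rw [integral_sub hi2 hi3, integral_const_mul]
  have hw : HasFDerivAt (mehlerWeight r) (fderiv ℝ (mehlerWeight r) y) y :=
    ((contDiff_mehlerWeight r).differentiable (by simp) y).hasFDerivAt
  have hws : fderiv ℝ (mehlerWeight r) y (Pi.single i 1) =
      -(r i ^ 2 * y i / (1 - r i ^ 2)) * mehlerWeight r y := by
    have hq : HasFDerivAt (fun x : ι → ℝ => -∑ j, r j ^ 2 * x j ^ 2 / (2 * (1 - r j ^ 2)))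
        (-∑ j, (r j ^ 2 * (2 * y j) / (2 * (1 - r j ^ 2))) •
          ContinuousLinearMap.proj (R := ℝ) (φ := fun _ : ι => ℝ) j) y := by
      refine HasFDerivAt.fun_neg (HasFDerivAt.fun_sum fun j _ => ?_)
      have h := (((hasFDerivAt_apply (𝕜 := ℝ) j y).pow 2).const_mul (r j ^ 2)).mul_const
        (2 * (1 - r j ^ 2))⁻¹
      refine h.congr_fderiv ?_
      ext v
      have := (one_sub_sq_pos (hr j)).ne'
      simp
      field_simp
    have := hq.exp.fderiv
    change fderiv ℝ (mehlerWeight r) y = _ at this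
    rw [this]
    simp [Pi.single_apply, mehlerWeight]
    have := (one_sub_sq_pos (hr i)).ne'
    field_simp
  have hexp := (Complex.reCLM.hasFDerivAt.comp y (hE.hasFDerivAt y))
  have hprod := ((hw.const_mul P).fun_mul hexp).fderiv
  have hfun : mehlerInt r m g = fun y => P * mehlerWeight r y *
      (Complex.reCLM ∘ expIntegral m (mehlerForm r) θ) y := funext fun y => mehlerInt_eq hr g y
  have hval : ((expIntegral m (mehlerForm r) (fun x => mulVec (mehlerForm r x) (θ x)) y)
      (Pi.single i 1)).re = ∫ x, Real.exp (∑ i, r i * x i / (1 - r i ^ 2) * y i) *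
      (r i * x i / (1 - r i ^ 2) * (g x * mehlerWeight r x)) ∂m := by
    rw [expIntegral, ContinuousLinearMap.integral_apply (hE.mul_vec.integrable_smul y)]
    rw [integral_congr_ae (ae_of_all _ hre), integral_complex_ofReal, Complex.ofReal_re]
  have hmain : ∫ x, mehler r x y * (r i * x i / (1 - r i ^ 2) * g x) ∂m =
      P * mehlerWeight r y * ∫ x, Real.exp (∑ i, r i * x i / (1 - r i ^ 2) * y i) *
      (r i * x i / (1 - r i ^ 2) * (g x * mehlerWeight r x)) ∂m := by
    rw [← integral_const_mul]
    refine integral_congr_ae (ae_of_all _ fun x => ?_)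
    simp only [mehler_eq hr]
    ring
  rw [pderivAt, hfun, hprod, hmain, ← hval]
  have h3 : ∫ x, mehler r x y * g x ∂m = P * mehlerWeight r y *
      (Complex.reCLM ∘ expIntegral m (mehlerForm r) θ) y := mehlerInt_eq hr g y
  rw [h3]
  simp [hws]
  ring

end mehlerIntegral

/-! ### Reverse Poincaré inequality for the Mehler semigroup -/

section reversePoincare

variable {ι : Type} [Fintype ι]

lemma memLp_eval_gaussPi (i : ι) : MemLp (fun x : ι → ℝ => x i) 2 (gaussPi ι) :=
  (memLp_id_gaussianReal' 2 (by simp)).comp_measurePreserving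
    (measurePreserving_eval (fun _ : ι => gaussLine) i)

lemma integral_eval_gaussPi (i : ι) : ∫ x, x i ∂(gaussPi ι) = 0 := by
  have := integral_comp_eval (μ := fun _ : ι => gaussLine) (i := i) (f := fun t : ℝ => t)
    (by fun_prop)
  rw [this]
  simp [gaussLine]

lemma integral_sum_mul_sq_gaussPi (c : ι → ℝ) :
    ∫ x, (∑ i, c i * x i) ^ 2 ∂(gaussPi ι) = ∑ i, c i ^ 2 := by
  have hm : ∀ i, MemLp (fun t : ℝ => c i * t) 2 gaussLine := fun i =>
    (memLp_id_gaussianReal' 2 (by simp)).const_mul (c i)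
  have h1 := variance_sum_pi (μ := fun _ : ι => gaussLine) (X := fun i t => c i * t) hm
  have hm2 : MemLp (∑ i, fun x : ι → ℝ => c i * x i) 2 (gaussPi ι) :=
    memLp_finsetSum' _ fun i _ => (memLp_eval_gaussPi i).const_mul (c i)
  rw [variance_eq_sub hm2] at h1
  have h2 : ∀ i, Var[fun t : ℝ => c i * t; gaussLine] = c i ^ 2 := fun i => by
    rw [variance_const_mul]
    simp [gaussLine]
  have h3 : ∫ x, (∑ i, fun x : ι → ℝ => c i * x i) x ∂(gaussPi ι) = 0 := by
    simp only [Finset.sum_apply]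
    rw [integral_finsetSum _ fun i _ => ((memLp_eval_gaussPi i).integrable (by norm_num)).const_mul _]
    simp only [integral_const_mul, integral_eval_gaussPi, mul_zero, Finset.sum_const_zero]
  rw [h3, Finset.sum_congr rfl fun i _ => h2 i] at h1
  simpa using h1

/-- Bessel's inequality for the coordinate functions and the constants. -/
lemma sum_sq_integral_mul_eval_le {G : (ι → ℝ) → ℝ} (hG : MemLp G 2 (gaussPi ι)) :
    ∑ i, (∫ z, G z * z i ∂(gaussPi ι)) ^ 2 ≤
      ∫ z, G z ^ 2 ∂(gaussPi ι) - (∫ z, G z ∂(gaussPi ι)) ^ 2 := by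
  set c : ι → ℝ := fun i => ∫ z, G z * z i ∂(gaussPi ι) with hc
  set a : ℝ := ∫ z, G z ∂(gaussPi ι) with ha
  have hξ : MemLp (fun z : ι → ℝ => ∑ i, c i * z i) 2 (gaussPi ι) :=
    memLp_finsetSum _ fun i _ => (memLp_eval_gaussPi i).const_mul (c i)
  have hG1 : Integrable G (gaussPi ι) := hG.integrable (by norm_num)
  have hξ1 : Integrable (fun z : ι → ℝ => ∑ i, c i * z i) (gaussPi ι) := hξ.integrable (by norm_num)
  have iG2 : Integrable (fun z => G z ^ 2) (gaussPi ι) := hG.integrable_sq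
  have iξ2 : Integrable (fun z => (∑ i, c i * z i) ^ 2) (gaussPi ι) := hξ.integrable_sq
  have iGξ : Integrable (fun z => G z * ∑ i, c i * z i) (gaussPi ι) := hG.integrable_mul hξ
  have e1 : ∫ z, (∑ i, c i * z i) ∂(gaussPi ι) = 0 := by
    rw [integral_finsetSum _ fun i _ => ((memLp_eval_gaussPi i).integrable (by norm_num)).const_mul _]
    simp only [integral_const_mul, integral_eval_gaussPi, mul_zero, Finset.sum_const_zero]
  have e2 : ∫ z, G z * ∑ i, c i * z i ∂(gaussPi ι) = ∑ i, c i ^ 2 := by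
    have : ∀ z : ι → ℝ, G z * ∑ i, c i * z i = ∑ i, c i * (G z * z i) := fun z => by
      rw [Finset.mul_sum]
      exact Finset.sum_congr rfl fun i _ => by ring
    simp_rw [this]
    have hGi : ∀ i, Integrable (fun z => G z * z i) (gaussPi ι) := fun i =>
      hG.integrable_mul (memLp_eval_gaussPi i)
    rw [integral_finsetSum _ fun i _ => (hGi i).const_mul _]
    simp only [integral_const_mul]
    exact Finset.sum_congr rfl fun i _ => by rw [sq]
  have key : 0 ≤ ∫ z, (G z - a - ∑ i, c i * z i) ^ 2 ∂(gaussPi ι) :=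
    integral_nonneg fun z => sq_nonneg _
  have hexp : ∀ z : ι → ℝ, (G z - a - ∑ i, c i * z i) ^ 2 =
      G z ^ 2 + (∑ i, c i * z i) ^ 2 - 2 * (G z * ∑ i, c i * z i) - 2 * a * G z +
        2 * a * (∑ i, c i * z i) + a ^ 2 := fun z => by ring
  simp_rw [hexp] at key
  have i1 : Integrable (fun z => G z ^ 2 + (∑ i, c i * z i) ^ 2 - 2 * (G z * ∑ i, c i * z i))
    (gaussPi ι) := (iG2.add iξ2).sub (iGξ.const_mul 2)
  have i2 : Integrable (fun z => G z ^ 2 + (∑ i, c i * z i) ^ 2 - 2 * (G z * ∑ i, c i * z i) -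
    2 * a * G z) (gaussPi ι) := i1.sub (hG1.const_mul (2 * a))
  rw [integral_add (i2.fun_add (hξ1.const_mul (2 * a))) (integrable_const _),
    integral_add i2 (hξ1.const_mul (2 * a)), integral_sub i1 (hG1.const_mul (2 * a)),
    integral_sub (iG2.fun_add iξ2) (iGξ.const_mul 2), integral_add iG2 iξ2,
    integral_const_mul, integral_const_mul, integral_const_mul, e1, e2,
    integral_sum_mul_sq_gaussPi, ← ha] at key
  simp only [integral_const, probReal_univ, smul_eq_mul] at key
  nlinarith [key]

variable {r : ι → ℝ} (hr : ∀ i, r i ∈ Ico (0 : ℝ) 1) {g : (ι → ℝ) → ℝ} (hg : Measurable g)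
  {B : ℝ} (hB : ∀ x, |g x| ≤ B)

include hg hB in
lemma memLp_comp_ouPoint (y : ι → ℝ) : MemLp (fun z => g (ouPoint r y z)) 2 (gaussPi ι) :=
  MemLp.of_bound (hg.comp (measurable_ouPoint r y)).aestronglyMeasurable B
    (ae_of_all _ fun z => by simpa using hB _)

include hr hg in
lemma mehlerInt_gaussPi (y : ι → ℝ) :
    mehlerInt r (gaussPi ι) g y = ∫ z, g (ouPoint r y z) ∂(gaussPi ι) :=
  integral_mul_mehler hr y hg

include hr hg hB in
lemma abs_mehlerInt_gaussPi_le (y : ι → ℝ) : |mehlerInt r (gaussPi ι) g y| ≤ B := by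
  rw [mehlerInt_gaussPi hr hg]
  have := norm_integral_le_of_norm_le_const (μ := gaussPi ι) (f := fun z => g (ouPoint r y z))
    (C := B) (ae_of_all _ fun z => by simpa using hB _)
  simpa using this

-- The derivative falls on the kernel rather than on g, so bounded measurable g suffices. It appears
-- as the first Hermite coefficient of z ↦ g(ry + √(1 − r²) z), which is what Bessel's inequality
-- controls.
include hr hg hB in
lemma pderivAt_mehlerInt_gaussPi [DecidableEq ι] (i : ι) (y : ι → ℝ) :
    pderivAt i (mehlerInt r (gaussPi ι) g) y =
      r i / √(1 - r i ^ 2) * ∫ z, g (ouPoint r y z) * z i ∂(gaussPi ι) := by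
  rw [(pderivAt_mehlerInt hr hg hB i y).2, integral_mul_mehler hr y (g := fun x =>
    g x * ((r i * x i - r i ^ 2 * y i) / (1 - r i ^ 2))) (by fun_prop), ← integral_const_mul]
  refine integral_congr_ae (ae_of_all _ fun z => ?_)
  have h := one_sub_sq_pos (hr i)
  have h1 : √(1 - r i ^ 2) ≠ 0 := (Real.sqrt_pos.2 h).ne'
  have h2 : (1 - r i ^ 2) = √(1 - r i ^ 2) ^ 2 := (Real.sq_sqrt h.le).symm
  have h3 : (r i * ouPoint r y z i - r i ^ 2 * y i) / (1 - r i ^ 2) = r i / √(1 - r i ^ 2) * z i := by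
    rw [div_eq_iff h.ne']
    nth_rw 2 [h2]
    simp only [ouPoint]
    field_simp
    ring
  simp only [h3]
  ring

include hr hg hB in
/-- The reverse Poincaré inequality. -/
theorem sum_pderivAt_mehlerInt_sq_le [DecidableEq ι] {v : ℝ} (hv0 : 0 ≤ v)
    (hrv : ∀ i, r i ^ 2 ≤ v) (y : ι → ℝ) :
    (1 - v) * ∑ i, pderivAt i (mehlerInt r (gaussPi ι) g) y ^ 2 ≤
      v * (mehlerInt r (gaussPi ι) (fun x => g x ^ 2) y - mehlerInt r (gaussPi ι) g y ^ 2) := by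
  have hb := sum_sq_integral_mul_eval_le (memLp_comp_ouPoint (r := r) hg hB y)
  rw [← mehlerInt_gaussPi hr hg, ← integral_mul_mehler hr y (g := fun x => g x ^ 2) (by fun_prop)] at hb

  refine le_trans ?_ (mul_le_mul_of_nonneg_left hb hv0)
  rw [Finset.mul_sum, Finset.mul_sum]
  refine Finset.sum_le_sum fun i _ => ?_
  have h := one_sub_sq_pos (hr i)
  rw [pderivAt_mehlerInt_gaussPi hr hg hB, mul_pow, div_pow, Real.sq_sqrt h.le, ← mul_assoc]
  refine mul_le_mul_of_nonneg_right ?_ (sq_nonneg _)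
  -- What is needed is r²/(1 − r²) ≤ v/(1 − v), from monotonicity of t/(1 − t).
  rw [← mul_div_assoc, div_le_iff₀ h]
  nlinarith [hrv i]

include hr hg hB in
lemma exists_abs_pderivAt_mehlerInt_le [DecidableEq ι] :
    ∃ C, ∀ i y, |pderivAt i (mehlerInt r (gaussPi ι) g) y| ≤ C := by
  have hC : ∀ i, ∃ C, 0 ≤ C ∧ ∀ y, |pderivAt i (mehlerInt r (gaussPi ι) g) y| ≤ C := fun i => by
    refine ⟨|r i / √(1 - r i ^ 2)| * ∫ z : ι → ℝ, |B| * |z i| ∂(gaussPi ι), mul_nonneg (abs_nonneg _)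
      (integral_nonneg fun z => by positivity), fun y => ?_⟩
    rw [pderivAt_mehlerInt_gaussPi hr hg hB, abs_mul]
    refine mul_le_mul_of_nonneg_left ?_ (abs_nonneg _)
    have hi : Integrable (fun z : ι → ℝ => |B| * |z i|) (gaussPi ι) :=
      (((memLp_eval_gaussPi i).integrable (by norm_num)).abs).const_mul _
    refine norm_integral_le_of_norm_le (f := fun z => g (ouPoint r y z) * z i) hi
      (ae_of_all _ fun z => ?_)
    rw [norm_mul]
    exact mul_le_mul_of_nonneg_right ((hB _).trans (le_abs_self B)) (abs_nonneg _)
  choose C hC0 hC using hC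
  exact ⟨∑ i, C i, fun i y => (hC i y).trans
    (Finset.single_le_sum (f := C) (fun j _ => hC0 j) (Finset.mem_univ i))⟩

end reversePoincare

/-! ### The score of a measure along the Mehler flow -/

/-- Fatou's lemma for real-valued functions with a uniform bound. -/
lemma lintegral_ofReal_le_of_tendsto {α : Type*} [MeasurableSpace α] {P : Measure α}
    {F : ℕ → α → ℝ} {f : α → ℝ} {C : ℝ≥0∞} (hF : ∀ k, Measurable (F k))
    (hlim : ∀ x, Tendsto (fun k => F k x) atTop (𝓝 (f x)))
    (hC : ∀ᶠ k in atTop, ∫⁻ x, ENNReal.ofReal (F k x) ∂P ≤ C) :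
    ∫⁻ x, ENNReal.ofReal (f x) ∂P ≤ C := by
  calc ∫⁻ x, ENNReal.ofReal (f x) ∂P
      = ∫⁻ x, liminf (fun k => ENNReal.ofReal (F k x)) atTop ∂P := by
        refine lintegral_congr fun x => ?_
        exact ((ENNReal.continuous_ofReal.tendsto _).comp (hlim x)).liminf_eq.symm
    _ ≤ liminf (fun k => ∫⁻ x, ENNReal.ofReal (F k x) ∂P) atTop :=
        lintegral_liminf_le fun k => (hF k).ennreal_ofReal
    _ ≤ C := liminf_le_of_frequently_le' hC.frequently

section score

variable {ι : Type} [Fintype ι]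

/-- Smooth bounded functions with bounded partial derivatives. -/
structure IsTestFunction [DecidableEq ι] (u : (ι → ℝ) → ℝ) : Prop where
  contDiff : ContDiff ℝ ∞ u
  bounded : ∃ C, ∀ x, |u x| ≤ C
  bounded_pderivAt : ∃ C, ∀ i x, |pderivAt i u x| ≤ C

/-- `S` is the score of `ν` relative to the Gaussian, `ν` is centred with finite second moments, and
satisfies a Poincaré inequality with constant `lam`. -/
structure HasScore [DecidableEq ι] (ν : Measure (ι → ℝ)) (lam : ℝ) (S : ι → (ι → ℝ) → ℝ) :
    Prop where
  integrable_sq : ∀ i, Integrable (fun x => x i ^ 2) ν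
  memLp : ∀ i, MemLp (S i) 2 ν
  integral_score : ∀ i, ∫ x, S i x ∂ν = 0
  integral_mul_score : ∀ u, IsTestFunction u → ∀ i,
    ∫ x, (x i * u x - pderivAt i u x) ∂ν = ∫ x, u x * S i x ∂ν
  poincare : ∀ u, IsTestFunction u →
    lam * (∫ x, u x ^ 2 ∂ν - (∫ x, u x ∂ν) ^ 2) ≤ ∫ x, ∑ i, pderivAt i u x ^ 2 ∂ν

variable {r : ι → ℝ} (hr : ∀ i, r i ∈ Ico (0 : ℝ) 1)

include hr in
lemma isTestFunction_mehlerInt [DecidableEq ι] {g : (ι → ℝ) → ℝ} (hg : Measurable g) {B : ℝ}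
    (hB : ∀ x, |g x| ≤ B) : IsTestFunction (mehlerInt r (gaussPi ι) g) :=
  ⟨contDiff_mehlerInt hr hg hB, ⟨B, abs_mehlerInt_gaussPi_le hr hg hB⟩,
    exists_abs_pderivAt_mehlerInt_le hr hg hB⟩

include hr in
lemma integrable_mehler_prod {ν : Measure (ι → ℝ)} [IsFiniteMeasure ν]
    {F : (ι → ℝ) × (ι → ℝ) → ℝ} (hF : Measurable F)
    (hfin : ∫⁻ y, ∫⁻ z, ‖F (ouPoint r y z, y)‖ₑ ∂(gaussPi ι) ∂ν ≠ ⊤) :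
    Integrable (fun p => mehler r p.1 p.2 * F p) ((gaussPi ι).prod ν) := by
  have hm : Measurable fun p : (ι → ℝ) × (ι → ℝ) => mehler r p.1 p.2 * F p :=
    (continuous_mehler r).measurable.mul hF
  refine ⟨hm.aestronglyMeasurable, ?_⟩
  rw [HasFiniteIntegral, lintegral_prod_symm _ hm.enorm.aemeasurable, lt_top_iff_ne_top]
  convert hfin using 2
  funext y
  rw [← lintegral_mul_mehler hr y (g := fun x => ‖F (x, y)‖ₑ)
    (hF.comp (measurable_id.prodMk measurable_const)).enorm]
  refine lintegral_congr fun x => ?_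
  rw [enorm_mul, Real.enorm_eq_ofReal (mehler_pos hr _ _).le]

include hr in
lemma integrable_mehler_prod_of_bounded {ν : Measure (ι → ℝ)} [IsFiniteMeasure ν]
    {F : (ι → ℝ) × (ι → ℝ) → ℝ} (hF : Measurable F) {B : ℝ} (hB : ∀ p, |F p| ≤ B) :
    Integrable (fun p => mehler r p.1 p.2 * F p) ((gaussPi ι).prod ν) := by
  refine integrable_mehler_prod hr hF (ne_top_of_le_ne_top ?_ (lintegral_mono fun y =>
    lintegral_mono fun z => (Real.enorm_eq_ofReal_abs _).le.trans
      (ENNReal.ofReal_le_ofReal (hB _))))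
  simp only [lintegral_const, measure_univ, mul_one]
  exact ENNReal.mul_ne_top ENNReal.ofReal_ne_top (measure_ne_top _ _)

include hr in
lemma integrable_mehler_prod_moment {ν : Measure (ι → ℝ)} [IsProbabilityMeasure ν] (i : ι)
    (hM : Integrable (fun x => x i ^ 2) ν) :
    Integrable (fun p => mehler r p.1 p.2 * (1 + p.1 i ^ 2 + p.2 i ^ 2)) ((gaussPi ι).prod ν) := by
  refine integrable_mehler_prod hr (by fun_prop) ?_
  have h1 : ∀ y z : ι → ℝ, ‖1 + ouPoint r y z i ^ 2 + y i ^ 2‖ₑ ≤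
      ENNReal.ofReal (1 + 3 * y i ^ 2) + ENNReal.ofReal (2 * z i ^ 2) := fun y z => by
    rw [Real.enorm_eq_ofReal (by positivity), ← ENNReal.ofReal_add (by positivity) (by positivity)]
    refine ENNReal.ofReal_le_ofReal ?_
    have h2 : ouPoint r y z i ^ 2 ≤ 2 * (r i ^ 2 * y i ^ 2) + 2 * ((1 - r i ^ 2) * z i ^ 2) := by
      have := Real.sq_sqrt (one_sub_sq_pos (hr i)).le
      simp only [ouPoint]
      nlinarith [sq_nonneg (r i * y i - √(1 - r i ^ 2) * z i)]
    have h3 : r i ^ 2 ≤ 1 := by linarith [one_sub_sq_pos (hr i)]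
    have h4 : r i ^ 2 * y i ^ 2 ≤ 1 * y i ^ 2 := mul_le_mul_of_nonneg_right h3 (sq_nonneg _)
    have h5 : (1 - r i ^ 2) * z i ^ 2 ≤ 1 * z i ^ 2 :=
      mul_le_mul_of_nonneg_right (by linarith [sq_nonneg (r i)]) (sq_nonneg _)
    linarith
  refine ne_top_of_le_ne_top ?_ (lintegral_mono fun y => lintegral_mono fun z => h1 y z)
  have hz : Integrable (fun z : ι → ℝ => 2 * z i ^ 2) (gaussPi ι) :=
    (memLp_eval_gaussPi i).integrable_sq.const_mul 2
  have hy : Integrable (fun y : ι → ℝ => 1 + 3 * y i ^ 2) ν :=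
    (integrable_const _).add (hM.const_mul 3)
  simp only [lintegral_add_left measurable_const, lintegral_const, measure_univ,
    mul_one]
  rw [lintegral_add_right _ measurable_const]
  refine ENNReal.add_ne_top.2 ⟨?_, ?_⟩
  · rw [← ofReal_integral_eq_lintegral_ofReal hy (ae_of_all _ fun y => by positivity)]
    exact ENNReal.ofReal_ne_top
  · rw [lintegral_const, measure_univ, mul_one,
      ← ofReal_integral_eq_lintegral_ofReal hz (ae_of_all _ fun y => by positivity)]
    exact ENNReal.ofReal_ne_top

/-- The density of the image of `ν` under the Mehler flow. -/
def flowDensity (r : ι → ℝ) (ν : Measure (ι → ℝ)) : (ι → ℝ) → ℝ := mehlerInt r ν fun _ => 1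

variable {ν : Measure (ι → ℝ)} [IsProbabilityMeasure ν]

include hr in
lemma contDiff_flowDensity : ContDiff ℝ ∞ (flowDensity r ν) :=
  contDiff_mehlerInt hr measurable_const (B := 1) (by simp)

include hr in
lemma flowDensity_pos (x : ι → ℝ) : 0 < flowDensity r ν x := by
  have hi := integrable_mehler_mul (m := ν) hr (g := fun _ => 1) measurable_const (B := 1) (by simp) x
  rw [flowDensity, mehlerInt, integral_pos_iff_support_of_nonneg
    (fun y => by simpa using (mehler_pos hr y x).le) hi]
  have : (Function.support fun y => mehler r y x * 1) = univ := by
    ext y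
    simpa using (mehler_pos hr y x).ne'
  rw [this]
  simp

include hr in
lemma ofReal_flowDensity (x : ι → ℝ) :
    ENNReal.ofReal (flowDensity r ν x) = ∫⁻ y, ENNReal.ofReal (mehler r y x) ∂ν := by
  have hi := integrable_mehler_mul (m := ν) hr (g := fun _ => 1) measurable_const (B := 1) (by simp) x
  rw [flowDensity, mehlerInt, ofReal_integral_eq_lintegral_ofReal hi
    (ae_of_all _ fun y => by simpa using (mehler_pos hr y x).le)]
  simp

-- Duality: the density evolves by the adjoint of the operator acting on test functions, and the
-- kernel is symmetric.
include hr in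
lemma integral_mul_flowDensity {g : (ι → ℝ) → ℝ} (hg : Measurable g) {B : ℝ}
    (hB : ∀ x, |g x| ≤ B) : Integrable (fun x => g x * flowDensity r ν x) (gaussPi ι) ∧
    ∫ x, g x * flowDensity r ν x ∂(gaussPi ι) = ∫ y, mehlerInt r (gaussPi ι) g y ∂ν := by
  have hint := integrable_mehler_prod_of_bounded (ν := ν) hr (F := fun p => g p.1)
    (hg.comp measurable_fst) (fun p => hB p.1)
  have h1 : ∀ x, g x * flowDensity r ν x = ∫ y, mehler r x y * g x ∂ν := fun x => by
    rw [flowDensity, mehlerInt, ← integral_const_mul]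
    refine integral_congr_ae (ae_of_all _ fun y => ?_)
    simp only [mehler_comm r y x]
    ring
  simp_rw [h1]
  exact ⟨hint.integral_prod_left, integral_integral_swap (f := fun x y => mehler r x y * g x) hint⟩

-- The derivative of the flow density falls on the kernel, and (after swapping the integrals)
-- becomes r times the Gaussian adjoint xᵢ − ∂ᵢ applied to the smoothed function. The defining
-- relation of the score finishes.
include hr in
lemma integral_mul_pderivAt_flowDensity [DecidableEq ι] {lam : ℝ} {S : ι → (ι → ℝ) → ℝ}
    (hS : HasScore ν lam S) {g : (ι → ℝ) → ℝ} (hg : Measurable g) {B : ℝ} (hB : ∀ x, |g x| ≤ B)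
    (i : ι) : ∫ x, g x * pderivAt i (flowDensity r ν) x ∂(gaussPi ι) =
      r i * ∫ y, mehlerInt r (gaussPi ι) g y * S i y ∂ν := by
  have h0 := one_sub_sq_pos (hr i)
  have hint : Integrable (fun p : (ι → ℝ) × (ι → ℝ) => mehler r p.1 p.2 *
      (g p.1 * ((r i * p.2 i - r i ^ 2 * p.1 i) / (1 - r i ^ 2)))) ((gaussPi ι).prod ν) := by
    refine ((integrable_mehler_prod_moment hr i (hS.integrable_sq i)).const_mul
      (|B| / (1 - r i ^ 2))).mono' ((continuous_mehler r).measurable.mul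
        (by fun_prop)).aestronglyMeasurable (ae_of_all _ fun p => ?_)
    have hk := mehler_pos hr p.1 p.2
    rw [norm_mul, Real.norm_of_nonneg hk.le, mul_left_comm]
    refine mul_le_mul_of_nonneg_left ?_ hk.le
    rw [norm_mul, norm_div, Real.norm_of_nonneg h0.le, div_mul_eq_mul_div, ← mul_div_assoc]
    refine div_le_div_of_nonneg_right ?_ h0.le
    refine mul_le_mul ((hB _).trans (le_abs_self B)) ?_ (norm_nonneg _) (abs_nonneg _)
    have hr1 := (hr i).2
    have hr0 := (hr i).1
    have h3 : r i ^ 2 ≤ 1 := by linarith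
    refine abs_le.2 ⟨?_, ?_⟩ <;>
      nlinarith [sq_nonneg (p.2 i - 1), sq_nonneg (p.2 i + 1), sq_nonneg (p.1 i + 1),
        sq_nonneg (p.1 i - 1), mul_nonneg hr0 (sq_nonneg (p.2 i - 1)),
        mul_nonneg hr0 (sq_nonneg (p.2 i + 1)), mul_nonneg (sq_nonneg (r i)) (sq_nonneg (p.1 i + 1)),
        mul_nonneg (sq_nonneg (r i)) (sq_nonneg (p.1 i - 1)),
        mul_nonneg (sub_nonneg.2 hr1.le) (sq_nonneg (p.2 i)),
        mul_nonneg (sub_nonneg.2 h3) (sq_nonneg (p.1 i))]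
  have h1 : ∀ x, g x * pderivAt i (flowDensity r ν) x = ∫ y, mehler r x y *
      (g x * ((r i * y i - r i ^ 2 * x i) / (1 - r i ^ 2))) ∂ν := fun x => by
    rw [flowDensity, (pderivAt_mehlerInt hr measurable_const (B := 1) (by simp) i x).2,
      ← integral_const_mul]
    refine integral_congr_ae (ae_of_all _ fun y => ?_)
    simp only [mehler_comm r y x]
    ring
  -- Kernel identity: differentiating in x yields r (yᵢ − ∂/∂yᵢ) of the kernel.
  have h2 : ∀ y, ∫ x, mehler r x y * (g x * ((r i * y i - r i ^ 2 * x i) / (1 - r i ^ 2)))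
      ∂(gaussPi ι) = r i * (y i * mehlerInt r (gaussPi ι) g y -
        pderivAt i (mehlerInt r (gaussPi ι) g) y) := fun y => by
    have hd := pderivAt_mehlerInt (m := gaussPi ι) hr hg hB i y
    rw [hd.2, mehlerInt, ← integral_const_mul, ← integral_sub
      ((integrable_mehler_mul (m := gaussPi ι) hr hg hB y).const_mul (y i)) hd.1,
      ← integral_const_mul]
    refine integral_congr_ae (ae_of_all _ fun x => ?_)
    field_simp
    ring
  simp_rw [h1]
  rw [integral_integral_swap (f := fun x y => mehler r x y *
    (g x * ((r i * y i - r i ^ 2 * x i) / (1 - r i ^ 2)))) hint]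
  simp_rw [h2]
  rw [integral_const_mul, hS.integral_mul_score _ (isTestFunction_mehlerInt hr hg hB)]

end score

/-! ### Decay of the Fisher information along the Mehler flow -/

section fisher

variable {ι : Type} [Fintype ι] [DecidableEq ι] {ν : Measure (ι → ℝ)} [IsProbabilityMeasure ν]

lemma IsTestFunction.measurable {u : (ι → ℝ) → ℝ} (hu : IsTestFunction u) : Measurable u :=
  hu.contDiff.continuous.measurable

lemma IsTestFunction.memLp {u : (ι → ℝ) → ℝ} (hu : IsTestFunction u) : MemLp u 2 ν := by
  obtain ⟨C, hC⟩ := hu.bounded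
  exact MemLp.of_bound hu.measurable.aestronglyMeasurable C (ae_of_all _ hC)

lemma continuous_pderivAt {f : (ι → ℝ) → ℝ} (hf : ContDiff ℝ ∞ f) (i : ι) :
    Continuous (pderivAt i f) :=
  (hf.continuous_fderiv (by simp)).clm_apply continuous_const

variable {r : ι → ℝ} (hr : ∀ i, r i ∈ Ico (0 : ℝ) 1) {lam : ℝ} {S : ι → (ι → ℝ) → ℝ}
  (hS : HasScore ν lam S) {v : ℝ} (hv : v ∈ Ioo (0 : ℝ) 1) (hrv : ∀ i, r i ^ 2 ≤ v)

-- With u = P_r g, the Poincaré inequality gives λ(1 − v) Var u ≤ (1 − v)∫|∇u|², and the reverse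
-- Poincaré inequality bounds this by v(∫ P_r(g²) − ∫ u²). Moving v∫u² to the left produces the
-- constant v + λ(1 − v).
include hr hS hv hrv in
lemma variance_mehlerInt_le {g : (ι → ℝ) → ℝ} (hg : Measurable g)
    {B : ℝ} (hB : ∀ x, |g x| ≤ B) :
    (v + lam * (1 - v)) * (∫ y, mehlerInt r (gaussPi ι) g y ^ 2 ∂ν -
      (∫ y, mehlerInt r (gaussPi ι) g y ∂ν) ^ 2) ≤
      v * ∫ x, g x ^ 2 * flowDensity r ν x ∂(gaussPi ι) := by
  have hT := isTestFunction_mehlerInt hr hg hB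
  have hB2 : ∀ x, |g x ^ 2| ≤ B ^ 2 := fun x => by
    rw [abs_pow]
    exact pow_le_pow_left₀ (abs_nonneg _) (hB x) 2
  have hT2 := isTestFunction_mehlerInt (g := fun x => g x ^ 2) hr (hg.pow_const 2) hB2
  rw [(integral_mul_flowDensity (ν := ν) (g := fun x => g x ^ 2) hr (hg.pow_const 2) hB2).2]
  set u := mehlerInt r (gaussPi ι) g
  set w := mehlerInt r (gaussPi ι) fun x => g x ^ 2
  have hP := hS.poincare u hT
  obtain ⟨C, hC⟩ := hT.bounded_pderivAt
  have i1 : Integrable (fun y => ∑ i, pderivAt i u y ^ 2) ν := by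
    refine integrable_finsetSum _ fun i _ => ?_
    refine (MemLp.of_bound (continuous_pderivAt hT.contDiff i).measurable.aestronglyMeasurable C
      (ae_of_all _ fun x => ?_)).integrable_sq
    exact hC i x
  have i2 : Integrable (fun y => u y ^ 2) ν := hT.memLp.integrable_sq
  have i3 : Integrable w ν := hT2.memLp.integrable (by norm_num)
  have h1 : (1 - v) * ∫ y, ∑ i, pderivAt i u y ^ 2 ∂ν ≤ v * (∫ y, w y ∂ν - ∫ y, u y ^ 2 ∂ν) := by
    rw [← integral_const_mul, ← integral_sub i3 i2, ← integral_const_mul]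
    exact integral_mono (i1.const_mul _) ((i3.sub i2).const_mul _) fun y =>
      sum_pderivAt_mehlerInt_sq_le hr hg hB hv.1.le hrv y
  have h2 := mul_le_mul_of_nonneg_left hP (sub_nonneg.2 hv.2.le)
  have h3 : 0 ≤ v * (∫ y, u y ∂ν) ^ 2 := mul_nonneg hv.1.le (sq_nonneg _)
  linarith

-- For a truncated score g of the flow density, ∫ g² f_r equals r times the pairing of P_r g with
-- the score of ν. Centring P_r g costs nothing because the score has mean zero, so the variance
-- bound applies and the quantity is estimated by half of itself plus the score term.
include hr hS hv hrv in
lemma sum_integral_truncated_le (hlam : 0 < lam) {g : (ι → ℝ) → ℝ} (hg : Measurable g)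
    {B : ℝ} (hB : ∀ x, |g x| ≤ B) (i : ι)
    (hgf : ∀ x, g x * pderivAt i (flowDensity r ν) x = g x ^ 2 * flowDensity r ν x) :
    ∫ x, g x ^ 2 * flowDensity r ν x ∂(gaussPi ι) ≤
      r i ^ 2 * (v / (v + lam * (1 - v))) * ∫ x, S i x ^ 2 ∂ν := by
  have hT := isTestFunction_mehlerInt hr hg hB
  have h1 := integral_mul_pderivAt_flowDensity hr hS hg hB i
  have h2 := variance_mehlerInt_le hr hS hv hrv hg hB
  simp_rw [hgf] at h1
  set A := ∫ x, g x ^ 2 * flowDensity r ν x ∂(gaussPi ι)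
  set u := mehlerInt r (gaussPi ι) g
  set a := ∫ y, u y ∂ν
  have hv0 := hv.1
  have hκ : 0 < v + lam * (1 - v) := add_pos hv.1 (mul_pos hlam (sub_pos.2 hv.2))
  have hu := hT.memLp (ν := ν)
  have iu : Integrable u ν := hu.integrable (by norm_num)
  have iu2 : Integrable (fun y => u y ^ 2) ν := hu.integrable_sq
  have iS : Integrable (S i) ν := (hS.memLp i).integrable (by norm_num)
  have iS2 : Integrable (fun y => S i y ^ 2) ν := (hS.memLp i).integrable_sq
  have iuS : Integrable (fun y => u y * S i y) ν := hu.integrable_mul (hS.memLp i)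
  have e1 : ∫ y, (u y - a) ^ 2 ∂ν = ∫ y, u y ^ 2 ∂ν - a ^ 2 := by
    have : ∀ y, (u y - a) ^ 2 = u y ^ 2 - 2 * a * u y + a ^ 2 := fun y => by ring
    simp_rw [this]
    have ii : Integrable (fun y => u y ^ 2 - 2 * a * u y) ν := iu2.sub (iu.const_mul _)
    rw [integral_add ii (integrable_const _), integral_sub iu2 (iu.const_mul _),
      integral_const_mul, integral_const, probReal_univ, smul_eq_mul]
    ring
  have e2 : A = ∫ y, r i * ((u y - a) * S i y) ∂ν := by
    rw [integral_const_mul, h1]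
    have : ∀ y, (u y - a) * S i y = u y * S i y - a * S i y := fun y => by ring
    simp_rw [this]
    rw [integral_sub iuS (iS.const_mul _), integral_const_mul, hS.integral_score, mul_zero, sub_zero]
  have iua : Integrable (fun y => (u y - a) ^ 2) ν := (hu.sub (memLp_const a)).integrable_sq
  have iuaS : Integrable (fun y => r i * ((u y - a) * S i y)) ν :=
    ((hu.sub (memLp_const a)).integrable_mul (hS.memLp i)).const_mul (r i)
  have e3 : A ≤ (v + lam * (1 - v)) / v / 2 * ∫ y, (u y - a) ^ 2 ∂ν +
      r i ^ 2 * (v / (v + lam * (1 - v))) / 2 * ∫ y, S i y ^ 2 ∂ν := by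
    rw [e2, ← integral_const_mul, ← integral_const_mul,
      ← integral_add (iua.const_mul _) (iS2.const_mul _)]
    refine integral_mono iuaS ((iua.const_mul _).add (iS2.const_mul _)) fun y => ?_
    -- Young's inequality with weight (v + λ(1 − v))/v, chosen so that the variance bound turns the
    -- first term into at most A/2.
    have h3 : (v + lam * (1 - v)) / v / 2 * (u y - a) ^ 2 +
        r i ^ 2 * (v / (v + lam * (1 - v))) / 2 * S i y ^ 2 - r i * ((u y - a) * S i y) =
        ((v + lam * (1 - v)) * (u y - a) - v * (r i * S i y)) ^ 2 /
          (2 * v * (v + lam * (1 - v))) := by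
      field_simp
      ring
    have h4 : 0 ≤ ((v + lam * (1 - v)) * (u y - a) - v * (r i * S i y)) ^ 2 /
          (2 * v * (v + lam * (1 - v))) := by positivity
    show r i * ((u y - a) * S i y) ≤ _ + _
    linarith
  rw [e1] at e3
  have h5 : (v + lam * (1 - v)) / v / 2 * (∫ y, u y ^ 2 ∂ν - a ^ 2) ≤ A / 2 := by
    rw [div_div, div_mul_eq_mul_div, div_le_iff₀ (by positivity)]
    linarith
  linarith

include hr hS hv hrv in
/-- The Fisher information in direction `i` along the Mehler flow. -/
theorem lintegral_fisher_flowDensity_le (hlam : 0 < lam) (i : ι) :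
    ∫⁻ x, ENNReal.ofReal (pderivAt i (flowDensity r ν) x ^ 2 / flowDensity r ν x) ∂(gaussPi ι) ≤
      ENNReal.ofReal (r i ^ 2 * (v / (v + lam * (1 - v))) * ∫ x, S i x ^ 2 ∂ν) := by
  set f := flowDensity r ν with hf
  have hfpos : ∀ x, 0 < f x := flowDensity_pos hr
  have hfm : Measurable f := (contDiff_flowDensity hr).continuous.measurable
  have hDm : Measurable (pderivAt i f) := (continuous_pderivAt (contDiff_flowDensity hr) i).measurable
  have hqm : Measurable fun x => pderivAt i f x / f x := hDm.div hfm
  -- The score of the flow density is cut off where it is large: finiteness of its Fisher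
  -- information is not known in advance, and the pairing needs bounded g. Fatou's lemma removes the
  -- cutoff.
  let g : ℕ → (ι → ℝ) → ℝ := fun k =>
    {x | |pderivAt i f x / f x| ≤ k}.indicator fun x => pderivAt i f x / f x
  have hgm : ∀ k, Measurable (g k) := fun k =>
    hqm.indicator (measurableSet_le hqm.abs measurable_const)
  have hgb : ∀ k x, |g k x| ≤ k := fun k x => by
    by_cases hx : |pderivAt i f x / f x| ≤ k
    · simp [g, hx]
    · simp [g, hx]
  refine lintegral_ofReal_le_of_tendsto (F := fun k x => g k x ^ 2 * f x)
    (fun k => ((hgm k).pow_const 2).mul hfm) (fun x => ?_) (Eventually.of_forall fun k => ?_)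
  · refine tendsto_const_nhds.congr' ?_
    obtain ⟨K, hK⟩ := exists_nat_ge |pderivAt i f x / f x|
    filter_upwards [eventually_ge_atTop K] with k hk
    have hx : |pderivAt i f x / f x| ≤ k := hK.trans (by exact_mod_cast hk)
    have := (hfpos x).ne'
    simp only [g, indicator, mem_ofPred_eq, hx, if_true]
    field_simp
  · have hgk2 : ∀ x, |g k x ^ 2| ≤ (k : ℝ) ^ 2 := fun x => by
      rw [abs_pow]
      exact pow_le_pow_left₀ (abs_nonneg _) (hgb k x) 2
    rw [← ofReal_integral_eq_lintegral_ofReal (integral_mul_flowDensity (ν := ν) hr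
      (g := fun x => g k x ^ 2) ((hgm k).pow_const 2) hgk2).1
      (ae_of_all _ fun x => mul_nonneg (sq_nonneg _) (hfpos x).le)]
    refine ENNReal.ofReal_le_ofReal
      (sum_integral_truncated_le hr hS hv hrv hlam (hgm k) (hgb k) i fun x => ?_)
    by_cases hx : |pderivAt i f x / f x| ≤ k
    · have := (hfpos x).ne'
      simp only [g, indicator, mem_ofPred_eq, hx, if_true, ← hf]
      field_simp
    · simp [g, hx]

end fisher

/-! ### Entropy along the Mehler flow, one coordinate at a time -/

section flowEntropy

variable {ι : Type} [Fintype ι] [DecidableEq ι] {ν : Measure (ι → ℝ)} [IsProbabilityMeasure ν]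
  {r : ι → ℝ} (hr : ∀ i, r i ∈ Ico (0 : ℝ) 1)

include hr in
omit [DecidableEq ι] in
lemma lintegral_sq_mul_flowDensity_ne_top (i : ι) (hM : Integrable (fun x => x i ^ 2) ν) :
    ∫⁻ x, ENNReal.ofReal (x i ^ 2 * flowDensity r ν x) ∂(gaussPi ι) ≠ ⊤ := by
  have hint := (integrable_mehler_prod_moment hr i hM).hasFiniteIntegral
  have hm : Measurable fun p : (ι → ℝ) × (ι → ℝ) =>
      mehler r p.1 p.2 * (1 + p.1 i ^ 2 + p.2 i ^ 2) :=
    (continuous_mehler r).measurable.mul (by fun_prop)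
  rw [HasFiniteIntegral, lintegral_prod _ hm.enorm.aemeasurable] at hint
  refine ne_top_of_le_ne_top hint.ne (lintegral_mono fun x => ?_)
  rw [ENNReal.ofReal_mul (sq_nonneg _), ofReal_flowDensity hr, ← lintegral_const_mul _
    (continuous_mehler_left r x).measurable.ennreal_ofReal]
  refine lintegral_mono fun y => ?_
  have hk := mehler_pos hr x y
  rw [mehler_comm r y x, ← ENNReal.ofReal_mul (sq_nonneg _), Real.enorm_eq_ofReal (by positivity)]
  refine ENNReal.ofReal_le_ofReal ?_
  rw [mul_comm]
  exact mul_le_mul_of_nonneg_left (by nlinarith [sq_nonneg (y i)]) hk.le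

include hr in
omit [Fintype ι] in
lemma update_mul_mem (i : ι) {ρ : ℝ} (hρ : ρ ∈ Ico (0 : ℝ) 1) (j : ι) :
    Function.update r i (ρ * r i) j ∈ Ico (0 : ℝ) 1 := by
  rcases eq_or_ne j i with rfl | h
  · rw [Function.update_self]
    exact ⟨mul_nonneg hρ.1 (hr j).1, mul_lt_one_of_nonneg_of_lt_one_left hρ.1 hρ.2 (hr j).2.le⟩
  · rw [Function.update_of_ne h]
    exact hr j

-- Semigroup property: averaging a slice over the added Gaussian gives the flow density with rᵢ
-- replaced by ρrᵢ. This is the mass of the slice in the entropy comparison.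
include hr in
lemma lintegral_flowDensity_update (i : ι) {ρ : ℝ} (hρ : ρ ∈ Ico (0 : ℝ) 1) (x : ι → ℝ) :
    ∫⁻ z, ENNReal.ofReal (flowDensity r ν
      (Function.update x i (ρ * x i + √(1 - ρ ^ 2) * z))) ∂gaussLine =
      ENNReal.ofReal (flowDensity (Function.update r i (ρ * r i)) ν x) := by
  simp_rw [ofReal_flowDensity hr, ofReal_flowDensity (update_mul_mem hr i hρ)]
  rw [lintegral_lintegral_swap]
  · refine lintegral_congr fun y => ?_
    simp_rw [mehler_comm _ y]
    exact lintegral_mehler_update hr i hρ x y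
  · have hc : Continuous fun p : ℝ × (ι → ℝ) =>
        mehler r p.2 (Function.update x i (ρ * x i + √(1 - ρ ^ 2) * p.1)) :=
      Continuous.comp (g := fun p : (ι → ℝ) × (ι → ℝ) => mehler r p.1 p.2)
        (f := fun p : ℝ × (ι → ℝ) =>
          (p.2, Function.update x i (ρ * x i + √(1 - ρ ^ 2) * p.1))) (continuous_mehler r)
        (continuous_snd.prodMk (continuous_const.update i (by fun_prop)))
    exact hc.measurable.ennreal_ofReal.aemeasurable

include hr in
/-- The entropy along the Mehler flow in a single coordinate. -/
theorem lintegral_klFun_flowDensity_le (hM : ∀ i, Integrable (fun x => x i ^ 2) ν) (i : ι) {ρ : ℝ}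
    (hρ : ρ ∈ Ico (0 : ℝ) 1) :
    ∫⁻ x, ENNReal.ofReal (klFun (flowDensity r ν x)) ∂(gaussPi ι) ≤
      ∫⁻ x, ENNReal.ofReal (klFun (flowDensity (Function.update r i (ρ * r i)) ν x)) ∂(gaussPi ι) +
      ENNReal.ofReal (1 / 2 * (1 - ρ ^ 2)) * ∫⁻ x, ENNReal.ofReal
        (pderivAt i (flowDensity r ν) x ^ 2 / flowDensity r ν x) ∂(gaussPi ι) := by
  have hs := one_sub_sq_pos hρ
  have hr' := update_mul_mem hr i hρ
  have hC := contDiff_flowDensity (ν := ν) hr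
  have hpos := flowDensity_pos (ν := ν) hr
  have hfm : Measurable (flowDensity r ν) := hC.continuous.measurable
  have hDm : Measurable (pderivAt i (flowDensity r ν)) := (continuous_pderivAt hC i).measurable
  have hm1 : Measurable fun x => ENNReal.ofReal (klFun (flowDensity r ν x)) :=
    (measurable_klFun.comp hfm).ennreal_ofReal
  have hm2 : Measurable fun x =>
      ENNReal.ofReal (pderivAt i (flowDensity r ν) x ^ 2 / flowDensity r ν x) :=
    ((hDm.pow_const 2).div hfm).ennreal_ofReal
  have hm3 : Measurable fun x : ι → ℝ => ENNReal.ofReal (x i ^ 2 * flowDensity r ν x) :=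
    (((measurable_pi_apply i).pow_const 2).mul hfm).ennreal_ofReal
  have hm4 : Measurable fun x =>
      ENNReal.ofReal (klFun (flowDensity (Function.update r i (ρ * r i)) ν x)) :=
    (measurable_klFun.comp (contDiff_flowDensity hr').continuous.measurable).ennreal_ofReal
  have hup : Continuous fun p : (ι → ℝ) × ℝ =>
      Function.update p.1 i (ρ * p.1 i + √(1 - ρ ^ 2) * p.2) :=
    continuous_fst.update i (by fun_prop)
  -- By invariance both integrals become averages over slices s ↦ ρxᵢ + √(1 − ρ²) s. On a slice the
  -- line inequality applies: the derivative carries √(1 − ρ²), whence the factor 1 − ρ², and the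
  -- entropy of the slice mass is the entropy at the parameter ρrᵢ.
  rw [← lintegral_gaussPi_update hm1 i hρ, ← lintegral_gaussPi_update hm2 i hρ,
    ← lintegral_const_mul' _ _ ENNReal.ofReal_ne_top, ← lintegral_add_left hm4]
  have hae := lintegral_sq_mul_flowDensity_ne_top (ν := ν) hr i (hM i)
  rw [← lintegral_gaussPi_update hm3 i hρ] at hae
  have hae2 := ae_lt_top' (Measurable.lintegral_prod_right' (f := fun p : (ι → ℝ) × ℝ =>
    ENNReal.ofReal (Function.update p.1 i (ρ * p.1 i + √(1 - ρ ^ 2) * p.2) i ^ 2 *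
      flowDensity r ν (Function.update p.1 i (ρ * p.1 i + √(1 - ρ ^ 2) * p.2))))
    (hm3.comp hup.measurable)).aemeasurable hae
  refine lintegral_mono_ae ?_
  filter_upwards [hae2] with x hx
  have hupx : Continuous fun s : ℝ => Function.update x i (ρ * x i + √(1 - ρ ^ 2) * s) :=
    hup.comp (continuous_const.prodMk continuous_id)
  have hd : ∀ s, HasDerivAt (fun s => flowDensity r ν
      (Function.update x i (ρ * x i + √(1 - ρ ^ 2) * s)))
      (√(1 - ρ ^ 2) * pderivAt i (flowDensity r ν)
        (Function.update x i (ρ * x i + √(1 - ρ ^ 2) * s))) s := fun s => by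
    have h1 : HasDerivAt (fun s : ℝ => ρ * x i + √(1 - ρ ^ 2) * s) (√(1 - ρ ^ 2)) s := by
      simpa using ((hasDerivAt_id s).const_mul (√(1 - ρ ^ 2))).const_add (ρ * x i)
    have h2 := (hasDerivAt_update x i (ρ * x i + √(1 - ρ ^ 2) * s)).scomp s h1
    have h3 := ((hC.differentiable (by simp)
      (Function.update x i (ρ * x i + √(1 - ρ ^ 2) * s))).hasFDerivAt).comp_hasDerivAt s h2
    refine h3.congr_deriv ?_
    rw [map_smul, smul_eq_mul, pderivAt]
  have hmass := lintegral_flowDensity_update (ν := ν) hr i hρ x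
  have hmom : ∫⁻ s, ENNReal.ofReal (s ^ 2 * flowDensity r ν
      (Function.update x i (ρ * x i + √(1 - ρ ^ 2) * s))) ∂gaussLine ≠ ⊤ := by
    have hle : ∀ s : ℝ, ENNReal.ofReal (s ^ 2 * flowDensity r ν
        (Function.update x i (ρ * x i + √(1 - ρ ^ 2) * s))) ≤
        ENNReal.ofReal (2 / (1 - ρ ^ 2)) * ENNReal.ofReal
          (Function.update x i (ρ * x i + √(1 - ρ ^ 2) * s) i ^ 2 * flowDensity r ν
            (Function.update x i (ρ * x i + √(1 - ρ ^ 2) * s))) +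
        ENNReal.ofReal (2 / (1 - ρ ^ 2) * (ρ * x i) ^ 2) * ENNReal.ofReal (flowDensity r ν
            (Function.update x i (ρ * x i + √(1 - ρ ^ 2) * s))) := fun s => by
      have hp := hpos (Function.update x i (ρ * x i + √(1 - ρ ^ 2) * s))
      rw [← ENNReal.ofReal_mul (by positivity), ← ENNReal.ofReal_mul (by positivity),
        ← ENNReal.ofReal_add (by positivity) (by positivity), Function.update_self, ← mul_assoc,
        ← add_mul]
      refine ENNReal.ofReal_le_ofReal (mul_le_mul_of_nonneg_right ?_ hp.le)
      rw [← mul_add, div_mul_eq_mul_div, le_div_iff₀ hs]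
      have := Real.sq_sqrt hs.le
      nlinarith [sq_nonneg (2 * (ρ * x i) + √(1 - ρ ^ 2) * s)]
    refine ne_top_of_le_ne_top ?_ (lintegral_mono hle)
    have hm5 : Measurable fun s => ENNReal.ofReal (2 / (1 - ρ ^ 2) * (ρ * x i) ^ 2) *
        ENNReal.ofReal (flowDensity r ν (Function.update x i (ρ * x i + √(1 - ρ ^ 2) * s))) :=
      (hfm.comp hupx.measurable).ennreal_ofReal.const_mul _
    rw [lintegral_add_right _ hm5, lintegral_const_mul' _ _ ENNReal.ofReal_ne_top,
      lintegral_const_mul' _ _ ENNReal.ofReal_ne_top, hmass]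
    exact ENNReal.add_ne_top.2 ⟨ENNReal.mul_ne_top ENNReal.ofReal_ne_top hx.ne,
      ENNReal.mul_ne_top ENNReal.ofReal_ne_top ENNReal.ofReal_ne_top⟩
  refine (lintegral_klFun_le_fisher (fun s => hpos _) hd
    (continuous_const.mul ((continuous_pderivAt hC i).comp hupx)) (flowDensity_pos hr' x) hmass
    hmom).trans ?_
  refine add_le_add le_rfl ?_
  rw [← lintegral_const_mul' _ _ ENNReal.ofReal_ne_top]
  refine lintegral_mono fun s => ?_
  rw [← ENNReal.ofReal_mul (by positivity), mul_pow, Real.sq_sqrt hs.le]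
  refine ENNReal.ofReal_le_ofReal (le_of_eq ?_)
  ring

omit [DecidableEq ι] in
lemma flowDensity_zero (x : ι → ℝ) : flowDensity (fun _ => 0) ν x = 1 := by
  simp [flowDensity, mehlerInt, mehler, mehlerLine_zero]

variable {lam : ℝ} {S : ι → (ι → ℝ) → ℝ}

/-- The entropy between two times of the isotropic Mehler flow. -/
lemma lintegral_klFun_flowDensity_const_le (hS : HasScore ν lam S) (hlam : 0 < lam) {a b : ℝ}
    (ha : 0 ≤ a) (hab : a < b) (hb : b < 1) :
    ∫⁻ x, ENNReal.ofReal (klFun (flowDensity (fun _ => b) ν x)) ∂(gaussPi ι) ≤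
      ∫⁻ x, ENNReal.ofReal (klFun (flowDensity (fun _ => a) ν x)) ∂(gaussPi ι) +
      ENNReal.ofReal (1 / 2 * ((b ^ 2 - a ^ 2) * (b ^ 2 / (b ^ 2 + lam * (1 - b ^ 2))) *
        ∑ i, ∫ x, S i x ^ 2 ∂ν)) := by
  have hb0 : 0 < b := ha.trans_lt hab
  have hb2 : b ^ 2 ∈ Ioo (0 : ℝ) 1 := ⟨by positivity, by nlinarith⟩
  have hκ : 0 < b ^ 2 + lam * (1 - b ^ 2) := add_pos hb2.1 (mul_pos hlam (sub_pos.2 hb2.2))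
  have hab2 : 0 ≤ b ^ 2 - a ^ 2 := by nlinarith
  have hI : ∀ i, 0 ≤ ∫ x, S i x ^ 2 ∂ν := fun i => integral_nonneg fun x => sq_nonneg _
  -- The parameters are lowered from b to a one coordinate at a time. The Fisher bound with v = b²
  -- stays valid at every stage, as it needs only rᵢ² ≤ v.
  have key : ∀ A : Finset ι,
      ∫⁻ x, ENNReal.ofReal (klFun (flowDensity (fun _ => b) ν x)) ∂(gaussPi ι) ≤
      ∫⁻ x, ENNReal.ofReal (klFun (flowDensity (fun j => if j ∈ A then a else b) ν x)) ∂(gaussPi ι) +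
      ENNReal.ofReal (1 / 2 * ((b ^ 2 - a ^ 2) * (b ^ 2 / (b ^ 2 + lam * (1 - b ^ 2))) *
        ∑ i ∈ A, ∫ x, S i x ^ 2 ∂ν)) := by
    intro A
    induction A using Finset.induction_on with
    | empty => simp
    | insert i A hi ih =>
      refine ih.trans ?_
      have hr : ∀ j, (if j ∈ A then a else b) ∈ Ico (0 : ℝ) 1 := fun j => by
        split_ifs
        exacts [⟨ha, hab.trans hb⟩, ⟨hb0.le, hb⟩]
      have hrv : ∀ j, (if j ∈ A then a else b) ^ 2 ≤ b ^ 2 := fun j => by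
        split_ifs
        exacts [pow_le_pow_left₀ ha hab.le 2, le_rfl]
      -- ρ = a/b takes rᵢ = b to a; then (1 − ρ²) b² = b² − a² is the increment of v.
      have hρ : a / b ∈ Ico (0 : ℝ) 1 := ⟨by positivity, (div_lt_one hb0).2 hab⟩
      have h1 := lintegral_klFun_flowDensity_le (ν := ν) hr hS.integrable_sq i hρ
      have h2 := lintegral_fisher_flowDensity_le hr hS hb2 hrv hlam i
      have hup : Function.update (fun j => if j ∈ A then a else b) i
          (a / b * (if i ∈ A then a else b)) = fun j => if j ∈ insert i A then a else b := by
        funext j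
        rcases eq_or_ne j i with rfl | h
        · rw [Function.update_self]
          simp [hi, hb0.ne']
        · rw [Function.update_of_ne h]
          simp [h]
      rw [hup] at h1
      rw [Finset.sum_insert hi, mul_add, mul_add, ENNReal.ofReal_add
        (mul_nonneg (by norm_num) (mul_nonneg (mul_nonneg hab2 (by positivity)) (hI i)))
        (mul_nonneg (by norm_num) (mul_nonneg (mul_nonneg hab2 (by positivity))
          (Finset.sum_nonneg fun i _ => hI i))), ← add_assoc]
      refine add_le_add (h1.trans (add_le_add le_rfl ?_)) le_rfl
      refine (mul_le_mul_right h2 _).trans ?_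
      have hρ2 := one_sub_sq_pos hρ
      rw [← ENNReal.ofReal_mul (by positivity)]
      refine ENNReal.ofReal_le_ofReal (le_of_eq ?_)
      simp only [hi, if_false]
      field_simp
  simpa using key Finset.univ

end flowEntropy

/-! ### Integration over the flow -/

section flowIntegral

lemma rate_denom_pos {lam : ℝ} (hlam : 0 < lam) {v : ℝ} (hv : v ∈ Icc (0 : ℝ) 1) :
    0 < v + lam * (1 - v) := by
  rcases eq_or_lt_of_le hv.2 with rfl | h
  · simp
  · exact add_pos_of_nonneg_of_pos hv.1 (mul_pos hlam (sub_pos.2 h))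

lemma monotoneOn_rate {lam : ℝ} (hlam : 0 < lam) :
    MonotoneOn (fun v => v / (v + lam * (1 - v))) (Icc 0 1) := fun a ha b hb hab => by
  show a / _ ≤ b / _
  rw [div_le_div_iff₀ (rate_denom_pos hlam ha) (rate_denom_pos hlam hb)]
  nlinarith [mul_le_mul_of_nonneg_left hab hlam.le]

/-- The constant `c(λ)` is the integral over `[0, 1]` of `v / (v + λ (1 - v))`. -/
lemma exists_primitive_rate {lam : ℝ} (hlam : 0 < lam) :
    ∃ F : ℝ → ℝ, (∀ v ∈ Icc (0 : ℝ) 1, HasDerivAt F (v / (v + lam * (1 - v))) v) ∧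
      F 1 - F 0 = cConst lam := by
  by_cases h1 : lam = 1
  · refine ⟨fun v => v ^ 2 / 2, fun v _ => ?_, by simp [cConst, h1]⟩
    refine ((hasDerivAt_pow 2 v).div_const 2).congr_deriv ?_
    rw [h1]
    norm_num
  · have h2 : 1 - lam ≠ 0 := sub_ne_zero.2 (Ne.symm h1)
    refine ⟨fun v => v / (1 - lam) - lam / (1 - lam) ^ 2 * Real.log (v + lam * (1 - v)),
      fun v hv => ?_, ?_⟩
    · have hD := (rate_denom_pos hlam hv).ne'
      have hd : HasDerivAt (fun v => v + lam * (1 - v)) (1 + lam * (-1)) v :=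
        (hasDerivAt_id v).fun_add (((hasDerivAt_id v).const_sub 1).const_mul lam)
      refine (((hasDerivAt_id v).div_const (1 - lam)).fun_sub
        ((hd.log hD).const_mul (lam / (1 - lam) ^ 2))).congr_deriv ?_
      field_simp
      ring
    · rw [cConst, if_neg h1]
      simp only [sub_self, mul_zero, add_zero, Real.log_one, sub_zero, zero_div, zero_add, mul_one]
      field_simp
      ring

/-- By the mean value theorem c(λ) is a value of v/(v + λ(1 − v)) at some 0 < v < 1, and all such
values lie strictly between 0 and 1. -/
lemma cConst_mem {lam : ℝ} (hlam : 0 < lam) : cConst lam ∈ Ioo (0 : ℝ) 1 := by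
  obtain ⟨F, hF, hc⟩ := exists_primitive_rate hlam
  obtain ⟨v, hv, he⟩ := exists_hasDerivAt_eq_slope F (fun v => v / (v + lam * (1 - v))) one_pos
    (fun x hx => (hF x hx).continuousAt.continuousWithinAt) fun x hx => hF x (Ioo_subset_Icc_self hx)
  have hD := rate_denom_pos hlam (Ioo_subset_Icc_self hv)
  rw [hc] at he
  have he2 : cConst lam = v / (v + lam * (1 - v)) := by simpa using he.symm
  rw [he2]
  exact ⟨div_pos hv.1 hD, (div_lt_one hD).2 (by nlinarith [hv.1, hv.2, mul_pos hlam (sub_pos.2 hv.2)])⟩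

variable {ι : Type} [Fintype ι] [DecidableEq ι] {ν : Measure (ι → ℝ)} [IsProbabilityMeasure ν]
  {lam : ℝ} {S : ι → (ι → ℝ) → ℝ}

/-- The entropy along the isotropic Mehler flow is controlled by the initial Fisher information. -/
theorem lintegral_klFun_flowDensity_sqrt_le (hS : HasScore ν lam S) (hlam : 0 < lam) {s : ℝ}
    (hs : s ∈ Ioo (0 : ℝ) 1) :
    ∫⁻ x, ENNReal.ofReal (klFun (flowDensity (fun _ => √s) ν x)) ∂(gaussPi ι) ≤
      ENNReal.ofReal (1 / 2 * (cConst lam * ∑ i, ∫ x, S i x ^ 2 ∂ν)) := by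
  obtain ⟨F, hF, hc⟩ := exists_primitive_rate hlam
  set I := ∑ i, ∫ x, S i x ^ 2 ∂ν with hI
  have hI0 : 0 ≤ I := Finset.sum_nonneg fun i _ => integral_nonneg fun x => sq_nonneg _
  set R : ℝ → ℝ := fun v => v / (v + lam * (1 - v)) with hR
  have hRm : MonotoneOn R (Icc 0 1) := monotoneOn_rate hlam
  have hR0 : R 0 = 0 := by simp [hR]
  have hRnn : ∀ v ∈ Icc (0 : ℝ) 1, 0 ≤ R v := fun v hv => by
    rw [← hR0]
    exact hRm ⟨le_rfl, zero_le_one⟩ hv hv.1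
  -- The rate R is increasing, so its left-endpoint sums lie below the increments of the primitive
  -- F.
  have hslope : ∀ a b, 0 ≤ a → a < b → b ≤ 1 → (b - a) * R a ≤ F b - F a := fun a b ha hab hb => by
    obtain ⟨v, hv, he⟩ := exists_hasDerivAt_eq_slope F R hab
      (fun x hx => (hF x ⟨ha.trans hx.1, hx.2.trans hb⟩).continuousAt.continuousWithinAt)
      fun x hx => hF x ⟨ha.trans hx.1.le, hx.2.le.trans hb⟩
    have h1 : R a ≤ R v := hRm ⟨ha, (hab.trans_le hb).le⟩ ⟨ha.trans hv.1.le, hv.2.le.trans hb⟩ hv.1.le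
    rw [he, le_div_iff₀ (sub_pos.2 hab)] at h1
    linarith
  have hFmono : ∀ a b, 0 ≤ a → a ≤ b → b ≤ 1 → F a ≤ F b := fun a b ha hab hb => by
    rcases eq_or_lt_of_le hab with rfl | h
    · exact le_rfl
    · have := hslope a b ha h hb
      have := mul_nonneg (sub_pos.2 h).le (hRnn a ⟨ha, hab.trans hb⟩)
      linarith
  -- The flow bounds give right-endpoint sums of mesh δ. Shifted by one index they telescope against
  -- F, leaving the single surplus term δR(kδ). The chain starts at v = 0, where the density is 1
  -- and the entropy is 0.
  have hchain : ∀ (δ : ℝ), 0 < δ → ∀ k : ℕ, k * δ < 1 →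
      ∫⁻ x, ENNReal.ofReal (klFun (flowDensity (fun _ => √(k * δ)) ν x)) ∂(gaussPi ι) ≤
      ENNReal.ofReal (1 / 2 * ((F (k * δ) - F 0 + δ * R (k * δ)) * I)) := by
    intro δ hδ k
    induction k with
    | zero =>
      intro _
      simp [flowDensity_zero, klFun_one]
    | succ k ih =>
      intro hk
      have hk0 : 0 ≤ k * δ := by positivity
      have hkk : ((k + 1 : ℕ) : ℝ) * δ = k * δ + δ := by push_cast; ring
      have hlt : k * δ < ((k + 1 : ℕ) : ℝ) * δ := by rw [hkk]; linarith
      have hk1 : 0 ≤ ((k + 1 : ℕ) : ℝ) * δ := hk0.trans hlt.le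
      have h1 := lintegral_klFun_flowDensity_const_le (ν := ν) hS hlam (Real.sqrt_nonneg (k * δ))
        (Real.sqrt_lt_sqrt hk0 hlt) ((Real.sqrt_lt' one_pos).2 (by simpa using hk))
      rw [Real.sq_sqrt hk0, Real.sq_sqrt hk1] at h1
      have hRk := hRnn _ ⟨hk1, hk.le⟩
      have hFk := hFmono 0 (k * δ) le_rfl hk0 (hlt.trans hk).le
      have hRk0 := hRnn _ ⟨hk0, (hlt.trans hk).le⟩
      refine (h1.trans (add_le_add (ih (hlt.trans hk)) le_rfl)).trans ?_
      rw [← ENNReal.ofReal_add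
        (mul_nonneg (by norm_num) (mul_nonneg (add_nonneg (sub_nonneg.2 hFk)
          (mul_nonneg hδ.le hRk0)) hI0))
        (mul_nonneg (by norm_num) (mul_nonneg (mul_nonneg (sub_pos.2 hlt).le hRk) hI0))]
      refine ENNReal.ofReal_le_ofReal ?_
      rw [← mul_add, ← add_mul]
      refine mul_le_mul_of_nonneg_left (mul_le_mul_of_nonneg_right ?_ hI0) (by norm_num)
      have h2 := hslope _ _ hk0 hlt hk.le
      have h3 : ((k + 1 : ℕ) : ℝ) * δ - k * δ = δ := by rw [hkk]; ring
      rw [h3] at h2 ⊢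
      show _ + δ * R _ ≤ _
      linarith
  have hm : ∀ m : ℕ, ∫⁻ x, ENNReal.ofReal (klFun (flowDensity (fun _ => √s) ν x)) ∂(gaussPi ι) ≤
      ENNReal.ofReal (1 / 2 * ((cConst lam + 1 / ((m : ℝ) + 1)) * I)) := fun m => by
    have hm0 : (0 : ℝ) < m + 1 := by positivity
    have h1 := hchain (s / (m + 1)) (by have := hs.1; positivity) (m + 1)
    have h2 : ((m + 1 : ℕ) : ℝ) * (s / (m + 1)) = s := by push_cast; field_simp
    rw [h2] at h1
    refine (h1 hs.2).trans (ENNReal.ofReal_le_ofReal ?_)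
    refine mul_le_mul_of_nonneg_left (mul_le_mul_of_nonneg_right ?_ hI0) (by norm_num)
    have h3 := hFmono s 1 hs.1.le hs.2.le le_rfl
    have h4 : R s ≤ 1 := by
      have h5 : R 1 = 1 := by simp [hR]
      rw [← h5]
      exact hRm ⟨hs.1.le, hs.2.le⟩ ⟨zero_le_one, le_rfl⟩ hs.2.le
    have h6 : s / (m + 1) * R s ≤ 1 / ((m : ℝ) + 1) := by
      rw [div_mul_eq_mul_div]
      refine div_le_div_of_nonneg_right ?_ hm0.le
      nlinarith [hs.1, hs.2, hRnn s ⟨hs.1.le, hs.2.le⟩]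
    linarith
  refine ge_of_tendsto' (x := atTop) (f := fun m : ℕ =>
    ENNReal.ofReal (1 / 2 * ((cConst lam + 1 / ((m : ℝ) + 1)) * I))) ?_ hm
  refine (ENNReal.continuous_ofReal.tendsto _).comp ?_
  have := ((tendsto_one_div_add_atTop_nhds_zero_nat (𝕜 := ℝ)).const_add (cConst lam)).mul_const I
  rw [add_zero] at this
  exact this.const_mul (1 / 2)

end flowIntegral

/-! ### Lower semicontinuity of the entropy at time zero -/

section semicontinuity

/-- Young's inequality for the convex conjugates a ↦ a log a − a + 1 and t ↦ eᵗ − 1, the source of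
the Gibbs variational principle. -/
lemma mul_le_klFun_add_exp {a : ℝ} (ha : 0 < a) (t : ℝ) : a * t ≤ klFun a + (Real.exp t - 1) := by
  have h1 := Real.add_one_le_exp (t - Real.log a)
  rw [Real.exp_sub, Real.exp_log ha, le_div_iff₀ ha] at h1
  simp only [klFun]
  nlinarith

variable {ι : Type} [Fintype ι] {ν : Measure (ι → ℝ)} [IsProbabilityMeasure ν]

lemma tendsto_mehlerInt_gaussPi {ψ : (ι → ℝ) → ℝ} (hψ : Continuous ψ) {B : ℝ}
    (hB : ∀ x, |ψ x| ≤ B) {s : ℕ → ℝ} (hs : ∀ k, s k ∈ Ico (0 : ℝ) 1)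
    (hs1 : Tendsto s atTop (𝓝 1)) (y : ι → ℝ) :
    Tendsto (fun k => mehlerInt (fun _ => s k) (gaussPi ι) ψ y) atTop (𝓝 (ψ y)) := by
  have h1 : ∀ k, mehlerInt (fun _ => s k) (gaussPi ι) ψ y =
      ∫ z, ψ (ouPoint (fun _ => s k) y z) ∂(gaussPi ι) := fun k =>
    mehlerInt_gaussPi (fun _ => hs k) hψ.measurable y
  simp_rw [h1]
  have h2 : ψ y = ∫ _, ψ y ∂(gaussPi ι) := by simp
  rw [h2]
  refine tendsto_integral_of_dominated_convergence (fun _ => B)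
    (fun k => (hψ.measurable.comp (measurable_ouPoint _ y)).aestronglyMeasurable)
    (integrable_const B) (fun k => ae_of_all _ fun z => hB _) (ae_of_all _ fun z => ?_)
  refine (hψ.tendsto y).comp (tendsto_pi_nhds.2 fun i => ?_)
  have h3 : Tendsto (fun t : ℝ => t * y i + √(1 - t ^ 2) * z i) (𝓝 1)
      (𝓝 (1 * y i + √(1 - 1 ^ 2) * z i)) :=
    Continuous.tendsto (by fun_prop) 1
  have h4 : (1 : ℝ) * y i + √(1 - 1 ^ 2) * z i = y i := by simp
  rw [h4] at h3
  exact h3.comp hs1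

/-- The entropy is the supremum of ∫ fψ − ∫(e^ψ − 1) over bounded continuous ψ. For fixed ψ the
first integral is continuous along the flow, so the bound K passes to time zero; the choice ψ = log
f, truncated, then recovers the entropy. -/
theorem lintegral_klFun_le_of_flowDensity {f : (ι → ℝ) → ℝ} (hf : Continuous f) (f0 : ∀ x, 0 ≤ f x)
    (hν : ν = (gaussPi ι).withDensity fun x => ENNReal.ofReal (f x)) {K : ℝ} (hK0 : 0 ≤ K)
    (hK : ∀ s ∈ Ioo (0 : ℝ) 1,
      ∫⁻ x, ENNReal.ofReal (klFun (flowDensity (fun _ => √s) ν x)) ∂(gaussPi ι) ≤ ENNReal.ofReal K) :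
    ∫⁻ x, ENNReal.ofReal (klFun (f x)) ∂(gaussPi ι) ≤ ENNReal.ofReal K := by
  have hνint : ∀ g : (ι → ℝ) → ℝ, ∫ x, g x ∂ν = ∫ x, f x * g x ∂(gaussPi ι) := fun g => by
    rw [hν, integral_withDensity_eq_integral_toReal_smul₀ hf.measurable.ennreal_ofReal.aemeasurable
      (ae_of_all _ fun _ => ENNReal.ofReal_lt_top)]
    simp [ENNReal.toReal_ofReal (f0 _)]
  have hfint : Integrable f (gaussPi ι) := by
    refine integrable_of_lintegral_ofReal hf.aestronglyMeasurable f0 ?_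
    have : ν univ = 1 := measure_univ
    rw [hν, withDensity_apply _ MeasurableSet.univ, setLIntegral_univ] at this
    rw [this]
    exact ENNReal.one_ne_top
  -- the Gibbs variational inequality along the flow, in the limit
  have hgibbs : ∀ (ψ : (ι → ℝ) → ℝ) (B : ℝ), Continuous ψ → (∀ x, |ψ x| ≤ B) →
      ∫ x, f x * ψ x ∂(gaussPi ι) ≤ K + ∫ x, (Real.exp (ψ x) - 1) ∂(gaussPi ι) := by
    intro ψ B hψ hB
    have hexpi : Integrable (fun x => Real.exp (ψ x) - 1) (gaussPi ι) := by
      refine Integrable.sub ?_ (integrable_const _)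
      refine (integrable_const (Real.exp B)).mono' (Real.continuous_exp.comp hψ).aestronglyMeasurable
        (ae_of_all _ fun x => ?_)
      rw [Real.norm_of_nonneg (Real.exp_pos _).le]
      exact Real.exp_le_exp.2 ((le_abs_self _).trans (hB x))
    let s : ℕ → ℝ := fun k => 1 - 1 / ((k : ℝ) + 2)
    have hs : ∀ k, s k ∈ Ioo (0 : ℝ) 1 := fun k => by
      have h2 : (0 : ℝ) < k + 2 := by positivity
      have h3 : 1 / ((k : ℝ) + 2) < 1 := by
        rw [div_lt_one h2]
        have : (0 : ℝ) ≤ k := Nat.cast_nonneg k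
        linarith
      have h4 : 0 < 1 / ((k : ℝ) + 2) := by positivity
      exact ⟨by simp only [s]; linarith, by simp only [s]; linarith⟩
    have hs' : ∀ k, √(s k) ∈ Ico (0 : ℝ) 1 := fun k =>
      ⟨Real.sqrt_nonneg _, (Real.sqrt_lt' one_pos).2 (by simpa using (hs k).2)⟩
    have hs1 : Tendsto (fun k => √(s k)) atTop (𝓝 1) := by
      have h1 : Tendsto s atTop (𝓝 (1 - 0)) := by
        refine tendsto_const_nhds.sub ?_
        have := tendsto_one_div_add_atTop_nhds_zero_nat (𝕜 := ℝ)
        have := (tendsto_add_atTop_iff_nat 1).2 this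
        refine this.congr fun k => ?_
        push_cast
        ring
      have := (Real.continuous_sqrt.tendsto _).comp h1
      simpa [Function.comp_def] using this
    have hlim : Tendsto (fun k => ∫ y, mehlerInt (fun _ => √(s k)) (gaussPi ι) ψ y ∂ν) atTop
        (𝓝 (∫ y, ψ y ∂ν)) := by
      refine tendsto_integral_of_dominated_convergence (fun _ => B) (fun k => ?_)
        (integrable_const B) (fun k => ae_of_all _ fun y =>
          abs_mehlerInt_gaussPi_le (fun _ => hs' k) hψ.measurable hB y)
        (ae_of_all _ fun y => tendsto_mehlerInt_gaussPi hψ hB hs' hs1 y)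
      exact (contDiff_mehlerInt (fun _ => hs' k) hψ.measurable hB).continuous.aestronglyMeasurable
    rw [← hνint]
    refine le_of_tendsto' hlim fun k => ?_
    have hpos := flowDensity_pos (ν := ν) (fun _ : ι => hs' k)
    have hc := (contDiff_flowDensity (ν := ν) (fun _ : ι => hs' k)).continuous
    have hkl := integrable_of_lintegral_ofReal
      (measurable_klFun.comp hc.measurable).aestronglyMeasurable (fun x => klFun_nonneg (hpos x).le)
      (ne_top_of_le_ne_top ENNReal.ofReal_ne_top (hK (s k) (hs k)))
    have hkK : ∫ x, klFun (flowDensity (fun _ => √(s k)) ν x) ∂(gaussPi ι) ≤ K := by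
      rw [integral_eq_lintegral_of_nonneg_ae (ae_of_all _ fun x => klFun_nonneg (hpos x).le) hkl.1]
      exact ENNReal.toReal_le_of_le_ofReal hK0 (hK (s k) (hs k))
    have hm := integral_mul_flowDensity (ν := ν) (fun _ : ι => hs' k) hψ.measurable hB
    rw [← hm.2]
    refine (integral_mono hm.1 (hkl.add hexpi) fun x => ?_).trans
      ((integral_add hkl hexpi).le.trans (add_le_add hkK le_rfl))
    rw [mul_comm]
    exact mul_le_klFun_add_exp (hpos x) _
  -- truncation of `log f`
  let c : ℕ → (ι → ℝ) → ℝ := fun k x => max (1 / ((k : ℝ) + 1)) (min ((k : ℝ) + 1) (f x))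
  have hk1 : ∀ k : ℕ, (1 : ℝ) ≤ k + 1 := fun k => by
    have : (0 : ℝ) ≤ k := Nat.cast_nonneg k
    linarith
  have hk2 : ∀ k : ℕ, 1 / ((k : ℝ) + 1) ≤ 1 := fun k =>
    (div_le_one (one_pos.trans_le (hk1 k))).2 (hk1 k)
  have hk3 : ∀ k : ℕ, 0 < 1 / ((k : ℝ) + 1) := fun k => by positivity
  have hcpos : ∀ k x, 0 < c k x := fun k x => (hk3 k).trans_le (le_max_left _ _)
  have hcle : ∀ k x, c k x ≤ k + 1 := fun k x =>
    max_le ((hk2 k).trans (hk1 k)) (min_le_left _ _)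
  have hcc : ∀ k, Continuous (c k) := fun k => by fun_prop
  have hψc : ∀ k, Continuous fun x => Real.log (c k x) := fun k =>
    (hcc k).log fun x => (hcpos k x).ne'
  have hψb : ∀ k x, |Real.log (c k x)| ≤ Real.log (k + 1) := fun k x => by
    refine abs_le.2 ⟨?_, Real.log_le_log (hcpos k x) (hcle k x)⟩
    rw [← Real.log_inv, ← one_div]
    exact Real.log_le_log (hk3 k) (le_max_left _ _)
  -- With ψ = log c_k the Gibbs integrand is f log c_k − (c_k − 1), which tends pointwise to `klFun
  -- f`, also where f = 0.
  refine lintegral_ofReal_le_of_tendsto (F := fun k x => f x * Real.log (c k x) - (c k x - 1))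
    (fun k => ((hf.mul (hψc k)).sub ((hcc k).sub continuous_const)).measurable) (fun x => ?_)
    (Eventually.of_forall fun k => ?_)
  · rcases eq_or_lt_of_le (f0 x) with h0 | hpos
    · have h1 : ∀ k, c k x = 1 / ((k : ℝ) + 1) := fun k => by
        simp only [c, ← h0]
        rw [min_eq_right (zero_le_one.trans (hk1 k)), max_eq_left (hk3 k).le]
      simp only [h1, ← h0, zero_mul, klFun_zero]
      have := (tendsto_one_div_add_atTop_nhds_zero_nat (𝕜 := ℝ))
      have := (this.sub_const 1).const_sub 0
      simpa using this
    · refine tendsto_const_nhds.congr' ?_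
      obtain ⟨K1, hK1⟩ := exists_nat_ge (f x)
      obtain ⟨K2, hK2⟩ := exists_nat_ge (1 / f x)
      filter_upwards [eventually_ge_atTop K1, eventually_ge_atTop K2] with k h1 h2
      have h3 : f x ≤ (k : ℝ) + 1 := hK1.trans ((Nat.cast_le.2 h1).trans (by linarith))
      have h4 : 1 / ((k : ℝ) + 1) ≤ f x := by
        rw [div_le_iff₀ (one_pos.trans_le (hk1 k))]
        have h5 : 1 / f x ≤ (k : ℝ) + 1 := hK2.trans ((Nat.cast_le.2 h2).trans (by linarith))
        rw [div_le_iff₀ hpos] at h5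
        linarith
      simp only [c, min_eq_right h3, max_eq_right h4, klFun]
      ring
  · have hn : ∀ x, 0 ≤ f x * Real.log (c k x) - (c k x - 1) := fun x => by
      have hlog : Real.log (c k x) ≤ c k x - 1 := Real.log_le_sub_one_of_pos (hcpos k x)
      have hlog2 := Real.one_sub_inv_le_log_of_pos (hcpos k x)
      have hc1 := hcpos k x
      have hmul : c k x - 1 ≤ c k x * Real.log (c k x) := by
        have := mul_le_mul_of_nonneg_left hlog2 hc1.le
        rw [mul_sub, mul_inv_cancel₀ hc1.ne', mul_one] at this
        exact this
      rcases lt_or_ge (f x) (1 / ((k : ℝ) + 1)) with h1 | h1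
      · have h2 : c k x = 1 / ((k : ℝ) + 1) := by
          simp only [c]
          exact max_eq_left ((min_le_right _ _).trans h1.le)
        have h3 : Real.log (c k x) ≤ 0 := hlog.trans (by rw [h2]; linarith [hk2 k])
        have h4 : f x ≤ c k x := by rw [h2]; exact h1.le
        nlinarith
      · rcases lt_or_ge ((k : ℝ) + 1) (f x) with h5 | h5
        · have h2 : c k x = (k : ℝ) + 1 := by
            simp only [c]
            rw [min_eq_left h5.le]
            exact max_eq_right ((hk2 k).trans (hk1 k))
          have h3 : 0 ≤ Real.log (c k x) := Real.log_nonneg (by rw [h2]; exact hk1 k)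
          have h4 : c k x ≤ f x := by rw [h2]; exact h5.le
          nlinarith
        · have h2 : c k x = f x := by
            simp only [c]
            rw [min_eq_right h5, max_eq_right h1]
          rw [← h2]
          linarith
    have hg := hgibbs (fun x => Real.log (c k x)) _ (hψc k) (hψb k)
    simp only [Real.exp_log (hcpos k _)] at hg
    have i1 : Integrable (fun x => f x * Real.log (c k x)) (gaussPi ι) :=
      hfint.mul_bdd (hψc k).aestronglyMeasurable (ae_of_all _ (hψb k))
    have i2 : Integrable (fun x => c k x - 1) (gaussPi ι) := by
      refine Integrable.sub ?_ (integrable_const _)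
      refine (integrable_const ((k : ℝ) + 1)).mono' (hcc k).aestronglyMeasurable
        (ae_of_all _ fun x => ?_)
      rw [Real.norm_of_nonneg (hcpos k x).le]
      exact hcle k x
    have i3 : Integrable (fun x => f x * Real.log (c k x) - (c k x - 1)) (gaussPi ι) := i1.sub i2
    rw [← ofReal_integral_eq_lintegral_ofReal i3 (ae_of_all _ hn)]
    refine ENNReal.ofReal_le_ofReal ?_
    refine (integral_sub i1 i2).le.trans ?_
    linarith

end semicontinuity

/-! ### Integration by parts for the Gaussian measure -/

section partialDerivatives

variable {ι : Type} [Fintype ι] [DecidableEq ι] {u w : (ι → ℝ) → ℝ} {x : ι → ℝ}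

lemma pderivAt_fun_mul (hu : DifferentiableAt ℝ u x) (hw : DifferentiableAt ℝ w x) (i : ι) :
    pderivAt i (fun x => u x * w x) x = u x * pderivAt i w x + w x * pderivAt i u x := by
  simp [pderivAt, fderiv_fun_mul hu hw]

lemma pderivAt_fun_add (hu : DifferentiableAt ℝ u x) (hw : DifferentiableAt ℝ w x) (i : ι) :
    pderivAt i (fun x => u x + w x) x = pderivAt i u x + pderivAt i w x := by
  simp [pderivAt, fderiv_fun_add hu hw]

lemma pderivAt_fun_sub (hu : DifferentiableAt ℝ u x) (hw : DifferentiableAt ℝ w x) (i : ι) :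
    pderivAt i (fun x => u x - w x) x = pderivAt i u x - pderivAt i w x := by
  simp [pderivAt, fderiv_fun_sub hu hw]

omit [Fintype ι] in
lemma pderivAt_eval (i : ι) : pderivAt i (fun x : ι → ℝ => x i) x = 1 := by
  rw [pderivAt, (hasFDerivAt_apply (𝕜 := ℝ) i x).fderiv]
  simp

lemma contDiff_pderivAt (hu : ContDiff ℝ ∞ u) (i : ι) : ContDiff ℝ ∞ (pderivAt i u) :=
  (hu.fderiv_right (m := ∞) (by simp)).clm_apply contDiff_const

lemma pderivAt_comp_smul (hu : Differentiable ℝ u) (c : ℝ) (i : ι) (x : ι → ℝ) :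
    pderivAt i (fun x => u (c • x)) x = c * pderivAt i u (c • x) := by
  have h1 : HasFDerivAt (fun x : ι → ℝ => c • x) (c • ContinuousLinearMap.id ℝ (ι → ℝ)) x :=
    (hasFDerivAt_id x).const_smul c
  have h2 := ((hu (c • x)).hasFDerivAt.comp x h1).fderiv
  rw [pderivAt]
  change fderiv ℝ (u ∘ fun x => c • x) x (Pi.single i 1) = _
  rw [h2]
  simp [pderivAt]

lemma hasDerivAt_comp_update (hu : DifferentiableAt ℝ u (Function.update x i t)) :
    HasDerivAt (fun s => u (Function.update x i s)) (pderivAt i u (Function.update x i t)) t :=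
  hu.hasFDerivAt.comp_hasDerivAt t (hasDerivAt_update x i t)

omit [Fintype ι] in
lemma hasCompactSupport_pderivAt (hu : HasCompactSupport u) (i : ι) :
    HasCompactSupport (pderivAt i u) :=
  hu.fderiv_apply (𝕜 := ℝ) (Pi.single i 1)

end partialDerivatives

section integrationByParts

lemma integral_deriv_gaussLine {w w' : ℝ → ℝ} (hd : ∀ t, HasDerivAt w (w' t) t)
    (hw : Integrable w gaussLine) (hw' : Integrable w' gaussLine)
    (htw : Integrable (fun t => t * w t) gaussLine) :
    ∫ t, w' t ∂gaussLine = ∫ t, t * w t ∂gaussLine := by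
  rw [integrable_gaussLine_iff] at hw hw' htw
  rw [integral_gaussLine, integral_gaussLine, ← sub_eq_zero, ← integral_sub hw' htw]
  refine integral_eq_zero_of_hasDerivAt_of_integrable (f := fun t => gaussPDF t * w t)
    (fun t => ?_) (hw'.sub htw) hw
  refine ((hasDerivAt_gaussPDF t).fun_mul (hd t)).congr_deriv ?_
  ring

variable {ι : Type} [Fintype ι] [DecidableEq ι]

/-- Refreshing one coordinate by an independent Gaussian is the Ornstein–Uhlenbeck step with ρ = 0;
this reduces integration by parts to the line. -/
lemma measurePreserving_update_gaussPi (i : ι) :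
    MeasurePreserving (fun p : (ι → ℝ) × ℝ => Function.update p.1 i p.2)
      ((gaussPi ι).prod gaussLine) (gaussPi ι) := by
  have hm : Measurable fun p : (ι → ℝ) × ℝ => Function.update p.1 i p.2 :=
    (continuous_fst.update i continuous_snd).measurable
  refine ⟨hm, Measure.ext_of_lintegral _ fun g hg => ?_⟩
  have hgm : Measurable fun p : (ι → ℝ) × ℝ => g (Function.update p.1 i p.2) := hg.comp hm
  rw [lintegral_map hg hm, lintegral_prod _ hgm.aemeasurable]
  have := lintegral_gaussPi_update hg i (ρ := 0) ⟨le_rfl, one_pos⟩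
  simpa using this

/-- Gaussian integration by parts. -/
theorem integral_pderivAt_gaussPi {w : (ι → ℝ) → ℝ} (hd : Differentiable ℝ w) (i : ι)
    (hw : Integrable w (gaussPi ι)) (hw' : Integrable (pderivAt i w) (gaussPi ι))
    (hxw : Integrable (fun x => x i * w x) (gaussPi ι)) :
    ∫ x, pderivAt i w x ∂(gaussPi ι) = ∫ x, x i * w x ∂(gaussPi ι) := by
  have hmp := measurePreserving_update_gaussPi i
  have hpush : ∀ g : (ι → ℝ) → ℝ, Integrable g (gaussPi ι) →
      Integrable (fun p : (ι → ℝ) × ℝ => g (Function.update p.1 i p.2))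
        ((gaussPi ι).prod gaussLine) ∧
      ∫ x, g x ∂(gaussPi ι) = ∫ x, ∫ t, g (Function.update x i t) ∂gaussLine ∂(gaussPi ι) := by
    intro g hg
    have h1 : Integrable (fun p : (ι → ℝ) × ℝ => g (Function.update p.1 i p.2))
        ((gaussPi ι).prod gaussLine) := hmp.integrable_comp_of_integrable hg
    refine ⟨h1, ?_⟩
    rw [← integral_prod _ h1, ← integral_map hmp.measurable.aemeasurable, hmp.map_eq]
    rw [hmp.map_eq]
    exact hg.1
  obtain ⟨i1, -⟩ := hpush w hw
  obtain ⟨i2, e2⟩ := hpush _ hw'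
  obtain ⟨i3, e3⟩ := hpush _ hxw
  rw [e2, e3]
  refine integral_congr_ae ?_
  filter_upwards [i1.prod_right_ae, i2.prod_right_ae, i3.prod_right_ae] with x h1 h2 h3
  simp only [Function.update_self] at h3 ⊢
  exact integral_deriv_gaussLine (fun t => hasDerivAt_comp_update (hd _)) h1 h2 h3

end integrationByParts

/-! ### The Fisher information of a density whose Laplacian dominates -/

section laplacian

variable {ι : Type} [Fintype ι] [DecidableEq ι]

/-- The factor on the right is (xᵢ − ∂ᵢ)²χ, with xᵢ − ∂ᵢ the Gaussian adjoint of ∂ᵢ. Only the cutoff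
has compact support, so no growth condition on f is needed. -/
lemma integral_mul_pderivAt_pderivAt {f χ : (ι → ℝ) → ℝ} (hf : ContDiff ℝ ∞ f)
    (hχ : ContDiff ℝ ∞ χ) (hχs : HasCompactSupport χ) (i : ι) :
    ∫ x, χ x * pderivAt i (pderivAt i f) x ∂(gaussPi ι) =
      ∫ x, (pderivAt i (pderivAt i χ) x - χ x - 2 * (x i * pderivAt i χ x) + x i ^ 2 * χ x) * f x
        ∂(gaussPi ι) := by
  have hf1 := contDiff_pderivAt hf i
  have hf2 := contDiff_pderivAt hf1 i
  have hχ1 := contDiff_pderivAt hχ i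
  have hχ2 := contDiff_pderivAt hχ1 i
  have hχs1 := hasCompactSupport_pderivAt hχs i
  have hχs2 := hasCompactSupport_pderivAt hχs1 i
  have hev : ContDiff ℝ ∞ fun x : ι → ℝ => x i := contDiff_apply ℝ ℝ i
  have dd : ∀ {u : (ι → ℝ) → ℝ}, ContDiff ℝ ∞ u → Differentiable ℝ u := fun hu =>
    hu.differentiable (by simp)
  have d1 : ContDiff ℝ ∞ fun x => χ x * pderivAt i f x := hχ.mul hf1
  have d2 : ContDiff ℝ ∞ fun x => pderivAt i χ x * f x := hχ1.mul hf
  have d3 : ContDiff ℝ ∞ fun x => χ x * (x i * f x) := hχ.mul (hev.mul hf)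
  have d4 : ContDiff ℝ ∞ fun x => χ x * pderivAt i f x - pderivAt i χ x * f x := d1.sub d2
  -- Both integrations by parts are done at once: the Gaussian divergence ∂ᵢw − xᵢw of w = χ∂ᵢf −
  -- f∂ᵢχ + xᵢχf is the difference of the two integrands.
  have d5 : ContDiff ℝ ∞ fun x =>
    χ x * pderivAt i f x - pderivAt i χ x * f x + χ x * (x i * f x) := d4.add d3
  have hsupp : HasCompactSupport fun x =>
      χ x * pderivAt i f x - pderivAt i χ x * f x + χ x * (x i * f x) :=
    ((hχs.mul_right).sub (hχs1.mul_right)).add (hχs.mul_right)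
  have hder : ∀ x, pderivAt i (fun x =>
      χ x * pderivAt i f x - pderivAt i χ x * f x + χ x * (x i * f x)) x =
      χ x * pderivAt i (pderivAt i f) x - pderivAt i (pderivAt i χ) x * f x + χ x * f x +
        x i * pderivAt i χ x * f x + x i * χ x * pderivAt i f x := fun x => by
    rw [pderivAt_fun_add (dd d4 x) (dd d3 x), pderivAt_fun_sub (dd d1 x) (dd d2 x),
      pderivAt_fun_mul (dd hχ x) (dd hf1 x), pderivAt_fun_mul (dd hχ1 x) (dd hf x),
      pderivAt_fun_mul (dd hχ x) (dd (hev.mul hf) x), pderivAt_fun_mul (dd hev x) (dd hf x),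
      pderivAt_eval]
    ring
  have i3 : Integrable (fun x => x i * (χ x * pderivAt i f x - pderivAt i χ x * f x +
      χ x * (x i * f x))) (gaussPi ι) :=
    (hev.continuous.mul d5.continuous).integrable_of_hasCompactSupport (hsupp.mul_left)
  have i4 := (contDiff_pderivAt d5 i).continuous.integrable_of_hasCompactSupport (μ := gaussPi ι)
    (hasCompactSupport_pderivAt hsupp i)
  have hibp := integral_pderivAt_gaussPi (dd d5) i
    (d5.continuous.integrable_of_hasCompactSupport hsupp) i4 i3
  have i1 : Integrable (fun x => χ x * pderivAt i (pderivAt i f) x) (gaussPi ι) :=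
    (hχ.continuous.mul hf2.continuous).integrable_of_hasCompactSupport hχs.mul_right
  have cE : Continuous fun x : ι → ℝ => (pderivAt i (pderivAt i χ) x - χ x -
      2 * (x i * pderivAt i χ x) + x i ^ 2 * χ x) * f x :=
    ((((hχ2.continuous.sub hχ.continuous).sub (continuous_const.mul
      (hev.continuous.mul hχ1.continuous))).add ((hev.continuous.pow 2).mul hχ.continuous))).mul
      hf.continuous
  have sE : HasCompactSupport fun x : ι → ℝ => (pderivAt i (pderivAt i χ) x - χ x -
      2 * (x i * pderivAt i χ x) + x i ^ 2 * χ x) * f x :=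
    HasCompactSupport.mul_right (((hχs2.sub hχs).sub ((hχs1.mul_left).mul_left)).add hχs.mul_left)
  have i2 := cE.integrable_of_hasCompactSupport (μ := gaussPi ι) sE
  rw [← sub_eq_zero] at hibp ⊢
  rw [← integral_sub i1 i2]
  rw [← integral_sub i4 i3] at hibp
  rw [← hibp]
  refine integral_congr_ae (ae_of_all _ fun x => ?_)
  simp only [hder]
  ring

lemma lintegral_ofReal_le_of_tendsto_bound {α : Type*} [MeasurableSpace α] {P : Measure α}
    {F : ℕ → α → ℝ} {f : α → ℝ} {a : ℕ → ℝ} {b : ℝ} (hF : ∀ k, Measurable (F k))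
    (hlim : ∀ x, Tendsto (fun k => F k x) atTop (𝓝 (f x)))
    (ha : ∀ k, ∫⁻ x, ENNReal.ofReal (F k x) ∂P ≤ ENNReal.ofReal (a k))
    (hab : Tendsto a atTop (𝓝 b)) :
    ∫⁻ x, ENNReal.ofReal (f x) ∂P ≤ ENNReal.ofReal b := by
  refine le_of_forall_gt_imp_ge_of_dense fun C hC => ?_
  refine lintegral_ofReal_le_of_tendsto hF hlim ?_
  have h1 := (ENNReal.continuous_ofReal.tendsto b).comp hab
  filter_upwards [h1.eventually (gt_mem_nhds hC)] with k hk
  exact (ha k).trans hk.le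

/-- Integrating a nonnegative Laplacian against the Gaussian measure. -/
theorem nonneg_and_lintegral_laplacian_le {f : (ι → ℝ) → ℝ} (hf : ContDiff ℝ ∞ f)
    (hL : ∀ x, 0 ≤ ∑ i, pderivAt i (pderivAt i f) x) (hfi : Integrable f (gaussPi ι))
    (hxf : ∀ i, Integrable (fun x => x i ^ 2 * f x) (gaussPi ι)) :
    0 ≤ ∑ i, ∫ x, (x i ^ 2 - 1) * f x ∂(gaussPi ι) ∧
    ∫⁻ x, ENNReal.ofReal (∑ i, pderivAt i (pderivAt i f) x) ∂(gaussPi ι) ≤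
      ENNReal.ofReal (∑ i, ∫ x, (x i ^ 2 - 1) * f x ∂(gaussPi ι)) := by
  -- Cutoffs b(x/(k + 1)) exhaust the space. Nonnegativity of the Laplacian allows Fatou in the
  -- limit, which gives integrability of Δf rather than assuming it.
  let b : ContDiffBump (0 : ι → ℝ) := ⟨1, 2, one_pos, by norm_num⟩
  have hb : ContDiff ℝ ∞ b := b.contDiff
  have hbs : HasCompactSupport b := b.hasCompactSupport
  have hb0 : b 0 = 1 := b.one_of_mem_closedBall (by simp [b])
  let c : ℕ → ℝ := fun k => 1 / ((k : ℝ) + 1)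
  have hc : ∀ k, c k ≠ 0 := fun k => by positivity
  have hc1 : ∀ k, |c k| ≤ 1 := fun k => by
    have : (0 : ℝ) ≤ k := Nat.cast_nonneg k
    rw [abs_of_nonneg (by positivity), div_le_one (by positivity)]
    linarith
  have hc0 : Tendsto c atTop (𝓝 0) := tendsto_one_div_add_atTop_nhds_zero_nat
  let χ : ℕ → (ι → ℝ) → ℝ := fun k x => b (c k • x)
  have hχ : ∀ k, ContDiff ℝ ∞ (χ k) := fun k => hb.comp (contDiff_const_smul _)
  have hχs : ∀ k, HasCompactSupport (χ k) := fun k => hbs.comp_smul (hc k)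
  have hχ1 : ∀ k i x, pderivAt i (χ k) x = c k * pderivAt i b (c k • x) := fun k i x =>
    pderivAt_comp_smul (hb.differentiable (by simp)) _ _ _
  have hχ2 : ∀ k i x, pderivAt i (pderivAt i (χ k)) x =
      c k ^ 2 * pderivAt i (pderivAt i b) (c k • x) := fun k i x => by
    have h1 : pderivAt i (χ k) = fun x => c k * pderivAt i b (c k • x) := funext (hχ1 k i)
    have h2 := pderivAt_comp_smul ((contDiff_pderivAt hb i).differentiable (by simp)) (c k) i x
    have h3 : ContDiff ℝ ∞ fun x => pderivAt i b (c k • x) :=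
      (contDiff_pderivAt hb i).comp (contDiff_const_smul (c k))
    rw [h1, pderivAt_fun_mul (differentiableAt_const _) (h3.differentiable (by simp) x), h2]
    simp [pderivAt]
    ring
  have hscale : ∀ x : ι → ℝ, Tendsto (fun k => c k • x) atTop (𝓝 0) := fun x => by
    simpa using hc0.smul_const x
  have hbc : ∀ {u : (ι → ℝ) → ℝ}, Continuous u → ∀ x : ι → ℝ,
      Tendsto (fun k => u (c k • x)) atTop (𝓝 (u 0)) := fun hu x => (hu.tendsto 0).comp (hscale x)
  have hi : ∀ k i, Integrable (fun x => χ k x * pderivAt i (pderivAt i f) x) (gaussPi ι) :=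
    fun k i => ((hχ k).continuous.mul (contDiff_pderivAt (contDiff_pderivAt hf i) i).continuous
      ).integrable_of_hasCompactSupport (hχs k).mul_right
  have hiL : ∀ k, Integrable (fun x => χ k x * ∑ i, pderivAt i (pderivAt i f) x) (gaussPi ι) :=
    fun k => by
      simp_rw [Finset.mul_sum]
      exact integrable_finsetSum _ fun i _ => hi k i
  have h0L : ∀ k x, 0 ≤ χ k x * ∑ i, pderivAt i (pderivAt i f) x := fun k x =>
    mul_nonneg b.nonneg (hL x)
  have hlim : Tendsto (fun k => ∫ x, χ k x * ∑ i, pderivAt i (pderivAt i f) x ∂(gaussPi ι)) atTop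
      (𝓝 (∑ i, ∫ x, (x i ^ 2 - 1) * f x ∂(gaussPi ι))) := by
    have ha : ∀ k, ∫ x, χ k x * ∑ i, pderivAt i (pderivAt i f) x ∂(gaussPi ι) =
        ∑ i, ∫ x, (pderivAt i (pderivAt i (χ k)) x - χ k x -
          2 * (x i * pderivAt i (χ k) x) + x i ^ 2 * χ k x) * f x ∂(gaussPi ι) := fun k => by
      simp_rw [Finset.mul_sum]
      rw [integral_finsetSum _ fun i _ => hi k i]
      exact Finset.sum_congr rfl fun i _ => integral_mul_pderivAt_pderivAt hf (hχ k) (hχs k) i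
    simp_rw [ha]
    refine tendsto_finsetSum _ fun i _ => ?_
    have cb1 := (contDiff_pderivAt hb i).continuous
    have cb2 := (contDiff_pderivAt (contDiff_pderivAt hb i) i).continuous
    have hbs1 := hasCompactSupport_pderivAt hbs i
    obtain ⟨B2, hB2⟩ := (hasCompactSupport_pderivAt hbs1 i).exists_bound_of_continuous cb2
    have cy : Continuous fun y : ι → ℝ => y i * pderivAt i b y := (continuous_apply i).mul cb1
    obtain ⟨B1, hB1⟩ := HasCompactSupport.exists_bound_of_continuous
      (f := fun y : ι → ℝ => y i * pderivAt i b y) hbs1.mul_left cy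
    -- Derivatives of the cutoff are expressed at the scaled point: the factor c_k joins xᵢ to give
    -- a scaled coordinate, so all cutoff terms are bounded, and in the limit only −1 + xᵢ²
    -- survives.
    have hterm : ∀ k x, pderivAt i (pderivAt i (χ k)) x - χ k x -
        2 * (x i * pderivAt i (χ k) x) + x i ^ 2 * χ k x =
        c k ^ 2 * pderivAt i (pderivAt i b) (c k • x) - b (c k • x) -
        2 * ((c k • x) i * pderivAt i b (c k • x)) + x i ^ 2 * b (c k • x) := fun k x => by
      rw [hχ2, hχ1]
      simp only [χ, Pi.smul_apply, smul_eq_mul]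
      ring
    simp_rw [hterm]
    refine tendsto_integral_of_dominated_convergence
      (fun x => (B2 + 1 + 2 * B1) * |f x| + |x i ^ 2 * f x|) (fun k => ?_)
      ((hfi.abs.const_mul _).add (hxf i).abs) (fun k => ae_of_all _ fun x => ?_)
      (ae_of_all _ fun x => ?_)
    · have cs : Continuous fun x : ι → ℝ => c k • x := continuous_const_smul _
      exact (((((continuous_const.mul (cb2.comp cs)).sub (hb.continuous.comp cs)).sub
        (continuous_const.mul (cy.comp cs))).add (((continuous_apply i).pow 2).mul
        (hb.continuous.comp cs))).mul hf.continuous).aestronglyMeasurable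
    · have h1 : |c k ^ 2 * pderivAt i (pderivAt i b) (c k • x)| ≤ B2 := by
        rw [abs_mul, abs_pow]
        have h2 := hB2 (c k • x)
        rw [Real.norm_eq_abs] at h2
        calc |c k| ^ 2 * |pderivAt i (pderivAt i b) (c k • x)|
            ≤ 1 * |pderivAt i (pderivAt i b) (c k • x)| :=
              mul_le_mul_of_nonneg_right (pow_le_one₀ (abs_nonneg _) (hc1 k)) (abs_nonneg _)
          _ ≤ B2 := by linarith
      have h3 := hB1 (c k • x)
      rw [Real.norm_eq_abs] at h3
      have h4 : |b (c k • x)| ≤ 1 := by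
        rw [abs_of_nonneg b.nonneg]
        exact b.le_one
      rw [add_mul, Real.norm_eq_abs]
      refine (abs_add_le _ _).trans (add_le_add ?_ ?_)
      · rw [abs_mul]
        refine mul_le_mul_of_nonneg_right ?_ (abs_nonneg _)
        rw [abs_le] at h1 h3 h4 ⊢
        constructor <;> linarith [h1.1, h1.2, h3.1, h3.2, h4.1, h4.2]
      · rw [mul_right_comm, abs_mul]
        exact mul_le_of_le_one_right (abs_nonneg _) h4
    · have t1 := ((hc0.pow 2).mul (hbc cb2 x)).sub (hbc hb.continuous x)
      have t2 := (hbc cy x).const_mul 2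
      have t3 := (hbc hb.continuous x).const_mul (x i ^ 2)
      have t4 := ((t1.sub t2).add t3).mul_const (f x)
      refine t4.congr' ?_ |>.trans (le_of_eq ?_)
      · exact Eventually.of_forall fun k => rfl
      · rw [hb0]
        refine congrArg 𝓝 ?_
        rw [Pi.zero_apply]
        ring
  refine ⟨ge_of_tendsto' hlim fun k => integral_nonneg (h0L k),
    lintegral_ofReal_le_of_tendsto_bound
      (F := fun k x => χ k x * ∑ i, pderivAt i (pderivAt i f) x) (fun k => ?_) (fun x => ?_)
      (fun k => ?_) hlim⟩
  · exact ((hχ k).continuous.mul (continuous_finsetSum _ fun i _ =>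
      (contDiff_pderivAt (contDiff_pderivAt hf i) i).continuous)).measurable
  · have := (hbc hb.continuous x).mul_const (∑ i, pderivAt i (pderivAt i f) x)
    rwa [hb0, one_mul] at this
  · exact (ofReal_integral_eq_lintegral_ofReal (hiL k) (ae_of_all _ (h0L k))).ge

end laplacian

/-! ### Entropy of a density whose Laplacian dominates -/

section entropyBound

variable {ι : Type} [Fintype ι] [DecidableEq ι]

/-- A smooth probability density `f` relative to the Gaussian measure, centred with finite second
moments, such that `|∇f|² = f Δf` and `Δf ≥ 0`. -/
structure IsLaplacianDensity (f : (ι → ℝ) → ℝ) : Prop where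
  contDiff : ContDiff ℝ ∞ f
  nonneg : ∀ x, 0 ≤ f x
  sum_sq : ∀ x, ∑ i, pderivAt i f x ^ 2 = f x * ∑ i, pderivAt i (pderivAt i f) x
  laplacian_nonneg : ∀ x, 0 ≤ ∑ i, pderivAt i (pderivAt i f) x
  integrable : Integrable f (gaussPi ι)
  integral_eq_one : ∫ x, f x ∂(gaussPi ι) = 1
  integrable_sq : ∀ i, Integrable (fun x => x i ^ 2 * f x) (gaussPi ι)
  integral_eval : ∀ i, ∫ x, x i * f x ∂(gaussPi ι) = 0

/-- The measure with density `f` relative to the Gaussian. -/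
def gaussDensity (f : (ι → ℝ) → ℝ) : Measure (ι → ℝ) :=
  (gaussPi ι).withDensity fun x => ENNReal.ofReal (f x)

namespace IsLaplacianDensity

variable {f : (ι → ℝ) → ℝ} (hf : IsLaplacianDensity f)
include hf

lemma measurable : Measurable f := hf.contDiff.continuous.measurable

lemma differentiable : Differentiable ℝ f := hf.contDiff.differentiable (by simp)

lemma continuous_pderivAt (i : ι) : Continuous (pderivAt i f) :=
  (contDiff_pderivAt hf.contDiff i).continuous

lemma lintegral_eq_one : ∫⁻ x, ENNReal.ofReal (f x) ∂(gaussPi ι) = 1 := by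
  rw [← ofReal_integral_eq_lintegral_ofReal hf.integrable (ae_of_all _ hf.nonneg),
    hf.integral_eq_one, ENNReal.ofReal_one]

lemma isProbabilityMeasure : IsProbabilityMeasure (gaussDensity f) := by
  refine ⟨?_⟩
  rw [gaussDensity, withDensity_apply _ MeasurableSet.univ, setLIntegral_univ, hf.lintegral_eq_one]

lemma integral_gaussDensity (g : (ι → ℝ) → ℝ) :
    ∫ x, g x ∂(gaussDensity f) = ∫ x, f x * g x ∂(gaussPi ι) := by
  rw [gaussDensity, integral_withDensity_eq_integral_toReal_smul₀
    hf.measurable.ennreal_ofReal.aemeasurable (ae_of_all _ fun _ => ENNReal.ofReal_lt_top)]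
  simp [ENNReal.toReal_ofReal (hf.nonneg _)]

lemma integrable_gaussDensity_iff (g : (ι → ℝ) → ℝ) :
    Integrable g (gaussDensity f) ↔ Integrable (fun x => f x * g x) (gaussPi ι) := by
  rw [gaussDensity, integrable_withDensity_iff_integrable_smul₀'
    hf.measurable.ennreal_ofReal.aemeasurable (ae_of_all _ fun _ => ENNReal.ofReal_lt_top)]
  simp [ENNReal.toReal_ofReal (hf.nonneg _)]

/-- Zeros of f are critical points, so the quotient ∂ᵢf/f, which is 0 there by convention, still
satisfies f · (∂ᵢf/f) = ∂ᵢf everywhere. -/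
lemma pderivAt_eq_zero {x : ι → ℝ} (hx : f x = 0) (i : ι) : pderivAt i f x = 0 := by
  have h := hf.sum_sq x
  rw [hx, zero_mul, Finset.sum_eq_zero_iff_of_nonneg fun i _ => sq_nonneg _] at h
  exact pow_eq_zero_iff two_ne_zero |>.1 (h i (Finset.mem_univ i))

lemma integrable_laplacian :
    Integrable (fun x => ∑ i, pderivAt i (pderivAt i f) x) (gaussPi ι) := by
  refine integrable_of_lintegral_ofReal (continuous_finsetSum _ fun i _ =>
    (contDiff_pderivAt (contDiff_pderivAt hf.contDiff i) i).continuous).aestronglyMeasurable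
    hf.laplacian_nonneg (ne_top_of_le_ne_top ENNReal.ofReal_ne_top
      (nonneg_and_lintegral_laplacian_le hf.contDiff hf.laplacian_nonneg hf.integrable
        hf.integrable_sq).2)

/-- Equality where f > 0. At a zero of f the left side is 0 by convention, while the Laplacian may
be positive. -/
lemma sum_sq_div_le (x : ι → ℝ) :
    ∑ i, pderivAt i f x ^ 2 / f x ≤ ∑ i, pderivAt i (pderivAt i f) x := by
  rcases eq_or_lt_of_le (hf.nonneg x) with h | h
  · simp only [← h, div_zero, Finset.sum_const_zero]
    exact hf.laplacian_nonneg x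
  · rw [← Finset.sum_div, hf.sum_sq, mul_div_cancel_left₀ _ h.ne']

lemma integrable_sq_div (i : ι) :
    Integrable (fun x => pderivAt i f x ^ 2 / f x) (gaussPi ι) := by
  refine hf.integrable_laplacian.mono'
    (((hf.continuous_pderivAt i).measurable.pow_const 2).div hf.measurable).aestronglyMeasurable
    (ae_of_all _ fun x => ?_)
  have h0 : ∀ j, 0 ≤ pderivAt j f x ^ 2 / f x := fun j => div_nonneg (sq_nonneg _) (hf.nonneg x)
  rw [Real.norm_of_nonneg (h0 i)]
  exact (Finset.single_le_sum (f := fun j => pderivAt j f x ^ 2 / f x) (fun j _ => h0 j)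
    (Finset.mem_univ i)).trans (hf.sum_sq_div_le x)

lemma sum_moment_nonneg : 0 ≤ ∑ i, ∫ x, (x i ^ 2 - 1) * f x ∂(gaussPi ι) :=
  (nonneg_and_lintegral_laplacian_le hf.contDiff hf.laplacian_nonneg hf.integrable
    hf.integrable_sq).1

/-- The Fisher information is bounded by the excess of the second moment. -/
lemma fisher_le :
    ∑ i, ∫ x, pderivAt i f x ^ 2 / f x ∂(gaussPi ι) ≤
      ∑ i, ∫ x, (x i ^ 2 - 1) * f x ∂(gaussPi ι) := by
  have h0 : 0 ≤ᵐ[gaussPi ι] fun x => ∑ i, pderivAt i f x ^ 2 / f x :=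
    ae_of_all _ fun x => Finset.sum_nonneg fun i _ => div_nonneg (sq_nonneg _) (hf.nonneg x)
  obtain ⟨hM, hle⟩ := nonneg_and_lintegral_laplacian_le hf.contDiff hf.laplacian_nonneg
    hf.integrable hf.integrable_sq
  rw [← ENNReal.ofReal_le_ofReal_iff hM, ← integral_finsetSum _ fun i _ => hf.integrable_sq_div i,
    ofReal_integral_eq_lintegral_ofReal (integrable_finsetSum _ fun i _ => hf.integrable_sq_div i) h0]
  exact (lintegral_mono fun x => ENNReal.ofReal_le_ofReal (hf.sum_sq_div_le x)).trans hle

/-- By the arithmetic–geometric mean inequality |∂ᵢf| ≤ f + |∂ᵢf|²/f. -/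
lemma integrable_pderivAt (i : ι) : Integrable (pderivAt i f) (gaussPi ι) := by
  refine (hf.integrable.add (hf.integrable_sq_div i)).mono'
    (hf.continuous_pderivAt i).aestronglyMeasurable (ae_of_all _ fun x => ?_)
  rw [Pi.add_apply, Real.norm_eq_abs]
  rcases eq_or_lt_of_le (hf.nonneg x) with h | h
  · rw [hf.pderivAt_eq_zero h.symm, ← h]
    simp
  · rw [← sq_abs]
    have h1 : f x + |pderivAt i f x| ^ 2 / f x - |pderivAt i f x| =
        ((f x - |pderivAt i f x|) ^ 2 + f x * |pderivAt i f x|) / f x := by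
      field_simp
      ring
    have h2 : 0 ≤ ((f x - |pderivAt i f x|) ^ 2 + f x * |pderivAt i f x|) / f x := by positivity
    linarith

lemma integrable_eval_mul (i : ι) : Integrable (fun x => x i * f x) (gaussPi ι) := by
  refine (hf.integrable.add (hf.integrable_sq i)).mono'
    ((measurable_pi_apply i).mul hf.measurable).aestronglyMeasurable (ae_of_all _ fun x => ?_)
  have h := hf.nonneg x
  rw [Pi.add_apply, norm_mul, Real.norm_of_nonneg h, Real.norm_eq_abs]
  have h1 : |x i| ≤ 1 + x i ^ 2 := abs_le.2 ⟨by nlinarith [sq_nonneg (x i + 1)],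
    by nlinarith [sq_nonneg (x i - 1)]⟩
  nlinarith [mul_le_mul_of_nonneg_right h1 h]

lemma mul_score (i : ι) (x : ι → ℝ) : f x * (pderivAt i f x / f x) = pderivAt i f x := by
  rcases eq_or_ne (f x) 0 with h | h
  · rw [h, hf.pderivAt_eq_zero h, zero_mul]
  · exact mul_div_cancel₀ _ h

lemma mul_score_sq (i : ι) (x : ι → ℝ) :
    f x * (pderivAt i f x / f x) ^ 2 = pderivAt i f x ^ 2 / f x := by
  rw [sq, ← mul_assoc, hf.mul_score, sq, mul_div_assoc]

/-- The score is ∂ᵢf/f. Gaussian integration by parts applied to f gives its mean, which is the mean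
of xᵢ under fγ and hence zero; applied to uf it gives the duality relation. -/
lemma hasScore {lam : ℝ} (hP : ∀ u, IsTestFunction u →
    lam * (∫ x, u x ^ 2 ∂(gaussDensity f) - (∫ x, u x ∂(gaussDensity f)) ^ 2) ≤
      ∫ x, ∑ i, pderivAt i u x ^ 2 ∂(gaussDensity f)) :
    HasScore (gaussDensity f) lam fun i x => pderivAt i f x / f x where
  integrable_sq i := by
    rw [hf.integrable_gaussDensity_iff]
    simpa only [mul_comm] using hf.integrable_sq i
  memLp i := by
    rw [memLp_two_iff_integrable_sq, hf.integrable_gaussDensity_iff]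
    · simpa only [hf.mul_score_sq] using hf.integrable_sq_div i
    · exact ((hf.continuous_pderivAt i).measurable.div hf.measurable).aestronglyMeasurable
  integral_score i := by
    rw [hf.integral_gaussDensity]
    simp only [hf.mul_score]
    rw [integral_pderivAt_gaussPi hf.differentiable i hf.integrable (hf.integrable_pderivAt i)
      (hf.integrable_eval_mul i), hf.integral_eval]
  integral_mul_score u hu i := by
    obtain ⟨C, hC⟩ := hu.bounded
    obtain ⟨C', hC'⟩ := hu.bounded_pderivAt
    have hum : AEStronglyMeasurable u (gaussPi ι) := hu.measurable.aestronglyMeasurable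
    have hdm : AEStronglyMeasurable (pderivAt i u) (gaussPi ι) :=
      (contDiff_pderivAt hu.contDiff i).continuous.aestronglyMeasurable
    have hud : Differentiable ℝ u := hu.contDiff.differentiable (by simp)
    have i1 : Integrable (fun x => u x * f x) (gaussPi ι) :=
      hf.integrable.bdd_mul hum (ae_of_all _ hC)
    have i2 : Integrable (fun x => u x * pderivAt i f x) (gaussPi ι) :=
      (hf.integrable_pderivAt i).bdd_mul hum (ae_of_all _ hC)
    have i3 : Integrable (fun x => pderivAt i u x * f x) (gaussPi ι) :=
      hf.integrable.bdd_mul hdm (ae_of_all _ (hC' i))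
    have i4 : Integrable (fun x => u x * (x i * f x)) (gaussPi ι) :=
      (hf.integrable_eval_mul i).bdd_mul hum (ae_of_all _ hC)
    have hd : pderivAt i (fun x => u x * f x) = fun x => u x * pderivAt i f x + pderivAt i u x * f x :=
      funext fun x => by rw [pderivAt_fun_mul (hud x) (hf.differentiable x), mul_comm (f x)]
    have hibp := integral_pderivAt_gaussPi (hud.fun_mul hf.differentiable) i i1
      (by rw [hd]; exact i2.add i3) (i4.congr (ae_of_all _ fun x => by ring))
    rw [hd, integral_add i2 i3] at hibp
    rw [hf.integral_gaussDensity, hf.integral_gaussDensity]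
    have e1 : ∀ x, f x * (u x * (pderivAt i f x / f x)) = u x * pderivAt i f x := fun x => by
      rw [mul_left_comm, hf.mul_score]
    have e2 : ∀ x : ι → ℝ, f x * (x i * u x - pderivAt i u x) =
      u x * (x i * f x) - pderivAt i u x * f x := fun x => by ring
    simp_rw [e1, e2]
    rw [integral_sub i4 i3]
    have e3 : ∫ x, x i * (u x * f x) ∂(gaussPi ι) = ∫ x, u x * (x i * f x) ∂(gaussPi ι) :=
      integral_congr_ae (ae_of_all _ fun x => by ring)
    linarith
  poincare := hP

/-- The entropy is bounded by the excess of the second moment, with the constant `c(λ) / 2`. -/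
theorem lintegral_klFun_le {lam : ℝ} (hlam : 0 < lam) (hP : ∀ u, IsTestFunction u →
    lam * (∫ x, u x ^ 2 ∂(gaussDensity f) - (∫ x, u x ∂(gaussDensity f)) ^ 2) ≤
      ∫ x, ∑ i, pderivAt i u x ^ 2 ∂(gaussDensity f)) :
    ∫⁻ x, ENNReal.ofReal (klFun (f x)) ∂(gaussPi ι) ≤
      ENNReal.ofReal (1 / 2 * (cConst lam * ∑ i, ∫ x, (x i ^ 2 - 1) * f x ∂(gaussPi ι))) := by
  have := hf.isProbabilityMeasure
  have hc := (cConst_mem hlam).1.le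
  refine lintegral_klFun_le_of_flowDensity (ν := gaussDensity f) hf.contDiff.continuous hf.nonneg rfl
    (mul_nonneg (by norm_num) (mul_nonneg hc hf.sum_moment_nonneg)) fun s hs => ?_
  refine (lintegral_klFun_flowDensity_sqrt_le (hf.hasScore hP) hlam hs).trans
    (ENNReal.ofReal_le_ofReal ?_)
  refine mul_le_mul_of_nonneg_left (mul_le_mul_of_nonneg_left ?_ hc) (by norm_num)
  refine (Finset.sum_congr rfl fun i _ => ?_).trans_le hf.fisher_le
  rw [hf.integral_gaussDensity]
  simp only [hf.mul_score_sq]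

end IsLaplacianDensity

end entropyBound

/-! ### Squared moduli of holomorphic functions on phase space -/

section holomorphic

variable {κ : Type} [Fintype κ] [DecidableEq κ]

/-- The complex-valued partial derivative in the `i`-th coordinate. -/
def cderivAt {ι : Type} [Fintype ι] [DecidableEq ι] (i : ι) (G : (ι → ℝ) → ℂ) (x : ι → ℝ) : ℂ :=
  fderiv ℝ G x (Pi.single i 1)

/-- Smooth functions on phase space that are holomorphic in `q + i p`. -/
structure IsHolomorphic (G : (κ ⊕ κ → ℝ) → ℂ) : Prop where
  contDiff : ContDiff ℝ ∞ G
  cauchyRiemann : ∀ j x, cderivAt (Sum.inl j) G x = Complex.I * cderivAt (Sum.inr j) G x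

lemma contDiff_cderivAt {ι : Type} [Fintype ι] [DecidableEq ι] {G : (ι → ℝ) → ℂ}
    (hG : ContDiff ℝ ∞ G) (i : ι) : ContDiff ℝ ∞ (cderivAt i G) :=
  (hG.fderiv_right (m := ∞) (by simp)).clm_apply contDiff_const

lemma cderivAt_comm {ι : Type} [Fintype ι] [DecidableEq ι] {G : (ι → ℝ) → ℂ}
    (hG : ContDiff ℝ ∞ G) (i j : ι) (x : ι → ℝ) :
    cderivAt i (cderivAt j G) x = cderivAt j (cderivAt i G) x := by
  have hd : DifferentiableAt ℝ (fderiv ℝ G) x :=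
    (hG.fderiv_right (m := ∞) (by simp)).differentiable (by simp) x
  have h1 : ∀ k l, cderivAt k (cderivAt l G) x =
      fderiv ℝ (fderiv ℝ G) x (Pi.single k 1) (Pi.single l 1) := fun k l => by
    have : cderivAt l G = fun y => fderiv ℝ G y (Pi.single l 1) := rfl
    rw [cderivAt, this, fderiv_clm_apply hd (differentiableAt_const _)]
    simp
  rw [h1, h1]
  exact (hG.contDiffAt.isSymmSndFDerivAt
    (by simpa using (WithTop.coe_le_coe.2 le_top : ((2 : ℕ∞) : ℕ∞ω) ≤ ((⊤ : ℕ∞) : ℕ∞ω)))) _ _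

namespace IsHolomorphic

variable {G H : (κ ⊕ κ → ℝ) → ℂ}

lemma differentiable (hG : IsHolomorphic G) : Differentiable ℝ G :=
  hG.contDiff.differentiable (by simp)

lemma mul (hG : IsHolomorphic G) (hH : IsHolomorphic H) : IsHolomorphic fun x => G x * H x := by
  refine ⟨hG.contDiff.mul hH.contDiff, fun j x => ?_⟩
  have h : ∀ i, cderivAt i (fun x => G x * H x) x = G x * cderivAt i H x + H x * cderivAt i G x :=
    fun i => by simp [cderivAt, fderiv_fun_mul (hG.differentiable x) (hH.differentiable x)]
  rw [h, h, hG.cauchyRiemann, hH.cauchyRiemann]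
  ring

lemma sum {σ : Type*} {s : Finset σ} {G : σ → (κ ⊕ κ → ℝ) → ℂ} (hG : ∀ a, IsHolomorphic (G a)) :
    IsHolomorphic fun x => ∑ a ∈ s, G a x := by
  refine ⟨ContDiff.sum fun a _ => (hG a).contDiff, fun j x => ?_⟩
  have h : ∀ i, cderivAt i (fun x => ∑ a ∈ s, G a x) x = ∑ a ∈ s, cderivAt i (G a) x := fun i => by
    rw [cderivAt, fderiv_fun_sum fun a _ => (hG a).differentiable x]
    simp [cderivAt]
  rw [h, h, Finset.mul_sum]
  exact Finset.sum_congr rfl fun a _ => (hG a).cauchyRiemann j x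

lemma const (c : ℂ) : IsHolomorphic fun _ : κ ⊕ κ → ℝ => c :=
  ⟨contDiff_const, fun j x => by simp [cderivAt]⟩

lemma cexp (hG : IsHolomorphic G) : IsHolomorphic fun x => Complex.exp (G x) := by
  refine ⟨hG.contDiff.cexp, fun j x => ?_⟩
  have h : ∀ i, cderivAt i (fun x => Complex.exp (G x)) x = Complex.exp (G x) * cderivAt i G x :=
    fun i => by
      rw [cderivAt, ((hG.differentiable x).hasFDerivAt.cexp).fderiv]
      simp [cderivAt]
  rw [h, h, hG.cauchyRiemann]
  ring

lemma clm {L : (κ ⊕ κ → ℝ) →L[ℝ] ℂ}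
    (hL : ∀ j, L (Pi.single (Sum.inl j) 1) = Complex.I * L (Pi.single (Sum.inr j) 1)) :
    IsHolomorphic fun x => L x :=
  ⟨L.contDiff, fun j x => by simpa [cderivAt] using hL j⟩

/-- The Cauchy–Riemann equations pass to derivatives by symmetry of the second derivative. -/
lemma cderivAt_inr (hG : IsHolomorphic G) (k : κ) : IsHolomorphic (cderivAt (Sum.inr k) G) := by
  refine ⟨contDiff_cderivAt hG.contDiff _, fun j x => ?_⟩
  rw [cderivAt_comm hG.contDiff, cderivAt_comm hG.contDiff (Sum.inr j)]
  have h1 : cderivAt (Sum.inl j) G = fun y => Complex.I * cderivAt (Sum.inr j) G y :=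
    funext (hG.cauchyRiemann j)
  rw [h1, cderivAt, fderiv_const_mul ((contDiff_cderivAt hG.contDiff _).differentiable (by simp) x)]
  simp [cderivAt]

lemma cderivAt_inl_inl (hG : IsHolomorphic G) (j : κ) (x : κ ⊕ κ → ℝ) :
    cderivAt (Sum.inl j) (cderivAt (Sum.inl j) G) x =
      -cderivAt (Sum.inr j) (cderivAt (Sum.inr j) G) x := by
  have h1 : cderivAt (Sum.inl j) G = fun y => Complex.I * cderivAt (Sum.inr j) G y :=
    funext (hG.cauchyRiemann j)
  have h2 := (hG.cderivAt_inr j).cauchyRiemann j x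
  rw [h1]
  have h3 : cderivAt (Sum.inl j) (fun y => Complex.I * cderivAt (Sum.inr j) G y) x =
      Complex.I * cderivAt (Sum.inl j) (cderivAt (Sum.inr j) G) x := by
    rw [cderivAt, fderiv_const_mul ((contDiff_cderivAt hG.contDiff _).differentiable (by simp) x)]
    simp [cderivAt]
  rw [h3, h2, ← mul_assoc, Complex.I_mul_I, neg_one_mul]

omit [Fintype κ] [DecidableEq κ] in
lemma pderivAt_inner {ι : Type} [Fintype ι] [DecidableEq ι] {A B : (ι → ℝ) → ℂ}
    (hA : ContDiff ℝ ∞ A) (hB : ContDiff ℝ ∞ B) (i : ι) (x : ι → ℝ) :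
    pderivAt i (fun x => inner ℝ (A x) (B x)) x =
      inner ℝ (A x) (cderivAt i B x) + inner ℝ (cderivAt i A x) (B x) := by
  rw [pderivAt, ((hA.differentiable (by simp) x).hasFDerivAt.inner ℝ
    (hB.differentiable (by simp) x).hasFDerivAt).fderiv]
  simp [cderivAt]

omit [Fintype κ] [DecidableEq κ] in
lemma pderivAt_norm_sq {ι : Type} [Fintype ι] [DecidableEq ι] {A : (ι → ℝ) → ℂ}
    (hA : ContDiff ℝ ∞ A) (i : ι) :
    pderivAt i (fun x => ‖A x‖ ^ 2) = fun x => 2 * inner ℝ (A x) (cderivAt i A x) := by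
  funext x
  have h : (fun x => ‖A x‖ ^ 2) = fun x => inner ℝ (A x) (A x) :=
    funext fun x => (real_inner_self_eq_norm_sq _).symm
  rw [h, pderivAt_inner hA hA, real_inner_comm (A x)]
  ring

omit [Fintype κ] [DecidableEq κ] in
lemma pderivAt_pderivAt_norm_sq {ι : Type} [Fintype ι] [DecidableEq ι] {A : (ι → ℝ) → ℂ}
    (hA : ContDiff ℝ ∞ A) (i : ι) (x : ι → ℝ) :
    pderivAt i (pderivAt i fun x => ‖A x‖ ^ 2) x =
      2 * (inner ℝ (A x) (cderivAt i (cderivAt i A) x) + ‖cderivAt i A x‖ ^ 2) := by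
  have hB := contDiff_cderivAt hA i
  rw [pderivAt_norm_sq hA, pderivAt_fun_mul (differentiableAt_const _)
    ((hA.inner ℝ hB).differentiable (by simp) x), pderivAt_inner hA hB, real_inner_self_eq_norm_sq]
  simp [pderivAt]

/-- The Cauchy–Riemann equations make the second derivatives of G in pⱼ and qⱼ opposite, so they
cancel; the two squared first derivatives agree in modulus. -/
lemma laplacian_norm_sq (hG : IsHolomorphic G) (x : κ ⊕ κ → ℝ) :
    ∑ i, pderivAt i (pderivAt i fun x => ‖G x‖ ^ 2) x =
      ∑ j, 4 * ‖cderivAt (Sum.inr j) G x‖ ^ 2 := by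
  rw [Fintype.sum_sum_type, ← Finset.sum_add_distrib]
  refine Finset.sum_congr rfl fun j _ => ?_
  rw [pderivAt_pderivAt_norm_sq hG.contDiff, pderivAt_pderivAt_norm_sq hG.contDiff,
    hG.cderivAt_inl_inl, hG.cauchyRiemann, inner_neg_right, norm_mul, Complex.norm_I, one_mul]
  ring

/-- In each complex coordinate the two partial derivatives of |G|² are, up to sign, twice the real
and imaginary parts of the conjugate of G times ∂G, so their squares add up to 4|G|²|∂G|². -/
lemma sum_sq_norm_sq (hG : IsHolomorphic G) (x : κ ⊕ κ → ℝ) :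
    ∑ i, pderivAt i (fun x => ‖G x‖ ^ 2) x ^ 2 =
      ‖G x‖ ^ 2 * ∑ i, pderivAt i (pderivAt i fun x => ‖G x‖ ^ 2) x := by
  rw [hG.laplacian_norm_sq, Fintype.sum_sum_type, ← Finset.sum_add_distrib, Finset.mul_sum]
  refine Finset.sum_congr rfl fun j _ => ?_
  rw [pderivAt_norm_sq hG.contDiff, pderivAt_norm_sq hG.contDiff]
  simp only [hG.cauchyRiemann, Complex.inner, ← Complex.normSq_eq_norm_sq, Complex.normSq_apply, Complex.mul_re,
    Complex.mul_im, Complex.conj_re, Complex.conj_im, Complex.I_re, Complex.I_im]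
  ring

end IsHolomorphic

lemma isHolomorphic_expIntegral {X : Type*} [MeasurableSpace X] {μ : Measure X}
    {Λ : X → (κ ⊕ κ → ℝ) →L[ℝ] ℂ} {θ : X → ℂ} (hE : ExpIntegrable μ Λ θ)
    (hΛ : ∀ x j, Λ x (Pi.single (Sum.inl j) 1) = Complex.I * Λ x (Pi.single (Sum.inr j) 1)) :
    IsHolomorphic (expIntegral μ Λ θ) := by
  refine ⟨contDiff_infty.2 fun n => hE.contDiff_nat n, fun j z => ?_⟩
  have h : ∀ i, cderivAt i (expIntegral μ Λ θ) z =
      ∫ x, Complex.exp (Λ x z) * (Λ x (Pi.single i 1) * θ x) ∂μ := fun i => by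
    rw [cderivAt, (hE.hasFDerivAt z).fderiv, expIntegral,
      ContinuousLinearMap.integral_apply (hE.mul_vec.integrable_smul z)]
    rfl
  rw [h, h, ← integral_const_mul]
  refine integral_congr_ae (ae_of_all _ fun x => ?_)
  simp only [hΛ]
  ring

end holomorphic

/-! ### Rescaling of phase space -/

section rescaling

lemma lintegral_gaussLine_inv (s : Set ℝ) (hs : MeasurableSet s) :
    ∫⁻ t, s.indicator (fun t => ENNReal.ofReal ((gaussPDF t)⁻¹)) t ∂gaussLine = volume s := by
  rw [lintegral_gaussLine]
  have h1 : ∀ t, ENNReal.ofReal (gaussPDF t) *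
      s.indicator (fun t => ENNReal.ofReal ((gaussPDF t)⁻¹)) t = s.indicator (fun _ => 1) t :=
    fun t => by
      by_cases ht : t ∈ s
      · simp only [indicator_of_mem ht]
        rw [← ENNReal.ofReal_mul (gaussPDF_pos t).le, mul_inv_cancel₀ (gaussPDF_pos t).ne',
          ENNReal.ofReal_one]
      · simp [indicator_of_notMem ht]
  simp_rw [h1]
  rw [lintegral_indicator hs]
  simp

lemma measurable_inv_gaussPDF : Measurable fun t => ENNReal.ofReal ((gaussPDF t)⁻¹) :=
  continuous_gaussPDF.measurable.inv.ennreal_ofReal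

variable {ι : Type} [Fintype ι]

lemma volume_pi_eq_withDensity :
    (volume : Measure (ι → ℝ)) =
      (gaussPi ι).withDensity fun x => ∏ i, ENNReal.ofReal ((gaussPDF (x i))⁻¹) := by
  rw [volume_pi]
  refine Measure.pi_eq fun s hs => ?_
  rw [withDensity_apply _ (MeasurableSet.univ_pi hs), ← lintegral_indicator (MeasurableSet.univ_pi hs)]
  have h1 : ∀ x : ι → ℝ, (univ.pi s).indicator
      (fun x => ∏ i, ENNReal.ofReal ((gaussPDF (x i))⁻¹)) x =
      ∏ i, (s i).indicator (fun t => ENNReal.ofReal ((gaussPDF t)⁻¹)) (x i) := fun x => by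
    by_cases hx : x ∈ univ.pi s
    · rw [indicator_of_mem hx]
      exact Finset.prod_congr rfl fun i _ => (indicator_of_mem (hx i (mem_univ i))
        (fun t => ENNReal.ofReal ((gaussPDF t)⁻¹))).symm
    · rw [indicator_of_notMem hx]
      obtain ⟨i, hi⟩ : ∃ i, x i ∉ s i := by simpa using hx
      exact (Finset.prod_eq_zero (Finset.mem_univ i) (indicator_of_notMem hi _)).symm
  simp_rw [h1]
  rw [lintegral_gaussPi_prod fun i => measurable_inv_gaussPDF.indicator (hs i)]
  exact Finset.prod_congr rfl fun i _ => lintegral_gaussLine_inv (s i) (hs i)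

/-- The inverse of the Gaussian weight `exp(-|x|² / 2)`. -/
def expWeight (x : ι → ℝ) : ℝ := Real.exp ((∑ i, x i ^ 2) / 2)

lemma expWeight_pos (x : ι → ℝ) : 0 < expWeight x := Real.exp_pos _

lemma continuous_expWeight : Continuous fun x : ι → ℝ => expWeight x := by
  unfold expWeight
  fun_prop

lemma prod_inv_gaussPDF (x : ι → ℝ) :
    ∏ i, ENNReal.ofReal ((gaussPDF (x i))⁻¹) =
      ENNReal.ofReal (√(2 * Real.pi) ^ Fintype.card ι) * ENNReal.ofReal (expWeight x) := by
  rw [← ENNReal.ofReal_prod_of_nonneg fun i _ => inv_nonneg.2 (gaussPDF_pos _).le,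
    ← ENNReal.ofReal_mul (by positivity)]
  congr 1
  simp only [gaussPDF_eq, mul_inv, inv_inv, Finset.prod_mul_distrib, Finset.prod_const,
    Finset.card_univ, expWeight, ← Real.exp_neg, ← Real.exp_sum]
  rw [Finset.sum_div]
  congr 3
  funext i
  ring

lemma smul_withDensity_expWeight :
    ENNReal.ofReal (√(2 * Real.pi) ^ Fintype.card ι) •
      (gaussPi ι).withDensity (fun x => ENNReal.ofReal (expWeight x)) = volume := by
  rw [volume_pi_eq_withDensity, ← withDensity_smul _ continuous_expWeight.measurable.ennreal_ofReal]
  congr 1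
  funext x
  rw [prod_inv_gaussPDF]
  rfl

variable {n : ℕ} {h : ℝ}

/-- The scaling factor `√(h / 2π)`. -/
def phaseScale (h : ℝ) : ℝ := √(h / (2 * Real.pi))

lemma phaseScale_pos (hh : 0 < h) : 0 < phaseScale h := Real.sqrt_pos.2 (by positivity)

/-- The affine map `x ↦ √(h / 2π) x + b`. -/
def phaseAffine (h : ℝ) (b : PhaseSpace n) (x : Fin n ⊕ Fin n → ℝ) : PhaseSpace n :=
  phaseScale h • WithLp.toLp 2 x + b

lemma measurableEmbedding_phaseAffine (hh : 0 < h) (b : PhaseSpace n) :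
    MeasurableEmbedding (phaseAffine h b) :=
  ((Homeomorph.addRight b).measurableEmbedding.comp
    (Homeomorph.smulOfNeZero _ (phaseScale_pos hh).ne').measurableEmbedding).comp
    (MeasurableEquiv.toLp 2 (Fin n ⊕ Fin n → ℝ)).measurableEmbedding

/-- The weight exp(|x|²/2) turns γ into (2π)⁻ⁿ dx on ℝ^{2n}, and the dilation contributes (h/2π)⁻ⁿ;
the product is h⁻ⁿ. -/
lemma map_phaseAffine (hh : 0 < h) (b : PhaseSpace n) :
    ((gaussPi (Fin n ⊕ Fin n)).withDensity fun x => ENNReal.ofReal (expWeight x)).map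
      (phaseAffine h b) = phaseMeasure n h := by
  have hs := phaseScale_pos hh
  have hvol : (volume : Measure (Fin n ⊕ Fin n → ℝ)).map (phaseAffine h b) =
      ENNReal.ofReal ((phaseScale h ^ (2 * n))⁻¹) • (volume : Measure (PhaseSpace n)) := by
    have h1 : phaseAffine h b = (fun z => z + b) ∘ (fun z => phaseScale h • z) ∘
        (WithLp.toLp 2 : (Fin n ⊕ Fin n → ℝ) → PhaseSpace n) := rfl
    have hm : Measurable (WithLp.toLp 2 : (Fin n ⊕ Fin n → ℝ) → PhaseSpace n) :=
      (MeasurableEquiv.toLp 2 (Fin n ⊕ Fin n → ℝ)).measurable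
    rw [h1, ← Measure.map_map (measurable_add_const b) ((measurable_const_smul _).comp hm),
      ← Measure.map_map (measurable_const_smul _) hm,
      (PiLp.volume_preserving_toLp (Fin n ⊕ Fin n)).map_eq, Measure.map_addHaar_smul _ hs.ne',
      Measure.map_smul, map_add_right_eq_self]
    congr 2
    rw [finrank_euclideanSpace, Fintype.card_sum, Fintype.card_fin, ← two_mul,
      abs_of_nonneg (by positivity)]
  have hc : ENNReal.ofReal (√(2 * Real.pi) ^ Fintype.card (Fin n ⊕ Fin n)) ≠ 0 := by
    simp only [ne_eq, ENNReal.ofReal_eq_zero, not_le]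
    positivity
  have h2 := congrArg (Measure.map (phaseAffine h b))
    (smul_withDensity_expWeight (ι := Fin n ⊕ Fin n))
  rw [Measure.map_smul, hvol] at h2
  have h3 := congrArg (fun m : Measure (PhaseSpace n) =>
    (ENNReal.ofReal (√(2 * Real.pi) ^ Fintype.card (Fin n ⊕ Fin n)))⁻¹ • m) h2
  simp only [smul_smul, ENNReal.inv_mul_cancel hc ENNReal.ofReal_ne_top, one_smul] at h3
  rw [h3, phaseMeasure]
  congr 1
  rw [← ENNReal.ofReal_inv_of_pos (by positivity), ← ENNReal.ofReal_mul (by positivity)]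
  congr 1
  rw [Fintype.card_sum, Fintype.card_fin, ← two_mul, pow_mul, pow_mul, phaseScale,
    Real.sq_sqrt (by positivity), Real.sq_sqrt (by positivity), ← mul_inv, ← mul_pow]
  congr 2
  field_simp

lemma lintegral_phaseMeasure (hh : 0 < h) (b : PhaseSpace n) (F : PhaseSpace n → ℝ≥0∞) :
    ∫⁻ w, F w ∂(phaseMeasure n h) =
      ∫⁻ x, ENNReal.ofReal (expWeight x) * F (phaseAffine h b x) ∂(gaussPi (Fin n ⊕ Fin n)) := by
  rw [← map_phaseAffine hh b, (measurableEmbedding_phaseAffine hh b).lintegral_map,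
    lintegral_withDensity_eq_lintegral_mul_non_measurable _
      continuous_expWeight.measurable.ennreal_ofReal (ae_of_all _ fun _ => ENNReal.ofReal_lt_top)]
  rfl

lemma integral_phaseMeasure {E : Type*} [NormedAddCommGroup E] [NormedSpace ℝ E] (hh : 0 < h)
    (b : PhaseSpace n) (F : PhaseSpace n → E) :
    ∫ w, F w ∂(phaseMeasure n h) =
      ∫ x, expWeight x • F (phaseAffine h b x) ∂(gaussPi (Fin n ⊕ Fin n)) := by
  rw [← map_phaseAffine hh b, (measurableEmbedding_phaseAffine hh b).integral_map,
    integral_withDensity_eq_integral_toReal_smul₀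
      continuous_expWeight.measurable.ennreal_ofReal.aemeasurable
      (ae_of_all _ fun _ => ENNReal.ofReal_lt_top)]
  simp [ENNReal.toReal_ofReal (expWeight_pos _).le]

lemma integrable_phaseMeasure_iff {E : Type*} [NormedAddCommGroup E] [NormedSpace ℝ E] (hh : 0 < h)
    (b : PhaseSpace n) (F : PhaseSpace n → E) :
    Integrable F (phaseMeasure n h) ↔
      Integrable (fun x => expWeight x • F (phaseAffine h b x)) (gaussPi (Fin n ⊕ Fin n)) := by
  rw [← map_phaseAffine hh b, (measurableEmbedding_phaseAffine hh b).integrable_map_iff,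
    integrable_withDensity_iff_integrable_smul₀'
      continuous_expWeight.measurable.ennreal_ofReal.aemeasurable
      (ae_of_all _ fun _ => ENNReal.ofReal_lt_top)]
  simp [ENNReal.toReal_ofReal (expWeight_pos _).le]

lemma gaussian_eq_map : gaussian n = (gaussPi (Fin n ⊕ Fin n)).map (WithLp.toLp 2) :=
  map_pi_eq_stdGaussian.symm

/-- The density of the rescaled measure in coordinates. -/
def rescaledDensity (h : ℝ) (ρ : PhaseSpace n → ℝ) (a : PhaseSpace n) (x : Fin n ⊕ Fin n → ℝ) : ℝ :=
  expWeight x * ρ (phaseAffine h a x)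

lemma exp_norm_sq_toLp (x : Fin n ⊕ Fin n → ℝ) :
    Real.exp (‖(WithLp.toLp 2 x : PhaseSpace n)‖ ^ 2 / 2) = expWeight x := by
  rw [EuclideanSpace.real_norm_sq_eq]
  rfl

lemma rescaledMeasure_eq_map (ρ : PhaseSpace n → ℝ) (a : PhaseSpace n) :
    rescaledMeasure h ρ a = (gaussDensity (rescaledDensity h ρ a)).map (WithLp.toLp 2) := by
  have he := (MeasurableEquiv.toLp 2 (Fin n ⊕ Fin n → ℝ)).measurableEmbedding
  refine Measure.ext fun s hs => ?_
  have hms := (MeasurableEquiv.toLp 2 (Fin n ⊕ Fin n → ℝ)).measurable hs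
  rw [rescaledMeasure, gaussian_eq_map, withDensity_apply _ hs]
  change _ = (gaussDensity (rescaledDensity h ρ a)).map
    (MeasurableEquiv.toLp 2 (Fin n ⊕ Fin n → ℝ)) s
  rw [he.map_apply, gaussDensity, withDensity_apply _ hms]
  change ∫⁻ z in s, _ ∂((gaussPi (Fin n ⊕ Fin n)).map
    (MeasurableEquiv.toLp 2 (Fin n ⊕ Fin n → ℝ))) = _
  rw [he.restrict_map, he.lintegral_map]
  refine lintegral_congr fun x => ?_
  simp only [MeasurableEquiv.coe_toLp, exp_norm_sq_toLp]
  rfl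

end rescaling

/-! ### The rescaled density as a squared modulus -/

section coherent

variable {n : ℕ} {h : ℝ}

/-- The complex coordinate `q_j + i p_j` as a real-linear form. -/
def phaseForm (j : Fin n) : (Fin n ⊕ Fin n → ℝ) →L[ℝ] ℂ :=
  Complex.ofRealCLM.comp (ContinuousLinearMap.proj (Sum.inr j)) +
    Complex.I • Complex.ofRealCLM.comp (ContinuousLinearMap.proj (Sum.inl j))

lemma phaseForm_apply (j : Fin n) (x : Fin n ⊕ Fin n → ℝ) :
    phaseForm j x = (x (Sum.inr j) : ℂ) + Complex.I * x (Sum.inl j) := by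
  simp [phaseForm]

lemma phaseForm_inl (j k : Fin n) : phaseForm j (Pi.single (Sum.inl k) 1) =
    Complex.I * phaseForm j (Pi.single (Sum.inr k) 1) := by
  simp [phaseForm_apply, Pi.single_apply]

/-- The exponent `∑ j, (y_j - b_j) / √(h / 2π) (q_j + i p_j)`. -/
def coherentForm (h : ℝ) (b : PhaseSpace n) (y : EuclideanSpace ℝ (Fin n)) :
    (Fin n ⊕ Fin n → ℝ) →L[ℝ] ℂ :=
  ∑ j, ((y j - b (Sum.inr j)) / phaseScale h) • phaseForm j

lemma coherentForm_apply (b : PhaseSpace n) (y : EuclideanSpace ℝ (Fin n))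
    (x : Fin n ⊕ Fin n → ℝ) : coherentForm h b y x =
      ∑ j, (((y j - b (Sum.inr j)) / phaseScale h : ℝ) : ℂ) *
        ((x (Sum.inr j) : ℂ) + Complex.I * x (Sum.inl j)) := by
  simp [coherentForm, phaseForm_apply, mul_add]

lemma coherentForm_inl (b : PhaseSpace n) (y : EuclideanSpace ℝ (Fin n)) (k : Fin n) :
    coherentForm h b y (Pi.single (Sum.inl k) 1) =
      Complex.I * coherentForm h b y (Pi.single (Sum.inr k) 1) := by
  simp only [coherentForm, sum_apply, smul_apply, phaseForm_inl,
    Finset.mul_sum]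
  exact Finset.sum_congr rfl fun j _ => (mul_smul_comm _ _ _).symm

lemma continuous_coherentForm (b : PhaseSpace n) : Continuous fun y => coherentForm h b y := by
  unfold coherentForm
  fun_prop

lemma norm_coherentForm_le (hh : 0 < h) (b : PhaseSpace n) (y : EuclideanSpace ℝ (Fin n)) :
    ‖coherentForm h b y‖ ≤ (∑ j : Fin n, ‖phaseForm j‖ / phaseScale h) * ‖y - position b‖ := by
  rw [Finset.sum_mul]
  refine (norm_sum_le _ _).trans (Finset.sum_le_sum fun j _ => ?_)
  have hs := phaseScale_pos hh
  rw [norm_smul, norm_div, Real.norm_of_nonneg hs.le, div_mul_eq_mul_div, div_mul_eq_mul_div,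
    mul_comm ‖phaseForm j‖]
  refine div_le_div_of_nonneg_right (mul_le_mul_of_nonneg_right ?_ (norm_nonneg _)) hs.le
  exact PiLp.norm_apply_le (y - position b) j

/-- The Gaussian-weighted wave function in the coherent state integral. -/
def coherentWeight (h : ℝ) (b : PhaseSpace n) (ψ : EuclideanSpace ℝ (Fin n) → ℂ)
    (y : EuclideanSpace ℝ (Fin n)) : ℂ :=
  ((Real.exp (-‖y - position b‖ ^ 2 / (2 * hstar h)) : ℝ) : ℂ) *
    (Complex.exp (Complex.I * ((inner ℝ (momentum b) y / hstar h : ℝ) : ℂ)) * ψ y)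

lemma norm_exp_I_mul_ofReal (t : ℝ) : ‖Complex.exp (Complex.I * (t : ℂ))‖ = 1 := by
  rw [mul_comm]
  exact Complex.norm_exp_ofReal_mul_I t

lemma norm_coherentWeight (b : PhaseSpace n) (ψ : EuclideanSpace ℝ (Fin n) → ℂ)
    (y : EuclideanSpace ℝ (Fin n)) : ‖coherentWeight h b ψ y‖ =
      Real.exp (-‖y - position b‖ ^ 2 / (2 * hstar h)) * ‖ψ y‖ := by
  rw [coherentWeight, norm_mul, norm_mul, norm_exp_I_mul_ofReal, one_mul, Complex.norm_real,
    Real.norm_of_nonneg (Real.exp_pos _).le]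

lemma hstar_pos (hh : 0 < h) : 0 < hstar h := div_pos hh (by positivity)

/-- Since ψ is only square integrable, the Gaussian is split: one half pairs with ψ by
Cauchy–Schwarz, the other absorbs the exponential of the linear form by completing a square. -/
lemma expIntegrable_coherent (hh : 0 < h) (b : PhaseSpace n) {ψ : EuclideanSpace ℝ (Fin n) → ℂ}
    (hψ : MemLp ψ 2 volume) :
    ExpIntegrable volume (coherentForm h b) (coherentWeight h b ψ) := by
  have hs := hstar_pos hh
  have hΛ : AEStronglyMeasurable (coherentForm h b) volume :=
    (continuous_coherentForm b).aestronglyMeasurable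
  have hθ : AEStronglyMeasurable (coherentWeight h b ψ) volume := by
    have c1 : Continuous fun y : EuclideanSpace ℝ (Fin n) =>
        ((Real.exp (-‖y - position b‖ ^ 2 / (2 * hstar h)) : ℝ) : ℂ) := by fun_prop
    have c2 : Continuous fun y : EuclideanSpace ℝ (Fin n) =>
        Complex.exp (Complex.I * ((inner ℝ (momentum b) y / hstar h : ℝ) : ℂ)) := by fun_prop
    exact c1.aestronglyMeasurable.mul (c2.aestronglyMeasurable.mul hψ.1)
  refine ⟨hΛ, hθ, fun c => ?_⟩
  set C := ∑ j : Fin n, ‖phaseForm j‖ / phaseScale h with hC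
  have hg : MemLp (fun y : EuclideanSpace ℝ (Fin n) =>
      Real.exp (-(4 * hstar h)⁻¹ * ‖y - position b‖ ^ 2)) 2 volume := by
    have cg : Continuous fun y : EuclideanSpace ℝ (Fin n) =>
      Real.exp (-(4 * hstar h)⁻¹ * ‖y - position b‖ ^ 2) := by fun_prop
    rw [memLp_two_iff_integrable_sq cg.aestronglyMeasurable]
    have h1 := (GaussianFourier.integrable_cexp_neg_mul_sq_norm_add (b := ((2 * hstar h)⁻¹ : ℝ))
      (by rw [Complex.ofReal_re]; positivity) 0 (0 : EuclideanSpace ℝ (Fin n))).norm.comp_sub_right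
      (position b)
    refine h1.congr (ae_of_all _ fun y => ?_)
    simp only [Complex.norm_exp, inner_zero_left, Complex.ofReal_zero, mul_zero, add_zero]
    rw [← Real.exp_nat_mul, ← Complex.ofReal_pow, ← Complex.ofReal_neg, ← Complex.ofReal_mul,
      Complex.ofReal_re]
    congr 1
    push_cast
    field_simp
    ring
  have hprod : Integrable (fun y => Real.exp (hstar h * (|c| * C) ^ 2) *
      (Real.exp (-(4 * hstar h)⁻¹ * ‖y - position b‖ ^ 2) * ‖ψ y‖)) volume :=
    (hg.integrable_mul hψ.norm).const_mul _
  refine hprod.mono' ((Real.continuous_exp.comp_aestronglyMeasurable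
    (hΛ.norm.const_mul c)).mul hθ.norm) (ae_of_all _ fun y => ?_)
  rw [Real.norm_of_nonneg (by positivity), norm_coherentWeight, ← mul_assoc, ← mul_assoc,
    ← Real.exp_add, ← Real.exp_add]
  refine mul_le_mul_of_nonneg_right (Real.exp_le_exp.2 ?_) (norm_nonneg _)
  have h2 : c * ‖coherentForm h b y‖ ≤ |c| * (C * ‖y - position b‖) :=
    mul_le_mul (le_abs_self c) (norm_coherentForm_le hh b y) (norm_nonneg _) (abs_nonneg c)
  have h3 : hstar h * (|c| * C) ^ 2 + -(4 * hstar h)⁻¹ * ‖y - position b‖ ^ 2 -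
      (|c| * (C * ‖y - position b‖) + -‖y - position b‖ ^ 2 / (2 * hstar h)) =
      (2 * hstar h * (|c| * C) - ‖y - position b‖) ^ 2 / (4 * hstar h) := by
    field_simp
    ring
  have h4 : 0 ≤ (2 * hstar h * (|c| * C) - ‖y - position b‖) ^ 2 / (4 * hstar h) := by positivity
  linarith

/-- The holomorphic function whose squared modulus is the rescaled density. -/
def coherentHolo (h : ℝ) (b : PhaseSpace n) (ψ : EuclideanSpace ℝ (Fin n) → ℂ)
    (x : Fin n ⊕ Fin n → ℝ) : ℂ :=
  ((2 / h) ^ ((n : ℝ) / 4) : ℝ) * Complex.exp (∑ j, -(1 / 4) * (phaseForm j x * phaseForm j x)) *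
    expIntegral volume (coherentForm h b) (coherentWeight h b ψ) x

lemma isHolomorphic_coherentHolo (hh : 0 < h) (b : PhaseSpace n)
    {ψ : EuclideanSpace ℝ (Fin n) → ℂ} (hψ : MemLp ψ 2 volume) :
    IsHolomorphic (coherentHolo h b ψ) := by
  have hw : ∀ j : Fin n, IsHolomorphic fun x => phaseForm j x := fun j =>
    IsHolomorphic.clm (phaseForm_inl j)
  exact ((IsHolomorphic.const _).mul (IsHolomorphic.cexp (IsHolomorphic.sum fun j =>
    (IsHolomorphic.const _).mul ((hw j).mul (hw j))))).mul
    (isHolomorphic_expIntegral (expIntegrable_coherent hh b hψ) (coherentForm_inl b))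

lemma phaseScale_sq (hh : 0 < h) : phaseScale h ^ 2 = hstar h := Real.sq_sqrt (by positivity)

/-- Expanding the exponent around b isolates the part bilinear in y − b and q + ip. What does not
depend on y is a phase of modulus one and a real Gaussian factor in q. -/
lemma norm_integral_coherent (hh : 0 < h) (b : PhaseSpace n) (ψ : EuclideanSpace ℝ (Fin n) → ℂ)
    (x : Fin n ⊕ Fin n → ℝ) :
    ‖∫ y : EuclideanSpace ℝ (Fin n),
      Complex.exp (Complex.I * ((inner ℝ (momentum (phaseAffine h b x)) y / hstar h : ℝ) : ℂ)) *
        ((Real.exp (-‖y - position (phaseAffine h b x)‖ ^ 2 / (2 * hstar h)) : ℝ) : ℂ) * ψ y‖ =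
      Real.exp (-(∑ j, x (Sum.inr j) ^ 2) / 2) *
        ‖expIntegral volume (coherentForm h b) (coherentWeight h b ψ) x‖ := by
  have hs := phaseScale_pos hh
  have hsq := phaseScale_sq hh
  have hpt : ∀ y : EuclideanSpace ℝ (Fin n),
      Complex.exp (Complex.I * ((inner ℝ (momentum (phaseAffine h b x)) y / hstar h : ℝ) : ℂ)) *
        ((Real.exp (-‖y - position (phaseAffine h b x)‖ ^ 2 / (2 * hstar h)) : ℝ) : ℂ) * ψ y =
      (Complex.exp (Complex.I * ((∑ j, x (Sum.inl j) * b (Sum.inr j) / phaseScale h : ℝ) : ℂ)) *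
        ((Real.exp (-(∑ j, x (Sum.inr j) ^ 2) / 2) : ℝ) : ℂ)) *
      (Complex.exp (coherentForm h b y x) • coherentWeight h b ψ y) := fun y => by
    rw [coherentWeight, smul_eq_mul, ← mul_assoc, ← mul_assoc, ← mul_assoc]
    congr 1
    simp only [Complex.ofReal_exp, ← Complex.exp_add]
    congr 1
    rw [coherentForm_apply, EuclideanSpace.real_norm_sq_eq, EuclideanSpace.real_norm_sq_eq,
      ← hsq]
    simp only [PiLp.inner_apply, momentum, position, phaseAffine, PiLp.add_apply, PiLp.smul_apply,
      PiLp.sub_apply, smul_eq_mul, RCLike.inner_apply, conj_trivial]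
    have hsc : (phaseScale h : ℂ) ≠ 0 := Complex.ofReal_ne_zero.2 hs.ne'
    push_cast
    simp only [Finset.sum_div, Finset.mul_sum, ← Finset.sum_neg_distrib, ← Finset.sum_add_distrib]
    refine Finset.sum_congr rfl fun j _ => ?_
    field_simp
    ring
  simp_rw [hpt]
  rw [integral_const_mul, norm_mul, norm_mul, norm_exp_I_mul_ofReal, one_mul, Complex.norm_real,
    Real.norm_of_nonneg (Real.exp_pos _).le, expIntegral]

/-- The rescaled phase space density is the squared modulus of a holomorphic function. -/
theorem rescaledDensity_eq_norm_sq (hh : 0 < h) (b : PhaseSpace n)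
    (ψ : EuclideanSpace ℝ (Fin n) → ℂ) (x : Fin n ⊕ Fin n → ℝ) :
    rescaledDensity h (phaseDensity h ψ) b x = ‖coherentHolo h b ψ x‖ ^ 2 := by
  rw [rescaledDensity, phaseDensity, coherentTransform, norm_mul, norm_mul, norm_exp_I_mul_ofReal,
    mul_one, norm_integral_coherent hh, coherentHolo, norm_mul, norm_mul, Complex.norm_exp]
  have h1 : (∑ j, -(1 / 4) * (phaseForm j x * phaseForm j x)).re =
      (∑ j, x (Sum.inl j) ^ 2 - ∑ j, x (Sum.inr j) ^ 2) / 4 := by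
    rw [Complex.re_sum, ← Finset.sum_sub_distrib, Finset.sum_div]
    refine Finset.sum_congr rfl fun j _ => ?_
    rw [phaseForm_apply]
    simp only [Complex.mul_re, Complex.mul_im, Complex.add_re, Complex.add_im, Complex.ofReal_re,
      Complex.ofReal_im, Complex.I_re, Complex.I_im, Complex.neg_re, Complex.neg_im]
    norm_num
    ring
  -- After the factor exp(−|q|²) the weight exp((|p|² + |q|²)/2) becomes exp((|p|² − |q|²)/2), the
  -- squared modulus of exp(−¼ ∑ (qⱼ + ipⱼ)²). This makes the prefactor holomorphic.
  have h2 : expWeight x * Real.exp (-(∑ j, x (Sum.inr j) ^ 2) / 2) ^ 2 =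
      Real.exp ((∑ j, x (Sum.inl j) ^ 2 - ∑ j, x (Sum.inr j) ^ 2) / 4) ^ 2 := by
    rw [expWeight, ← Real.exp_nat_mul, ← Real.exp_nat_mul, ← Real.exp_add, Fintype.sum_sum_type]
    congr 1
    push_cast
    ring
  rw [h1, mul_pow, mul_pow, mul_pow, mul_pow, ← h2]
  ring

end coherent

/-! ### The rescaled density at the barycenter -/

section barycenter

variable {n : ℕ} {h : ℝ}

lemma phaseAffine_apply (b : PhaseSpace n) (x : Fin n ⊕ Fin n → ℝ) (i : Fin n ⊕ Fin n) :
    phaseAffine h b x i = phaseScale h * x i + b i := by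
  simp [phaseAffine]

/-- The rescaled phase space density, centred at the barycenter, is a Laplacian density. -/
theorem isLaplacianDensity_rescaledDensity (hh : 0 < h) {ψ : EuclideanSpace ℝ (Fin n) → ℂ}
    (hψ : MemLp ψ 2 volume) {ρ : PhaseSpace n → ℝ} (hρ : ρ = phaseDensity h ψ)
    (hprob : ∫ z, ρ z ∂(phaseMeasure n h) = 1)
    (hmom : Integrable (fun z => ‖z‖ ^ 2 * ρ z) (phaseMeasure n h)) :
    IsLaplacianDensity (rescaledDensity h ρ (barycenter h ρ)) := by
  set b := barycenter h ρ with hb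
  set f := rescaledDensity h ρ b with hf
  have hs := phaseScale_pos hh
  have hG := isHolomorphic_coherentHolo hh b hψ
  have hfG : f = fun x => ‖coherentHolo h b ψ x‖ ^ 2 := by
    funext x
    rw [hf, hρ, rescaledDensity_eq_norm_sq hh]
  have hf0 : ∀ x, 0 ≤ f x := fun x => by rw [hfG]; positivity
  have hfc : ContDiff ℝ ∞ f := by rw [hfG]; exact hG.contDiff.norm_sq ℝ
  have hone : ∫ x, f x ∂(gaussPi (Fin n ⊕ Fin n)) = 1 := by
    rw [← hprob, integral_phaseMeasure hh b]
    rfl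
  -- A nonintegrable function has Bochner integral 0, so total mass 1 already forces integrability.
  have hfi : Integrable f (gaussPi (Fin n ⊕ Fin n)) :=
    Integrable.of_integral_ne_zero (by rw [hone]; exact one_ne_zero)
  have hm : Integrable (fun x => ‖phaseAffine h b x‖ ^ 2 * f x) (gaussPi (Fin n ⊕ Fin n)) := by
    rw [integrable_phaseMeasure_iff hh b] at hmom
    refine hmom.congr (ae_of_all _ fun x => ?_)
    simp only [smul_eq_mul, hf, rescaledDensity]
    ring
  have hcoord : ∀ x i, (phaseScale h * x i + b i) ^ 2 ≤ ‖phaseAffine h b x‖ ^ 2 := fun x i => by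
    rw [← phaseAffine_apply, ← sq_abs]
    exact pow_le_pow_left₀ (abs_nonneg _) (PiLp.norm_apply_le (phaseAffine h b x) i) 2
  refine ⟨hfc, hf0, fun x => ?_, fun x => ?_, hfi, hone, fun i => ?_, fun i => ?_⟩
  · rw [hfG]
    exact hG.sum_sq_norm_sq x
  · rw [hfG, hG.laplacian_norm_sq]
    exact Finset.sum_nonneg fun j _ => by positivity
  · refine ((hm.add (hfi.const_mul (b i ^ 2))).const_mul (2 / phaseScale h ^ 2)).mono'
      (((measurable_pi_apply i).pow_const 2).mul hfc.continuous.measurable).aestronglyMeasurable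
      (ae_of_all _ fun x => ?_)
    rw [Real.norm_of_nonneg (mul_nonneg (sq_nonneg _) (hf0 x)), Pi.add_apply, ← add_mul, ← mul_assoc]
    refine mul_le_mul_of_nonneg_right ?_ (hf0 x)
    rw [div_mul_eq_mul_div, le_div_iff₀ (by positivity)]
    nlinarith [hcoord x i, sq_nonneg (phaseScale h * x i + 2 * b i)]
  · have hbx : Integrable (fun x => f x • phaseAffine h b x) (gaussPi (Fin n ⊕ Fin n)) := by
      have hmeas : Measurable (phaseAffine h b) := (measurableEmbedding_phaseAffine hh b).measurable
      refine (hfi.add hm).mono' (hfc.continuous.measurable.smul hmeas).aestronglyMeasurable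
        (ae_of_all _ fun x => ?_)
      rw [norm_smul, Real.norm_of_nonneg (hf0 x), Pi.add_apply]
      nlinarith [mul_nonneg (hf0 x) (sq_nonneg (‖phaseAffine h b x‖ - 1)),
        mul_nonneg (hf0 x) (sq_nonneg ‖phaseAffine h b x‖), hf0 x]
    -- In rescaled coordinates the definition of the barycenter says that √(h/2π) x + b has mean b,
    -- that is, x has mean zero.
    have hbar : b = ∫ x, f x • phaseAffine h b x ∂(gaussPi (Fin n ⊕ Fin n)) := by
      conv_lhs => rw [hb, barycenter, integral_phaseMeasure hh b]
      refine integral_congr_ae (ae_of_all _ fun x => ?_)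
      simp only [smul_smul, hf, rescaledDensity]
    have hbi := (EuclideanSpace.proj i : PhaseSpace n →L[ℝ] ℝ).integral_comp_comm hbx
    rw [← hbar] at hbi
    have hbx' := (EuclideanSpace.proj i : PhaseSpace n →L[ℝ] ℝ).integrable_comp hbx
    simp only [PiLp.proj_apply, PiLp.smul_apply, smul_eq_mul, phaseAffine_apply]
      at hbi hbx'
    have hxi : Integrable (fun x => f x * (phaseScale h * x i + b i) - b i * f x)
        (gaussPi (Fin n ⊕ Fin n)) := hbx'.sub (hfi.const_mul _)
    have e1 : ∫ x, x i * f x ∂(gaussPi (Fin n ⊕ Fin n)) = (phaseScale h)⁻¹ *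
        ∫ x, (f x * (phaseScale h * x i + b i) - b i * f x) ∂(gaussPi (Fin n ⊕ Fin n)) := by
      rw [← integral_const_mul]
      refine integral_congr_ae (ae_of_all _ fun x => ?_)
      simp only
      field_simp
      ring
    rw [e1, integral_sub hbx' (hfi.const_mul _), hbi, integral_const_mul, hone]
    ring

end barycenter

/-! ### Transfer of the Poincaré inequality -/

section poincare

variable {n : ℕ} {h : ℝ}

/-- Recentring: the coordinates of a phase space point relative to `b / √(h / 2π)`. -/
def recentre (h : ℝ) (b z : PhaseSpace n) : Fin n ⊕ Fin n → ℝ :=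
  fun i => z i - b i / phaseScale h

lemma measurable_recentre (b : PhaseSpace n) : Measurable (recentre h b) := by
  unfold recentre
  fun_prop

/-- For every a, the measure with density `rescaledDensity h ρ a` is the image of ρ dμ_h under w ↦
(w − a)/√(h/2π), so changing a is a translation. The Poincaré inequality assumed at a = 0 is thereby
available at the barycenter. -/
lemma map_recentre (hh : 0 < h) {ρ : PhaseSpace n → ℝ} (b : PhaseSpace n)
    (hm0 : Measurable (rescaledDensity h ρ 0)) (hmb : Measurable (rescaledDensity h ρ b)) :
    (rescaledMeasure h ρ 0).map (recentre h b) = gaussDensity (rescaledDensity h ρ b) := by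
  have hs := phaseScale_pos hh
  have hml : Measurable (WithLp.toLp 2 : (Fin n ⊕ Fin n → ℝ) → PhaseSpace n) :=
    (MeasurableEquiv.toLp 2 (Fin n ⊕ Fin n → ℝ)).measurable
  have hkey : ∀ (a : PhaseSpace n) (k : (Fin n ⊕ Fin n → ℝ) → ℝ≥0∞), Measurable k →
      Measurable (rescaledDensity h ρ a) →
      ∫⁻ x, k x ∂(gaussDensity (rescaledDensity h ρ a)) =
      ∫⁻ w, ENNReal.ofReal (ρ w) * k (fun i => (w i - a i) / phaseScale h) ∂(phaseMeasure n h) :=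
    fun a k hk hma => by
      rw [gaussDensity, lintegral_withDensity_eq_lintegral_mul _ hma.ennreal_ofReal hk,
        lintegral_phaseMeasure hh a]
      refine lintegral_congr fun x => ?_
      rw [Pi.mul_apply, rescaledDensity, ENNReal.ofReal_mul (expWeight_pos x).le, mul_assoc]
      congr 3
      funext i
      rw [phaseAffine_apply]
      field_simp
      ring
  refine Measure.ext_of_lintegral _ fun k hk => ?_
  have hkr : Measurable fun z : PhaseSpace n => k (recentre h b z) :=
    hk.comp (measurable_recentre b)
  rw [lintegral_map hk (measurable_recentre b), rescaledMeasure_eq_map,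
    lintegral_map hkr hml, hkey b k hk hmb,
    hkey 0 (fun x => k (recentre h b (WithLp.toLp 2 x)))
      (hk.comp ((measurable_recentre b).comp hml)) hm0]
  refine lintegral_congr fun w => ?_
  congr 2
  funext i
  simp [recentre, sub_div]

lemma hasFDerivAt_recentre (b z : PhaseSpace n) : HasFDerivAt (recentre h b)
    (PiLp.continuousLinearEquiv 2 ℝ (fun _ : Fin n ⊕ Fin n => ℝ) :
      PhaseSpace n →L[ℝ] (Fin n ⊕ Fin n → ℝ)) z :=
  ((PiLp.continuousLinearEquiv 2 ℝ (fun _ : Fin n ⊕ Fin n => ℝ)).hasFDerivAt (x := z)).sub_const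
    (fun i => b i / phaseScale h)

lemma contDiff_recentre (b : PhaseSpace n) : ContDiff ℝ ∞ (recentre h b) :=
  ((PiLp.continuousLinearEquiv 2 ℝ (fun _ : Fin n ⊕ Fin n => ℝ)).contDiff).sub contDiff_const

lemma norm_gradient_comp_recentre_sq {u : (Fin n ⊕ Fin n → ℝ) → ℝ} (hu : Differentiable ℝ u)
    (m : ℝ) (b z : PhaseSpace n) :
    ‖gradient (fun z => u (recentre h b z) - m) z‖ ^ 2 =
      ∑ i, pderivAt i u (recentre h b z) ^ 2 := by
  have hd : HasFDerivAt (fun z => u (recentre h b z) - m)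
      ((fderiv ℝ u (recentre h b z)).comp
        (PiLp.continuousLinearEquiv 2 ℝ (fun _ : Fin n ⊕ Fin n => ℝ) :
          PhaseSpace n →L[ℝ] (Fin n ⊕ Fin n → ℝ))) z :=
    ((hu (recentre h b z)).hasFDerivAt.comp z (hasFDerivAt_recentre (h := h) b z)).sub_const m
  rw [EuclideanSpace.real_norm_sq_eq]
  refine Finset.sum_congr rfl fun i _ => ?_
  have h1 : (gradient (fun z => u (recentre h b z) - m) z) i =
      inner ℝ (gradient (fun z => u (recentre h b z) - m) z) (EuclideanSpace.single i (1 : ℝ)) := by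
    rw [EuclideanSpace.inner_single_right]
    simp
  rw [h1, inner_gradient_left, hd.fderiv]
  simp [pderivAt]
  rfl

/-- The Poincaré inequality for the recentred measure, in coordinates. -/
theorem poincare_gaussDensity (hh : 0 < h) {lam : ℝ} (hlam : 0 < lam) {ρ : PhaseSpace n → ℝ}
    (b : PhaseSpace n)
    (hm0 : Measurable (rescaledDensity h ρ 0)) (hf : IsLaplacianDensity (rescaledDensity h ρ b))
    (hP : SatisfiesPoincare (rescaledMeasure h ρ 0) lam) (u : (Fin n ⊕ Fin n → ℝ) → ℝ)
    (hu : IsTestFunction u) :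
    lam * (∫ x, u x ^ 2 ∂(gaussDensity (rescaledDensity h ρ b)) -
        (∫ x, u x ∂(gaussDensity (rescaledDensity h ρ b))) ^ 2) ≤
      ∫ x, ∑ i, pderivAt i u x ^ 2 ∂(gaussDensity (rescaledDensity h ρ b)) := by
  have hmap := map_recentre hh b hm0 hf.measurable
  set ν := gaussDensity (rescaledDensity h ρ b) with hν
  have hνp : IsProbabilityMeasure ν := hf.isProbabilityMeasure
  have hrm := measurable_recentre (h := h) b
  have h0p : IsProbabilityMeasure (rescaledMeasure h ρ 0) := by
    refine ⟨?_⟩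
    have : ν univ = 1 := measure_univ
    rwa [← hmap, Measure.map_apply hrm MeasurableSet.univ, preimage_univ] at this
  set m := ∫ x, u x ∂ν with hm
  obtain ⟨C, hC⟩ := hu.bounded
  obtain ⟨C', hC'⟩ := hu.bounded_pderivAt
  have hud : Differentiable ℝ u := hu.contDiff.differentiable (by simp)
  have hu2 : MemLp u 2 ν := hu.memLp
  have hui : Integrable (fun z => u (recentre h b z)) (rescaledMeasure h ρ 0) :=
    Integrable.of_bound (hu.measurable.comp hrm).aestronglyMeasurable C
      (ae_of_all _ fun z => hC _)
  have hmean : ∫ z, (u (recentre h b z) - m) ∂(rescaledMeasure h ρ 0) = 0 := by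
    rw [integral_sub hui (integrable_const _), integral_const, probReal_univ, one_smul,
      hm, ← hmap, integral_map hrm.aemeasurable hu.measurable.aestronglyMeasurable, sub_self]
  have key := hP (fun z => u (recentre h b z) - m)
    ((hu.contDiff.comp (contDiff_recentre b)).sub contDiff_const)
    (hui.sub (integrable_const _)) hmean
  simp_rw [norm_gradient_comp_recentre_sq hud] at key
  have hg1 : Measurable fun x => ENNReal.ofReal ((u x - m) ^ 2) :=
    ((hu.measurable.sub_const m).pow_const 2).ennreal_ofReal
  have hg2m : Measurable fun x => ∑ i, pderivAt i u x ^ 2 :=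
    (continuous_finsetSum _ fun i _ =>
      ((contDiff_pderivAt hu.contDiff i).continuous.pow 2)).measurable
  rw [← lintegral_map (f := fun x => ENNReal.ofReal ((u x - m) ^ 2)) hg1 hrm,
    ← lintegral_map (f := fun x => ENNReal.ofReal (∑ i, pderivAt i u x ^ 2))
      hg2m.ennreal_ofReal hrm, hmap] at key
  have i1 : Integrable (fun x => (u x - m) ^ 2) ν := (hu2.sub (memLp_const m)).integrable_sq
  have i2 : Integrable (fun x => ∑ i, pderivAt i u x ^ 2) ν := by
    refine integrable_finsetSum _ fun i _ => ?_
    exact (MemLp.of_bound (contDiff_pderivAt hu.contDiff i).continuous.aestronglyMeasurable C'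
      (ae_of_all _ fun x => hC' i x)).integrable_sq
  have n2 : ∀ x, 0 ≤ ∑ i, pderivAt i u x ^ 2 := fun x => Finset.sum_nonneg fun i _ => sq_nonneg _
  rw [← ofReal_integral_eq_lintegral_ofReal i1 (ae_of_all _ fun x => sq_nonneg _),
    ← ofReal_integral_eq_lintegral_ofReal i2 (ae_of_all _ n2), ← ENNReal.ofReal_mul hlam.le,
    ENNReal.ofReal_le_ofReal_iff (integral_nonneg n2)] at key
  have hvar : ∫ x, (u x - m) ^ 2 ∂ν = ∫ x, u x ^ 2 ∂ν - m ^ 2 := by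
    have h1 := variance_eq_sub hu2
    rw [variance_eq_integral hu.measurable.aemeasurable] at h1
    simpa using h1
  rwa [hvar] at key

end poincare

/-! ### The Wehrl deficit and the transport bound -/

section deficit

variable {n : ℕ} {h : ℝ}

lemma IsLaplacianDensity.integral_eq_toReal {ι : Type} [Fintype ι] [DecidableEq ι]
    {f : (ι → ℝ) → ℝ} (hf : IsLaplacianDensity f)
    (hfin : ∫⁻ x, ENNReal.ofReal (klFun (f x)) ∂(gaussPi ι) ≠ ⊤) :
    Integrable (fun x => f x * Real.log (f x)) (gaussPi ι) ∧
      ∫ x, f x * Real.log (f x) ∂(gaussPi ι) =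
        (∫⁻ x, ENNReal.ofReal (klFun (f x)) ∂(gaussPi ι)).toReal := by
  have hk0 : ∀ x, 0 ≤ klFun (f x) := fun x => klFun_nonneg (hf.nonneg x)
  have hkm : Measurable fun x => klFun (f x) := measurable_klFun.comp hf.measurable
  have hk : Integrable (fun x => klFun (f x)) (gaussPi ι) :=
    integrable_of_lintegral_ofReal hkm.aestronglyMeasurable hk0 hfin
  have hk1 : Integrable (fun x => klFun (f x) + f x) (gaussPi ι) := hk.fun_add hf.integrable
  have e : (fun x => f x * Real.log (f x)) = fun x => klFun (f x) + f x - 1 := by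
    funext x
    rw [klFun]
    ring
  rw [e]
  refine ⟨hk1.sub (integrable_const _), ?_⟩
  rw [integral_sub hk1 (integrable_const _), integral_add hk hf.integrable, hf.integral_eq_one,
    integral_const, probReal_univ, integral_eq_lintegral_of_nonneg_ae (ae_of_all _ hk0)
      hkm.aestronglyMeasurable]
  simp

/-- The deficit of a phase space density in terms of its rescaled density. -/
lemma wehrlDeficit_eq (hh : 0 < h) {ρ : PhaseSpace n → ℝ} {b : PhaseSpace n}
    (hf : IsLaplacianDensity (rescaledDensity h ρ b))
    (hfin : ∫⁻ x, ENNReal.ofReal (klFun (rescaledDensity h ρ b x)) ∂(gaussPi (Fin n ⊕ Fin n)) ≠ ⊤) :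
    Integrable (fun z => ρ z * Real.log (ρ z)) (phaseMeasure n h) ∧
      wehrlDeficit h ρ =
        1 / 2 * ∑ i, ∫ x, (x i ^ 2 - 1) * rescaledDensity h ρ b x ∂(gaussPi (Fin n ⊕ Fin n)) -
        (∫⁻ x, ENNReal.ofReal (klFun (rescaledDensity h ρ b x))
          ∂(gaussPi (Fin n ⊕ Fin n))).toReal := by
  obtain ⟨hl, hle⟩ := hf.integral_eq_toReal hfin
  have hsq : Integrable (fun x => ∑ i, x i ^ 2 * rescaledDensity h ρ b x)
      (gaussPi (Fin n ⊕ Fin n)) := integrable_finsetSum _ fun i _ => hf.integrable_sq i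
  have e : ∀ x, expWeight x • (ρ (phaseAffine h b x) * Real.log (ρ (phaseAffine h b x))) =
      rescaledDensity h ρ b x * Real.log (rescaledDensity h ρ b x) -
        1 / 2 * ∑ i, x i ^ 2 * rescaledDensity h ρ b x := fun x => by
    rw [← Finset.sum_mul, rescaledDensity, smul_eq_mul]
    rcases eq_or_ne (ρ (phaseAffine h b x)) 0 with h0 | h0
    · simp [h0]
    · rw [Real.log_mul (expWeight_pos x).ne' h0, expWeight, Real.log_exp]
      ring
  have hi : Integrable (fun z => ρ z * Real.log (ρ z)) (phaseMeasure n h) := by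
    rw [integrable_phaseMeasure_iff hh b]
    simp_rw [e]
    exact hl.sub (hsq.const_mul _)
  refine ⟨hi, ?_⟩
  have hm : ∀ i, ∫ x, (x i ^ 2 - 1) * rescaledDensity h ρ b x ∂(gaussPi (Fin n ⊕ Fin n)) =
      ∫ x, x i ^ 2 * rescaledDensity h ρ b x ∂(gaussPi (Fin n ⊕ Fin n)) - 1 := fun i => by
    simp_rw [sub_mul, one_mul]
    rw [integral_sub (hf.integrable_sq i) hf.integrable, hf.integral_eq_one]
  -- There are 2n coordinates, each with a −1 in its moment; the factor 1/2 turns these into the −n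
  -- of the deficit.
  rw [wehrlDeficit, entropy, integral_phaseMeasure hh b]
  simp_rw [e, hm]
  rw [integral_sub hl (hsq.const_mul _), hle, integral_const_mul,
    integral_finsetSum _ fun i _ => hf.integrable_sq i, Finset.sum_sub_distrib]
  simp
  ring

/-- Talagrand's inequality for the quadratic Wasserstein distance to the Gaussian. -/
lemma W2_le {f : (Fin n ⊕ Fin n → ℝ) → ℝ} (hf : IsLaplacianDensity f) :
    W2 ((gaussDensity f).map (WithLp.toLp 2)) (gaussian n) ≤
      (2 * ∫⁻ x, ENNReal.ofReal (klFun (f x)) ∂(gaussPi (Fin n ⊕ Fin n))) ^ (1 / 2 : ℝ) := by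
  obtain ⟨T, hT, hpush, hcost⟩ := exists_transport hf.measurable hf.nonneg hf.lintegral_eq_one
    fun i => (hf.integrable_sq i).lintegral_lt_top.ne
  have hml : Measurable (WithLp.toLp 2 : (Fin n ⊕ Fin n → ℝ) → PhaseSpace n) :=
    (MeasurableEquiv.toLp 2 (Fin n ⊕ Fin n → ℝ)).measurable
  have hTl : Measurable fun x => (WithLp.toLp 2 (T x) : PhaseSpace n) := hml.comp hT
  have hmap : (gaussDensity f).map T = gaussPi (Fin n ⊕ Fin n) := by
    refine Measure.ext_of_lintegral _ fun g hg => ?_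
    have hgT : Measurable fun x => g (T x) := hg.comp hT
    rw [lintegral_map hg hT, gaussDensity,
      lintegral_withDensity_eq_lintegral_mul _ hf.measurable.ennreal_ofReal hgT]
    exact hpush g hg
  -- The coupling is the law of (x, T x) under fγ, T being the Knothe map.
  refine iInf₂_le_of_le ((gaussDensity f).map fun x =>
    ((WithLp.toLp 2 x : PhaseSpace n), (WithLp.toLp 2 (T x) : PhaseSpace n))) ⟨?_, ?_⟩ ?_
  · rw [Measure.map_map measurable_fst (hml.prodMk hTl)]
    rfl
  · rw [Measure.map_map measurable_snd (hml.prodMk hTl), gaussian_eq_map, ← hmap,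
      Measure.map_map hml hT]
    rfl
  · refine ENNReal.rpow_le_rpow (le_trans (le_of_eq ?_) hcost) (by norm_num)
    have hed : Measurable fun w : PhaseSpace n × PhaseSpace n => edist w.1 w.2 ^ 2 :=
      measurable_edist.pow_const 2
    have hsum : Measurable fun x => ∑ i, ENNReal.ofReal ((x i - T x i) ^ 2) := by fun_prop
    have e : ∀ x, edist (WithLp.toLp 2 x : PhaseSpace n) (WithLp.toLp 2 (T x)) ^ 2 =
        ∑ i, ENNReal.ofReal ((x i - T x i) ^ 2) := fun x => by
      rw [edist_dist, ← ENNReal.ofReal_pow dist_nonneg, EuclideanSpace.dist_sq_eq,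
        ENNReal.ofReal_sum_of_nonneg fun i _ => sq_nonneg _]
      simp [Real.dist_eq, sq_abs]
    rw [lintegral_map hed (hml.prodMk hTl)]
    simp_rw [e]
    rw [gaussDensity, lintegral_withDensity_eq_lintegral_mul _ hf.measurable.ennreal_ofReal hsum]
    rfl

end deficit

/-- Stability of the Wehrl entropy bound under a Poincaré inequality. -/
theorem c2Const_mul_W2_sq_le_wehrlDeficit {n : ℕ} {h : ℝ} (hh : 0 < h) {lam : ℝ} (hlam : 0 < lam)
    {ψ : EuclideanSpace ℝ (Fin n) → ℂ} (hψ : MemLp ψ 2 volume)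
    {ρ : PhaseSpace n → ℝ} (hρ : ρ = phaseDensity h ψ)
    (hprob : ∫ z, ρ z ∂(phaseMeasure n h) = 1)
    (hmom : Integrable (fun z => ‖z‖ ^ 2 * ρ z) (phaseMeasure n h))
    (hpoinc : SatisfiesPoincare (rescaledMeasure h ρ 0) lam) :
    Integrable (fun z => ρ z * Real.log (ρ z)) (phaseMeasure n h) ∧
    W2 (rescaledMeasure h ρ (barycenter h ρ))
      (gaussian n) ≠ ⊤ ∧
    c2Const lam *
      (W2 (rescaledMeasure h ρ (barycenter h ρ))
        (gaussian n)).toReal ^ 2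
      ≤ wehrlDeficit h ρ := by
  have hf := isLaplacianDensity_rescaledDensity hh hψ hρ hprob hmom
  have hm0 : Measurable (rescaledDensity h ρ 0) := by
    have : rescaledDensity h ρ 0 = fun x => ‖coherentHolo h 0 ψ x‖ ^ 2 := by
      funext x
      rw [hρ, rescaledDensity_eq_norm_sq hh]
    rw [this]
    exact ((isHolomorphic_coherentHolo hh 0 hψ).contDiff.norm_sq ℝ).continuous.measurable
  have hkl := hf.lintegral_klFun_le hlam fun u hu =>
    poincare_gaussDensity hh hlam _ hm0 hf hpoinc u hu
  have hfin := ne_top_of_le_ne_top ENNReal.ofReal_ne_top hkl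
  obtain ⟨hint, hdef⟩ := wehrlDeficit_eq hh hf hfin
  have hW := W2_le hf
  rw [← rescaledMeasure_eq_map] at hW
  have hWtop := ENNReal.rpow_ne_top_of_nonneg (y := 1 / 2) (by norm_num)
    (ENNReal.mul_ne_top (a := 2) (by norm_num) hfin)
  refine ⟨hint, ne_top_of_le_ne_top hWtop hW, ?_⟩
  obtain ⟨hc0, hc1⟩ := cConst_mem hlam
  have hM := hf.sum_moment_nonneg
  have hH := ENNReal.toReal_mono ENNReal.ofReal_ne_top hkl
  rw [ENNReal.toReal_ofReal (by positivity)] at hH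
  have hW2 := pow_le_pow_left₀ ENNReal.toReal_nonneg (ENNReal.toReal_mono hWtop hW) 2
  rw [← ENNReal.toReal_rpow, ← Real.sqrt_eq_rpow, Real.sq_sqrt ENNReal.toReal_nonneg,
    ENNReal.toReal_mul, ENNReal.toReal_ofNat] at hW2
  rw [hdef, c2Const]
  have hc2 : 0 ≤ 1 / cConst lam - 1 := by
    rw [sub_nonneg, le_div_iff₀ hc0]
    linarith
  have h1 := mul_le_mul_of_nonneg_left hW2 (mul_nonneg (by norm_num : (0 : ℝ) ≤ 1 / 2) hc2)
  refine h1.trans ?_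
  -- Dividing the entropy bound by c(λ) gives H/c(λ) ≤ M/2, so (1/c(λ) − 1) H ≤ M/2 − H, which is
  -- the deficit.
  have h2 := mul_le_mul_of_nonneg_left hH (one_div_pos.2 hc0).le
  have h3 : ∀ M : ℝ, 1 / cConst lam * (1 / 2 * (cConst lam * M)) = 1 / 2 * M := fun M => by
    field_simp
  rw [h3] at h2
  linarith

end WehrlStability

end

theorem mainTheorem9 (n : ℕ) (h : ℝ) (hh : 0 < h) (lam : ℝ) (hlam : 0 < lam)
    (ψ : EuclideanSpace ℝ (Fin n) → ℂ) (hψ : MemLp ψ 2 volume)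
    (ρ : WehrlStability.PhaseSpace n → ℝ) (hρ : ρ = WehrlStability.phaseDensity h ψ)
    (hprob : ∫ z, ρ z ∂(WehrlStability.phaseMeasure n h) = 1)
    (hmom : Integrable (fun z => ‖z‖ ^ 2 * ρ z) (WehrlStability.phaseMeasure n h))
    (hpoinc : WehrlStability.SatisfiesPoincare (WehrlStability.rescaledMeasure h ρ 0) lam) :
    Integrable (fun z => ρ z * Real.log (ρ z)) (WehrlStability.phaseMeasure n h) ∧
    WehrlStability.W2 (WehrlStability.rescaledMeasure h ρ (WehrlStability.barycenter h ρ))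
      (WehrlStability.gaussian n) ≠ ⊤ ∧
    WehrlStability.c2Const lam *
      (WehrlStability.W2 (WehrlStability.rescaledMeasure h ρ (WehrlStability.barycenter h ρ))
        (WehrlStability.gaussian n)).toReal ^ 2
      ≤ WehrlStability.wehrlDeficit h ρ :=
  WehrlStability.c2Const_mul_W2_sq_le_wehrlDeficit hh hlam hψ hρ hprob hmom hpoinc
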